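/- **Setting.** Let $f:\mathbb R\to\mathbb R$ be smooth, and let $\hat u(x-ct)$ be a travelling wave of $u_t=u_{xx}+f(u)$ with a smooth profile that satisfies $\hat u''+c\hat u'+f(\hat u)=0$, $\hat u(\xi)\to\hat u_\pm$ and $\hat u^{(p)}(\xi)\to0$ ($p\ge1$) as $\xi\to\pm\infty$. Put $\phi=f'\circ\hat u$, and assume that $\phi-f'(\hat u_-)$ is integrable on $(-\infty,0]$, that $\phi-f'(\hat u_+)$ is integrable on $[0,\infty)$, and that all derivatives of $\phi$ are integrable on $\mathbb R$. For $\lambda\in\mathbb C$ consider $$y'=A(\xi;\lambda)y,\qquad A=\begin{bmatrix}0&1\\ \lambda-\phi(\xi)&-c\end{bmatrix},\qquad \kappa_\pm=\sqrt{c^2+4(\lambda-f'(\hat u_\pm))},\qquad \mu^{[1]}_\pm,\mu^{[2]}_\pm=\tfrac12(-c\pm'\kappa_\pm),$$ where $\pm'$ is $+$ for $\mu^{[1]}_\pm$ and $-$ for $\mu^{[2]}_\pm$ and the square root is the principal one, and let $B_\pm=\begin{bmatrix}1&1\\ \mu_\pm^{[1]}&\mu_\pm^{[2]}\end{bmatrix}$.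 Let $y_-$ be the solution that decays at $-\infty$, written $y_-=e^{\mu_-^{[1]}\xi}B_-\bar y_-$ and normalised by $\bar y_-\to(1,0)^\top$ as $\xi\to-\infty$; let $y_+$ be the solution that decays at $+\infty$, written $y_+=e^{\mu_+^{[2]}\xi}B_+\bar y_+$ and normalised by $\bar y_+\to(0,1)^\top$ as $\xi\to+\infty$. The Evans function is $D(\lambda)=\det[\,y_-(0),y_+(0)\,]$. **Method.** The two-stage (fourth-order) Gauss–Legendre Runge–Kutta method is applied to the rescaled equations $\bar y_-'=(B_-^{-1}AB_--\mu_-^{[1]}I)\bar y_-$ on $[-L,0]$ with step $h$, and $\bar y_+'=(B_+^{-1}AB_+-\mu_+^{[2]}I)\bar y_+$ on $[0,L]$, backwards from $L$, with step $-h$. It starts from the exact values at $\mp L$. Here $L=L(h)=N(h)h$ with $N(h)\in\mathbb N$ is so large that the derivatives of $\phi$ at $\pm L$ are negligible: $\phi^{(p)}(\pm L(h))=O(h^M)$ as $h\to0$ for all $p\ge1$ and all $M$. Let $z^\pm_k$ be the numerical values after $k$ steps ($0\le k\le N$), and let $$E_D=\det[\,B_-z^-_N,\;B_+z^+_N\,]-D(\lambda).$$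 The local error is the error of one step that starts from the exact $\bar y_\pm$ at a grid point; the global error is $z_k^\pm$ minus the exact $\bar y_\pm$ at the corresponding grid point. The nonstiff component is the first one for $\bar y_-$ and the second one for $\bar y_+$; the other one is stiff. **Claim.** Fix $\varepsilon>0$ and consider the regime $h\to0$, $|\lambda|\gg h^{-2}$, $|\arg\lambda|<\pi-\varepsilon$: "in the regime" means that there are $K,h_0>0$ such that the statement holds for all $0<h<h_0$ and all $\lambda$ with $|\arg\lambda|<\pi-\varepsilon$ and $|\lambda|h^2\ge K$, with constants independent of $h$, $\lambda$ and $k$. In the regime the steps of the method are uniquely solvable, and the following holds. 1. *No order reduction.* The local errors have nonstiff component $O(|\lambda|^{-1/2}h^5)$ and stiff component $O(|\lambda|^{-1}h^3)$; in particular there is no term of order $\lambda^{-1/2}h^2$, and the local errors are $O(h^5)$. The global errors have nonstiff component $O(|\lambda|^{-1/2}h^4)$ and stiff component $O(|\lambda|^{-1}h^2)$, and so are $O(h^4)$. 2. *Error in the Evans function.* Let $q(h)$ be the error of composite two-point Gauss–Legendre quadrature with cells of length $h$ for $\int_{-L}^{L}\phi$ (quadrature minus integral); it does not depend on $\lambda$.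 Then $$E_D=q(h)+O\bigl(|\lambda|^{-1/2}h^8,\ |\lambda|^{-1}h^4,\ |\lambda|^{-3/2}h^2\bigr)\quad\text{in the regime},$$ and $q$ vanishes at all orders in $h$: $q(h)=O(h^M)$ for every $M$. Consequently, for every $M$, $$E_D=O\bigl(|\lambda|^{-1/2}h^8,\ |\lambda|^{-1}h^4,\ |\lambda|^{-3/2}h^2\bigr)$$ in the part of the regime where $|\lambda|\le h^{-M}$ (with constants that may depend on $M$). Here $O(a,b,c)$ means $O(a+b+c)$. 3. *Comparison.* For fixed $h$ the bound $|\lambda|^{-1/2}h^8+|\lambda|^{-1}h^4+|\lambda|^{-3/2}h^2$ is strictly decreasing in $|\lambda|$ and tends to $0$ as $|\lambda|\to\infty$. The error is of smaller order than the rates $O(h^4)$ of the fourth-order Magnus method and $O(|\lambda|^{-1/2}h^2)$ of the exponential midpoint rule: for every $\eta>0$ one has $|E_D|\le\eta h^4$ in the regime, and, for every $M$, $|E_D|\le\eta|\lambda|^{-1/2}h^2$ in the part of the regime where $|\lambda|\le h^{-M}$ (with $K$ and $h_0$ depending on $\eta$ and $M$). -/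

import Mathlib

open Filter Topology Asymptotics MeasureTheory
open scoped Matrix ContDiff

namespace EvansGL

noncomputable section

/-- `w` is the profile of a travelling wave `u(x,t) = w(x - c t)` of the scalar
reaction-diffusion equation `u_t = u_xx + f(u)`, with end states `wm` at `-∞` and `wp` at `+∞`. -/
structure IsTravellingWave (f w : ℝ → ℝ) (c wm wp : ℝ) : Prop where
  smooth_reaction : ContDiff ℝ ∞ f
  smooth_profile : ContDiff ℝ ∞ w
  profile_eq : ∀ x, iteratedDeriv 2 w x + c * deriv w x + f (w x) = 0
  lim_left : Tendsto w atBot (𝓝 wm)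
  lim_right : Tendsto w atTop (𝓝 wp)
  deriv_lim_left : ∀ p : ℕ, 1 ≤ p → Tendsto (iteratedDeriv p w) atBot (𝓝 0)
  deriv_lim_right : ∀ p : ℕ, 1 ≤ p → Tendsto (iteratedDeriv p w) atTop (𝓝 0)

/-! ### The eigenvalue problem and the rescaled coordinates -/

/-- The matrix `A(x; lam)` of the first-order form `y' = A y` of `U'' + c U' + φ U = lam U`. -/
def evansMatrix (φ : ℝ → ℝ) (c : ℝ) (lam : ℂ) (x : ℝ) : Matrix (Fin 2) (Fin 2) ℂ :=
  !![0, 1; lam - (φ x : ℂ), -(c : ℂ)]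

/-- `κ = √(c² + 4 (lam - p))` (principal square root); `p` is the limit of `φ` at the end of the
line under consideration. -/
def kappa (c p : ℝ) (lam : ℂ) : ℂ := ((c : ℂ) ^ 2 + 4 * (lam - (p : ℂ))) ^ (1 / 2 : ℂ)

/-- The spatial eigenvalue `(-c + κ) / 2`. -/
def muOne (c p : ℝ) (lam : ℂ) : ℂ := (-(c : ℂ) + kappa c p lam) / 2

/-- The spatial eigenvalue `(-c - κ) / 2`. -/
def muTwo (c p : ℝ) (lam : ℂ) : ℂ := (-(c : ℂ) - kappa c p lam) / 2

/-- The matrix `B` of eigenvectors of the limiting matrix. -/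
def eigMatrix (c p : ℝ) (lam : ℂ) : Matrix (Fin 2) (Fin 2) ℂ :=
  !![1, 1; muOne c p lam, muTwo c p lam]

/-- The coordinates `ȳ` of `y`, defined by `y(x) = exp(mu x) B ȳ(x)`. -/
def rescale (c p : ℝ) (lam mu : ℂ) (y : ℝ → Fin 2 → ℂ) (x : ℝ) : Fin 2 → ℂ :=
  Complex.exp (-(mu * (x : ℂ))) • ((eigMatrix c p lam)⁻¹ *ᵥ y x)

/-- The matrix `Ā = B⁻¹ A B - mu I` of the equation `ȳ' = Ā ȳ`. -/
def rescaledMatrix (φ : ℝ → ℝ) (c p : ℝ) (lam mu : ℂ) (x : ℝ) : Matrix (Fin 2) (Fin 2) ℂ :=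
  (eigMatrix c p lam)⁻¹ * evansMatrix φ c lam x * eigMatrix c p lam - mu • 1

/-- Coordinates of `y` in the frame of the left problem (`mu = muOne`). -/
def leftCoords (c p : ℝ) (lam : ℂ) (y : ℝ → Fin 2 → ℂ) : ℝ → Fin 2 → ℂ :=
  rescale c p lam (muOne c p lam) y

/-- Coordinates of `y` in the frame of the right problem (`mu = muTwo`). -/
def rightCoords (c p : ℝ) (lam : ℂ) (y : ℝ → Fin 2 → ℂ) : ℝ → Fin 2 → ℂ :=
  rescale c p lam (muTwo c p lam) y

/-- The matrix of the left problem in its own coordinates. -/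
def leftMatrix (φ : ℝ → ℝ) (c p : ℝ) (lam : ℂ) : ℝ → Matrix (Fin 2) (Fin 2) ℂ :=
  rescaledMatrix φ c p lam (muOne c p lam)

/-- The matrix of the right problem in its own coordinates. -/
def rightMatrix (φ : ℝ → ℝ) (c p : ℝ) (lam : ℂ) : ℝ → Matrix (Fin 2) (Fin 2) ℂ :=
  rescaledMatrix φ c p lam (muTwo c p lam)

/-- The solution that decays at `-∞`, normalised by `ȳ → (1, 0)` there. -/
structure IsLeftSolution (φ : ℝ → ℝ) (c p : ℝ) (lam : ℂ) (y : ℝ → Fin 2 → ℂ) : Prop where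
  ode : ∀ x : ℝ, HasDerivAt y (evansMatrix φ c lam x *ᵥ y x) x
  decay : Tendsto y atBot (𝓝 0)
  normalised : Tendsto (leftCoords c p lam y) atBot (𝓝 ![1, 0])

/-- The solution that decays at `+∞`, normalised by `ȳ → (0, 1)` there. -/
structure IsRightSolution (φ : ℝ → ℝ) (c p : ℝ) (lam : ℂ) (y : ℝ → Fin 2 → ℂ) : Prop where
  ode : ∀ x : ℝ, HasDerivAt y (evansMatrix φ c lam x *ᵥ y x) x
  decay : Tendsto y atTop (𝓝 0)
  normalised : Tendsto (rightCoords c p lam y) atTop (𝓝 ![0, 1])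

/-! ### The two-stage Gauss-Legendre method -/

/-- One step of (signed) size `h`, from `y` at `x` to `y'` at `x + h`, of the two-stage
Gauss-Legendre Runge-Kutta method for the linear equation `y' = A(x) y`. -/
def IsGL4Step (A : ℝ → Matrix (Fin 2) (Fin 2) ℂ) (h x : ℝ) (y y' : Fin 2 → ℂ) : Prop :=
  ∃ s₁ s₂ : Fin 2 → ℂ,
    s₁ = A (x + (1 / 2 - √3 / 6) * h) *ᵥ
      (y + ((1 / 4) * h) • s₁ + ((1 / 4 - √3 / 6) * h) • s₂) ∧
    s₂ = A (x + (1 / 2 + √3 / 6) * h) *ᵥ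
      (y + ((1 / 4 + √3 / 6) * h) • s₁ + ((1 / 4) * h) • s₂) ∧
    y' = y + ((1 / 2) * h) • (s₁ + s₂)

/-- `z 0, …, z N` is produced by `N` steps of size `h` of the method, from `z 0 = y₀` at `x₀`. -/
def IsGL4Run (A : ℝ → Matrix (Fin 2) (Fin 2) ℂ) (h x₀ : ℝ) (N : ℕ) (y₀ : Fin 2 → ℂ)
    (z : ℕ → Fin 2 → ℂ) : Prop :=
  z 0 = y₀ ∧ ∀ k < N, IsGL4Step A h (x₀ + k * h) (z k) (z (k + 1))

/-! ### The Evans function -/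

/-- The wedge product (determinant with columns `a`, `b`). -/
def wedge (a b : Fin 2 → ℂ) : ℂ := Matrix.det !![a 0, b 0; a 1, b 1]

/-- The exact left and right solutions `y`, `yp` (potential `φ` with limits `pm`, `pp` at `∓∞`),
with the Gauss-Legendre approximations `z`, `zp` of their rescaled coordinates on the grids
`-N h + k h` and `N h - k h`, `0 ≤ k ≤ N`, which start from the exact values at `∓ N h`. -/
structure IsComputation (φ : ℝ → ℝ) (c pm pp : ℝ) (lam : ℂ) (h : ℝ) (N : ℕ)
    (y yp : ℝ → Fin 2 → ℂ) (z zp : ℕ → Fin 2 → ℂ) : Prop where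
  left : IsLeftSolution φ c pm lam y
  right : IsRightSolution φ c pp lam yp
  run_left : IsGL4Run (leftMatrix φ c pm lam) h (-(N * h)) N (leftCoords c pm lam y (-(N * h))) z
  run_right : IsGL4Run (rightMatrix φ c pp lam) (-h) (N * h) N (rightCoords c pp lam yp (N * h)) zp

/-- The error in the Evans function: the numerical value `(B z_N) ∧ (B₊ zp_N)` minus the exact
value `y(0) ∧ yp(0)`. -/
def evansError (c pm pp : ℝ) (lam : ℂ) (N : ℕ) (y yp : ℝ → Fin 2 → ℂ)
    (z zp : ℕ → Fin 2 → ℂ) : ℂ :=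
  wedge (eigMatrix c pm lam *ᵥ z N) (eigMatrix c pp lam *ᵥ zp N) - wedge (y 0) (yp 0)

/-- The error of composite two-point Gauss-Legendre quadrature, with `2N` cells of length `h`,
for `∫ φ` over `[-N h, N h]`. -/
def quadratureDefect (φ : ℝ → ℝ) (h : ℝ) (N : ℕ) : ℝ :=
  (∑ j ∈ Finset.range (2 * N), h / 2 *
      (φ (-(N * h) + j * h + (1 / 2 - √3 / 6) * h) + φ (-(N * h) + j * h + (1 / 2 + √3 / 6) * h)))
    - ∫ x in (-(N * h))..(N * h), φ x

/-- The size `|lam|^(-1/2) h⁸ + |lam|^(-1) h⁴ + |lam|^(-3/2) h²`. -/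
def errorScale (h : ℝ) (lam : ℂ) : ℝ :=
  ‖lam‖ ^ (-1 / 2 : ℝ) * h ^ 8 + ‖lam‖ ^ (-1 : ℝ) * h ^ 4 + ‖lam‖ ^ (-3 / 2 : ℝ) * h ^ 2

/-- The regime `|lam| ≫ h⁻²`, `h → 0`, `|arg lam| < π - ε`, with thresholds `K` and `h₀`. -/
def InRegime (ε K h₀ h : ℝ) (lam : ℂ) : Prop :=
  0 < h ∧ h < h₀ ∧ |lam.arg| < Real.pi - ε ∧ K ≤ ‖lam‖ * h ^ 2

/-! ### The explicit form of the rescaled matrices -/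

theorem det_eigMatrix (c p : ℝ) (lam : ℂ) : (eigMatrix c p lam).det = -kappa c p lam := by
  simp only [eigMatrix, Matrix.det_fin_two_of, muOne, muTwo]
  ring

theorem kappa_sq (c p : ℝ) (lam : ℂ) :
    kappa c p lam ^ 2 = (c : ℂ) ^ 2 + 4 * (lam - (p : ℂ)) := by
  rw [kappa, ← Complex.cpow_nat_mul]
  norm_num

theorem rescaledMatrix_eq (φ : ℝ → ℝ) (c p : ℝ) (lam mu : ℂ) (x : ℝ)
    (hk : kappa c p lam ≠ 0) :
    rescaledMatrix φ c p lam mu x =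
      !![muOne c p lam - mu - (φ x - p) / kappa c p lam, -((φ x - p) / kappa c p lam);
        (φ x - p) / kappa c p lam, muTwo c p lam - mu + (φ x - p) / kappa c p lam] := by
  have hs := kappa_sq c p lam
  have hB : IsUnit (eigMatrix c p lam).det := by
    rw [det_eigMatrix]; exact (neg_ne_zero.mpr hk).isUnit
  have key : ∀ M : Matrix (Fin 2) (Fin 2) ℂ,
      evansMatrix φ c lam x * eigMatrix c p lam = eigMatrix c p lam * (M + mu • 1) →
      rescaledMatrix φ c p lam mu x = M := by
    intro M hM
    rw [rescaledMatrix, Matrix.mul_assoc, hM, Matrix.nonsing_inv_mul_cancel_left _ _ hB]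
    simp
  apply key
  ext i j
  fin_cases i <;> fin_cases j <;>
    simp [evansMatrix, eigMatrix, Matrix.mul_apply, Fin.sum_univ_two, muOne, muTwo] <;>
    field_simp <;> first | ring1 | linear_combination (-kappa c p lam * hs)

theorem leftMatrix_eq (φ : ℝ → ℝ) (c p : ℝ) (lam : ℂ) (x : ℝ)
    (hk : kappa c p lam ≠ 0) :
    leftMatrix φ c p lam x =
      !![-((φ x - p) / kappa c p lam), -((φ x - p) / kappa c p lam);
        (φ x - p) / kappa c p lam, -kappa c p lam + (φ x - p) / kappa c p lam] := by
  rw [leftMatrix, rescaledMatrix_eq φ c p lam _ x hk]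
  ext i j
  fin_cases i <;> fin_cases j <;> simp [muOne, muTwo]
  ring

theorem rightMatrix_eq (φ : ℝ → ℝ) (c p : ℝ) (lam : ℂ) (x : ℝ)
    (hk : kappa c p lam ≠ 0) :
    rightMatrix φ c p lam x =
      !![kappa c p lam - (φ x - p) / kappa c p lam, -((φ x - p) / kappa c p lam);
        (φ x - p) / kappa c p lam, (φ x - p) / kappa c p lam] := by
  rw [rightMatrix, rescaledMatrix_eq φ c p lam _ x hk]
  ext i j
  fin_cases i <;> fin_cases j <;> simp [muOne, muTwo]
  ring

end

end EvansGL

open EvansGL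

/-!
In the rescaled coordinates both half-line problems are the same model problem on `(-∞, 0]`: with
`ψ` the potential measured from its limit and `κ` the root `κ_±`,
`u' = -(ψ / κ) (u + v)`, `v' = -κ v + (ψ / κ) (u + v)`, `(u, v) → (1, 0)` at `-∞`; on the right the
line is reflected and the components are swapped (`IsLeftSolution.modelSolution`,
`IsRightSolution.modelSolution`, `isGL4Step_leftMatrix_iff`, `isGL4Step_rightMatrix_iff`). Away from
the negative real axis `κ` has size `|lam|^(1/2)` and stays in a sector `c₀ |κ| ≤ Re κ`
(`exists_kappa_bounds`).

The solution that comes from `-∞` has no fast transient: the derivatives of `u` are `O(1 / κ)` and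
those of `v` are `O(1 / κ²)`, times a weight whose Riemann sums on the half-line are bounded
(`exists_isWeight`, `ModelSolution.deriv_le`). Therefore the defects of the method are as small as
for a nonstiff equation. When `h |κ|` is large, the stage equations are solved by inverting
`1 + q/2 + q²/12` with `q = h κ`, so the stiff stages gain a factor `1 / (h |κ|)`
(`StepErrors.norm_stage_le`), and the stability function `1 - q / (1 + q/2 + q²/12)`, although it
tends to `1`, is smaller than `1` in the sector (`norm_stability_le`). This gives the local errors,
and the discrete Gronwall lemma gives the global ones (`IsModelStep.norm_localError_le`,
`IsModelRun.norm_error_le`, `IsModelRun.norm_stiff_error_le`).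

The Evans function has size `|κ|`, so the error of `u` is needed to higher order in `1 / κ`. To
first order the relative error of `u` is the accumulated quadrature error `S` of `-ψ / κ`. The terms
of second order in `1 / κ` cancel, except where they are quadratic in the quadrature error, because
the method is symplectic: `b_i a_ij + b_j a_ji = b_i b_j` turns the quadrature error of
`u' (u - u(x + h))` into the stage defects of `u` (`gaussDefect_symplectic`,
`CellData.norm_secondOrder_le`). The errors of `v` enter `u` with the factor `O(q⁻²)` because the
stability function is `1` at infinity (`StepErrors.norm_coupling_le`). Together, the relative error
is `S` up to `O(h⁸ / κ² + h⁴ / κ³ + h² / κ⁴)` (`IsModelRun.norm_fine_error_le`).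

In the Evans function the leading factor `-κ` multiplies the sum of the relative errors of the two
sides, and `-κ` times the quadrature errors of `-ψ / κ` add up to the quadrature error `q` of
`∫ φ` over `[-L, L]` (`quadratureDefect_eq_add`, `norm_evans_remainder_le`). By the Euler-Maclaurin
expansion, whose boundary terms are negligible, `q` is `O(h ^ M)` for every `M`
(`exists_eulerMaclaurin`, `quadratureDefect_isBigO`). The comparisons with the other methods follow
from `|lam|^(-1/2) ≤ h` in the regime.
-/

namespace EvansGL

noncomputable section

/-! ### Bounds for derivatives -/

/-- `f` is smooth and its derivatives of order at most `J` are bounded by `b` on `s`. -/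
def DerivBound (J : ℕ) (s : Set ℝ) (f : ℝ → ℂ) (b : ℝ) : Prop :=
  ContDiff ℝ ∞ f ∧ ∀ j ≤ J, ∀ x ∈ s, ‖iteratedDeriv j f x‖ ≤ b

theorem DerivBound.mono {J J' : ℕ} {s s' : Set ℝ} {f : ℝ → ℂ} {b b' : ℝ}
    (h : DerivBound J s f b) (hJ : J' ≤ J) (hs : s' ⊆ s) (hb : b ≤ b') :
    DerivBound J' s' f b' :=
  ⟨h.1, fun j hj x hx => (h.2 j (hj.trans hJ) x (hs hx)).trans hb⟩

theorem DerivBound.norm_le {J : ℕ} {s : Set ℝ} {f : ℝ → ℂ} {b : ℝ}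
    (h : DerivBound J s f b) {x : ℝ} (hx : x ∈ s) : ‖f x‖ ≤ b := by
  simpa using h.2 0 (Nat.zero_le _) x hx

theorem contDiffAt_nat {f : ℝ → ℂ} (h : ContDiff ℝ ∞ f) (n : ℕ) (x : ℝ) : ContDiffAt ℝ n f x :=
  (h.of_le (by exact_mod_cast le_top)).contDiffAt

/-- The Leibniz rule, with the binomial coefficients summed to `2 ^ j`. -/
theorem norm_iteratedDeriv_mul_le {J : ℕ} {s : Set ℝ} {f g : ℝ → ℂ} {b b' : ℝ}
    (hf : DerivBound J s f b) (hg : DerivBound J s g b') {j : ℕ} (hj : j ≤ J) {x : ℝ}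
    (hx : x ∈ s) : ‖iteratedDeriv j (fun x => f x * g x) x‖ ≤ 2 ^ j * (b * b') := by
  have hb : 0 ≤ b := (norm_nonneg _).trans (hf.norm_le hx)
  have e := iteratedDeriv_mul (contDiffAt_nat hf.1 j x) (contDiffAt_nat hg.1 j x)
  change ‖iteratedDeriv j (f * g) x‖ ≤ _
  rw [e]
  have hs : (2 : ℝ) ^ j * (b * b') = ∑ i ∈ Finset.range (j + 1), (j.choose i : ℝ) * (b * b') := by
    rw [← Finset.sum_mul]
    congr 1
    exact_mod_cast (Nat.sum_range_choose j).symm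
  rw [hs]
  refine (norm_sum_le _ _).trans (Finset.sum_le_sum fun i hi => ?_)
  have hi' : i ≤ j := Nat.lt_succ_iff.mp (Finset.mem_range.mp hi)
  rw [norm_mul, norm_mul, Complex.norm_natCast, mul_assoc]
  exact mul_le_mul_of_nonneg_left (mul_le_mul (hf.2 i (hi'.trans hj) x hx)
    (hg.2 _ ((Nat.sub_le _ _).trans hj) x hx) (norm_nonneg _) hb) (Nat.cast_nonneg _)

theorem DerivBound.mul {J : ℕ} {s : Set ℝ} {f g : ℝ → ℂ} {b b' : ℝ}
    (hf : DerivBound J s f b) (hg : DerivBound J s g b') :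
    DerivBound J s (fun x => f x * g x) (2 ^ J * (b * b')) := by
  refine ⟨hf.1.mul hg.1, fun j hj x hx => (norm_iteratedDeriv_mul_le hf hg hj hx).trans ?_⟩
  have hb : 0 ≤ b := (norm_nonneg _).trans (hf.norm_le hx)
  have hb' : 0 ≤ b' := (norm_nonneg _).trans (hg.norm_le hx)
  exact mul_le_mul_of_nonneg_right (pow_le_pow_right₀ (by norm_num) hj) (mul_nonneg hb hb')

/-! ### Taylor bounds and the defects of Gauss quadrature -/

theorem norm_sub_taylor_le {f : ℝ → ℂ} {a h B : ℝ} (hh : 0 < h) (hf : ContDiff ℝ ∞ f) (n : ℕ)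
    (hB : ∀ t ∈ Set.Icc a (a + h), ‖iteratedDeriv (n + 1) f t‖ ≤ B) {t : ℝ}
    (ht : t ∈ Set.Icc a (a + h)) :
    ‖f t - ∑ k ∈ Finset.range (n + 1), ((k.factorial : ℝ)⁻¹ * (t - a) ^ k) • iteratedDeriv k f a‖
      ≤ B * h ^ (n + 1) := by
  have hu := uniqueDiffOn_Icc (show a < a + h by linarith)
  have ha : a ∈ Set.Icc a (a + h) := ⟨le_rfl, by linarith⟩
  have e : ∀ k : ℕ, ∀ y ∈ Set.Icc a (a + h),
      iteratedDerivWithin k f (Set.Icc a (a + h)) y = iteratedDeriv k f y := fun k y hy =>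
    iteratedDerivWithin_eq_iteratedDeriv hu (contDiffAt_nat hf k y) hy
  have key := taylor_mean_remainder_bound (f := f) (n := n) (show a ≤ a + h by linarith)
    ((hf.of_le (by exact_mod_cast le_top)).contDiffOn) ht
    (C := B) (fun y hy => by rw [e _ y hy]; exact hB y hy)
  rw [taylor_within_apply] at key
  simp only [e _ a ha] at key
  refine key.trans ?_
  have hB0 : 0 ≤ B := (norm_nonneg _).trans (hB a ha)
  have h1 : (t - a) ^ (n + 1) ≤ h ^ (n + 1) :=
    pow_le_pow_left₀ (by linarith [ht.1]) (by linarith [ht.2]) _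
  have h2 : 0 ≤ (t - a) ^ (n + 1) := pow_nonneg (by linarith [ht.1]) _
  have h3 : (1 : ℝ) ≤ (n.factorial : ℝ) := by
    exact_mod_cast Nat.one_le_iff_ne_zero.mpr n.factorial_ne_zero
  calc B * (t - a) ^ (n + 1) / n.factorial ≤ B * (t - a) ^ (n + 1) :=
        div_le_self (mul_nonneg hB0 h2) h3
    _ ≤ _ := mul_le_mul_of_nonneg_left h1 hB0

/-- The offset `√3 / 6` of the Gauss nodes from the midpoint of the unit interval. -/
def gaussOffset : ℝ := √3 / 6

theorem gaussOffset_sq : gaussOffset ^ 2 = 1 / 12 := by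
  rw [gaussOffset, div_pow, Real.sq_sqrt (by norm_num)]; norm_num

theorem gaussOffset_pos : 0 < gaussOffset := by unfold gaussOffset; positivity

theorem gaussOffset_le : gaussOffset ≤ 3 / 10 := by
  nlinarith [gaussOffset_sq, gaussOffset_pos]

/-- The error (quadrature minus integral) of two-point Gauss-Legendre quadrature on
`[x, x + h]`. -/
def gaussDefect (f : ℝ → ℂ) (x h : ℝ) : ℂ :=
  h / 2 * (f (x + (1 / 2 - gaussOffset) * h) + f (x + (1 / 2 + gaussOffset) * h))
    - ∫ t in x..(x + h), f t

theorem gauss_node_mem {x h : ℝ} (hh : 0 < h) :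
    x + (1 / 2 - gaussOffset) * h ∈ Set.Icc x (x + h) ∧
      x + (1 / 2 + gaussOffset) * h ∈ Set.Icc x (x + h) := by
  have h1 := gaussOffset_pos
  have h2 := gaussOffset_le
  refine ⟨⟨?_, ?_⟩, ?_, ?_⟩ <;> nlinarith

theorem gaussDefect_sub {f g : ℝ → ℂ} (hf : Continuous f) (hg : Continuous g) (x h : ℝ) :
    gaussDefect (fun t => f t - g t) x h = gaussDefect f x h - gaussDefect g x h := by
  simp only [gaussDefect]
  rw [intervalIntegral.integral_sub (hf.intervalIntegrable _ _) (hg.intervalIntegrable _ _)]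
  ring

theorem gaussDefect_add {f g : ℝ → ℂ} (hf : Continuous f) (hg : Continuous g) (x h : ℝ) :
    gaussDefect (fun t => f t + g t) x h = gaussDefect f x h + gaussDefect g x h := by
  simp only [gaussDefect]
  rw [intervalIntegral.integral_add (hf.intervalIntegrable _ _) (hg.intervalIntegrable _ _)]
  ring

theorem gaussDefect_const_mul (a : ℂ) (f : ℝ → ℂ) (x h : ℝ) :
    gaussDefect (fun t => a * f t) x h = a * gaussDefect f x h := by
  simp only [gaussDefect]
  rw [intervalIntegral.integral_const_mul]
  ring

/-- Two-point Gauss quadrature is exact for cubic polynomials. -/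
theorem gaussDefect_cubic (a₀ a₁ a₂ a₃ : ℂ) (x h : ℝ) :
    gaussDefect (fun t => a₀ + a₁ * ((t - x : ℝ) : ℂ) + a₂ * ((t - x : ℝ) : ℂ) ^ 2
      + a₃ * ((t - x : ℝ) : ℂ) ^ 3) x h = 0 := by
  have hd : ∀ t : ℝ, HasDerivAt (fun t : ℝ => a₀ * ((t - x : ℝ) : ℂ)
      + a₁ / 2 * ((t - x : ℝ) : ℂ) ^ 2 + a₂ / 3 * ((t - x : ℝ) : ℂ) ^ 3
      + a₃ / 4 * ((t - x : ℝ) : ℂ) ^ 4) (a₀ + a₁ * ((t - x : ℝ) : ℂ)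
      + a₂ * ((t - x : ℝ) : ℂ) ^ 2 + a₃ * ((t - x : ℝ) : ℂ) ^ 3) t := by
    intro t
    have h1 : HasDerivAt (fun t : ℝ => ((t - x : ℝ) : ℂ)) 1 t := by
      simpa using ((hasDerivAt_id t).sub_const x).ofReal_comp
    have := (((h1.const_mul a₀).add ((h1.pow 2).const_mul (a₁ / 2))).add
      ((h1.pow 3).const_mul (a₂ / 3))).add ((h1.pow 4).const_mul (a₃ / 4))
    exact this.congr_deriv (by simp; ring)
  have hi := intervalIntegral.integral_eq_sub_of_hasDerivAt (a := x) (b := x + h)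
    (fun t _ => hd t) (by apply Continuous.intervalIntegrable; fun_prop)
  rw [gaussDefect, hi]
  have hs : (gaussOffset : ℂ) ^ 2 = 1 / 12 := by
    rw [← Complex.ofReal_pow, gaussOffset_sq]; norm_num
  push_cast
  simp only [add_sub_cancel_left, sub_self]
  linear_combination (a₂ * h ^ 3 + 3 / 2 * a₃ * h ^ 4) * hs

theorem norm_gaussDefect_le_of_norm_le {f : ℝ → ℂ} {x h B : ℝ} (hh : 0 < h)
    (hB : ∀ t ∈ Set.Icc x (x + h), ‖f t‖ ≤ B) : ‖gaussDefect f x h‖ ≤ 2 * h * B := by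
  obtain ⟨h1, h2⟩ := gauss_node_mem (x := x) hh
  have hint : ‖∫ t in x..(x + h), f t‖ ≤ B * |x + h - x| :=
    intervalIntegral.norm_integral_le_of_norm_le_const fun t ht => hB t (by
      rw [Set.uIoc_of_le (by linarith)] at ht; exact ⟨ht.1.le, ht.2⟩)
  rw [add_sub_cancel_left, abs_of_pos hh] at hint
  have hn : ‖(h / 2 : ℂ)‖ = h / 2 := by
    rw [norm_div, Complex.norm_real, Real.norm_of_nonneg hh.le]; norm_num
  calc ‖gaussDefect f x h‖ ≤ h / 2 * (B + B) + B * h := by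
        refine (norm_sub_le _ _).trans (add_le_add ?_ hint)
        rw [norm_mul, hn]
        exact mul_le_mul_of_nonneg_left ((norm_add_le _ _).trans (add_le_add (hB _ h1) (hB _ h2)))
          (by linarith)
    _ = 2 * h * B := by ring

/-- Subtraction of the cubic Taylor polynomial, for which the rule is exact, leaves a remainder of
size `h ^ 4`. -/
theorem norm_gaussDefect_le {f : ℝ → ℂ} {x h B : ℝ} (hh : 0 < h)
    (hf : DerivBound 4 (Set.Icc x (x + h)) f B) : ‖gaussDefect f x h‖ ≤ 2 * B * h ^ 5 := by
  set P : ℝ → ℂ := fun t => f x + deriv f x * ((t - x : ℝ) : ℂ)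
    + iteratedDeriv 2 f x / 2 * ((t - x : ℝ) : ℂ) ^ 2
    + iteratedDeriv 3 f x / 6 * ((t - x : ℝ) : ℂ) ^ 3 with hP
  have hP0 : gaussDefect P x h = 0 := gaussDefect_cubic _ _ _ _ x h
  have hPc : Continuous P := by fun_prop
  have e := gaussDefect_sub hf.1.continuous hPc x h
  rw [hP0, sub_zero] at e
  rw [← e]
  refine (norm_gaussDefect_le_of_norm_le hh (B := B * h ^ 4) fun t ht => ?_).trans (by
    apply le_of_eq; ring)
  have := norm_sub_taylor_le hh hf.1 3 (fun t ht => hf.2 4 le_rfl t ht) ht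
  refine le_of_eq_of_le ?_ this
  congr 2
  simp only [Finset.sum_range_succ, Finset.sum_range_zero, hP, Nat.factorial, Complex.real_smul,
    iteratedDeriv_zero, iteratedDeriv_one]
  push_cast
  ring

/-- The defect of the two-point rule `f(x + γ h) - f(x) = h (α f'(x + c₁ h) + β f'(x + c₂ h))`
at the Gauss nodes; it covers the stages and the update of the method. -/
def stageDefect (f : ℝ → ℂ) (x h γ α β : ℝ) : ℂ :=
  f (x + γ * h) - f x - h * (α * deriv f (x + (1 / 2 - gaussOffset) * h)
      + β * deriv f (x + (1 / 2 + gaussOffset) * h))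

/-- The two conditions on `α` and `β` say that the rule is exact for quadratic polynomials. -/
theorem norm_stageDefect_le {f : ℝ → ℂ} {x h B γ α β : ℝ} (hh : 0 < h)
    (hf : ContDiff ℝ ∞ f) (hfB : ∀ t ∈ Set.Icc x (x + h), ‖iteratedDeriv 3 f t‖ ≤ B)
    (hγ : γ ∈ Set.Icc (0 : ℝ) 1) (hα : |α| ≤ 1) (hβ : |β| ≤ 1) (h1 : α + β = γ)
    (h2 : α * (1 / 2 - gaussOffset) + β * (1 / 2 + gaussOffset) = γ ^ 2 / 2) :
    ‖stageDefect f x h γ α β‖ ≤ 3 * B * h ^ 3 := by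
  unfold stageDefect
  obtain ⟨n1, n2⟩ := gauss_node_mem (x := x) hh
  have n3 : x + γ * h ∈ Set.Icc x (x + h) := ⟨by nlinarith [hγ.1], by nlinarith [hγ.2]⟩
  have hd : ContDiff ℝ ∞ (deriv f) := (contDiff_infty_iff_deriv.mp hf).2
  have hdB : ∀ t ∈ Set.Icc x (x + h), ‖iteratedDeriv 2 (deriv f) t‖ ≤ B := fun t ht => by
    rw [← iteratedDeriv_succ']; exact hfB t ht
  have t1 := norm_sub_taylor_le hh hf 2 hfB n3
  have t2 := norm_sub_taylor_le hh hd 1 hdB n1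
  have t3 := norm_sub_taylor_le hh hd 1 hdB n2
  have i2 : iteratedDeriv 1 (deriv f) x = iteratedDeriv 2 f x := by
    rw [← iteratedDeriv_succ']
  simp only [Finset.sum_range_succ, Finset.sum_range_zero, Nat.factorial, Complex.real_smul,
    iteratedDeriv_zero, iteratedDeriv_one, i2] at t1 t2 t3
  set A1 := f (x + γ * h)
  set A2 := deriv f (x + (1 / 2 - gaussOffset) * h)
  set A3 := deriv f (x + (1 / 2 + gaussOffset) * h)
  have i1 : iteratedDeriv 2 f x = deriv (deriv f) x := by
    rw [iteratedDeriv_succ', iteratedDeriv_one]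
  have c1 : (α : ℂ) + β = γ := by exact_mod_cast congrArg Complex.ofReal h1
  have c2 : (α : ℂ) * (1 / 2 - gaussOffset) + β * (1 / 2 + gaussOffset) = γ ^ 2 / 2 := by
    have := congrArg Complex.ofReal h2
    push_cast at this
    exact this
  rw [i1] at t1 t2 t3
  have hB : 0 ≤ B := (norm_nonneg _).trans (hfB _ n1)
  have main : ∀ (a b c : ℂ), ‖a‖ ≤ B * h ^ 3 → ‖b‖ ≤ B * h ^ 2 → ‖c‖ ≤ B * h ^ 2 →
      ‖a - h * (α * b + β * c)‖ ≤ 3 * B * h ^ 3 := by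
    intro a b c ha hb hc
    have : ‖(h : ℂ) * (α * b + β * c)‖ ≤ h * (1 * (B * h ^ 2) + 1 * (B * h ^ 2)) := by
      rw [norm_mul, Complex.norm_real, Real.norm_of_nonneg hh.le]
      refine mul_le_mul_of_nonneg_left ((norm_add_le _ _).trans (add_le_add ?_ ?_)) hh.le
      · rw [norm_mul, Complex.norm_real, Real.norm_eq_abs]
        exact mul_le_mul hα hb (norm_nonneg _) zero_le_one
      · rw [norm_mul, Complex.norm_real, Real.norm_eq_abs]
        exact mul_le_mul hβ hc (norm_nonneg _) zero_le_one
    refine (norm_sub_le _ _).trans ((add_le_add ha this).trans (le_of_eq ?_))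
    ring
  refine le_of_eq_of_le (congrArg _ ?_) (main _ _ _ t1 t2 t3)
  push_cast
  linear_combination (-h * deriv f x) * c1 - (h ^ 2 * deriv (deriv f) x) * c2

/-! ### The exact solution of the model problem -/

/-- A majorant `m` on `(-∞, 0]` of `ψ` and its first derivatives, bounded by `W`, that grows by at
most the factor `exp (x - s)` to the left, and whose Riemann sums are bounded by `W`. -/
structure IsWeight (ψ : ℝ → ℂ) (m : ℝ → ℝ) (W : ℝ) : Prop where
  smooth : ContDiff ℝ ∞ ψ
  deriv_le : ∀ j ≤ 4, ∀ x ≤ 0, ‖iteratedDeriv j ψ x‖ ≤ m x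
  le : ∀ x ≤ 0, m x ≤ W
  exp_le : ∀ s x, s ≤ x → x ≤ 0 → m s ≤ Real.exp (x - s) * m x
  integral_le : ∀ a x, a ≤ x → x ≤ 0 → ∫ t in a..x, ‖ψ t‖ ≤ W
  sum_le : ∀ h, 0 < h → h ≤ 1 → ∀ N : ℕ, ∀ n ≤ N,
    ∑ k ∈ Finset.range n, h * m (-(N * h) + (k + 1) * h) ≤ W

theorem IsWeight.nonneg {ψ : ℝ → ℂ} {m : ℝ → ℝ} {W : ℝ} (hm : IsWeight ψ m W) {x : ℝ}
    (hx : x ≤ 0) : 0 ≤ m x :=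
  (norm_nonneg _).trans (hm.deriv_le 0 (by norm_num) x hx)

theorem IsWeight.bound_nonneg {ψ : ℝ → ℂ} {m : ℝ → ℝ} {W : ℝ} (hm : IsWeight ψ m W) : 0 ≤ W :=
  (hm.nonneg le_rfl).trans (hm.le 0 le_rfl)

/-- The left problem in rescaled coordinates: `u` is the nonstiff and `v` the stiff component of
the solution that tends to `(1, 0)` at `-∞`. -/
structure ModelSolution (ψ : ℝ → ℂ) (κ : ℂ) (u v : ℝ → ℂ) : Prop where
  deriv_u : ∀ x, HasDerivAt u (-(ψ x / κ) * (u x + v x)) x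
  deriv_v : ∀ x, HasDerivAt v (-κ * v x + ψ x / κ * (u x + v x)) x
  lim_u : Tendsto u atBot (𝓝 1)
  lim_v : Tendsto v atBot (𝓝 0)

theorem ModelSolution.contDiff {ψ : ℝ → ℂ} {κ : ℂ} {u v : ℝ → ℂ} (hs : ModelSolution ψ κ u v)
    (hψ : ContDiff ℝ ∞ ψ) : ContDiff ℝ ∞ u ∧ ContDiff ℝ ∞ v := by
  have key : ∀ n : ℕ, ContDiff ℝ n u ∧ ContDiff ℝ n v := by
    intro n
    induction n with
    | zero =>
      exact ⟨contDiff_zero.mpr (continuous_iff_continuousAt.mpr fun x =>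
          (hs.deriv_u x).continuousAt),
        contDiff_zero.mpr (continuous_iff_continuousAt.mpr fun x => (hs.deriv_v x).continuousAt)⟩
    | succ n ih =>
      have hψn : ContDiff ℝ n ψ := hψ.of_le (by exact_mod_cast le_top)
      have eu : deriv u = fun x => -(ψ x / κ) * (u x + v x) := funext fun x => (hs.deriv_u x).deriv
      have ev : deriv v = fun x => -κ * v x + ψ x / κ * (u x + v x) :=
        funext fun x => (hs.deriv_v x).deriv
      obtain ⟨h1, h2⟩ := ih
      push_cast
      refine ⟨contDiff_succ_iff_deriv.mpr ⟨fun x => (hs.deriv_u x).differentiableAt, by simp, ?_⟩,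
        contDiff_succ_iff_deriv.mpr ⟨fun x => (hs.deriv_v x).differentiableAt, by simp, ?_⟩⟩
      · rw [eu]
        exact ((hψn.div_const κ).neg).mul (h1.add h2)
      · rw [ev]
        exact (contDiff_const.mul h2).add ((hψn.div_const κ).mul (h1.add h2))
  exact ⟨contDiff_infty.mpr fun n => (key n).1, contDiff_infty.mpr fun n => (key n).2⟩

/-- A solution of `v' = -κ v + F` that is bounded at `-∞` is controlled by `F`, with a gain of
the decay rate, as long as `F` grows by at most a factor `exp (x - s)` to the left. -/
theorem norm_le_of_decay {v F : ℝ → ℂ} {κ : ℂ} {A B x : ℝ}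
    (hv : ∀ s, HasDerivAt v (-κ * v s + F s) s)
    (hF : ∀ s ≤ x, ‖F s‖ ≤ A * Real.exp (x - s)) (hB : ∀ s ≤ x, ‖v s‖ ≤ B) (hκ : 1 < κ.re) :
    ‖v x‖ ≤ A / (κ.re - 1) := by
  set ρ := κ.re with hρ
  have hA : 0 ≤ A := by
    have := (norm_nonneg _).trans (hF x le_rfl)
    simpa using this
  set w : ℝ → ℂ := fun s => Complex.exp (κ * ((s - x : ℝ) : ℂ)) * v s with hw
  have hnorm : ∀ s : ℝ, ‖Complex.exp (κ * ((s - x : ℝ) : ℂ))‖ = Real.exp (ρ * (s - x)) := by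
    intro s
    rw [Complex.norm_exp]
    congr 1
    rw [Complex.re_mul_ofReal]
  have hdw : ∀ s, HasDerivAt w (Complex.exp (κ * ((s - x : ℝ) : ℂ)) * F s) s := by
    intro s
    have h1 : HasDerivAt (fun s : ℝ => ((s - x : ℝ) : ℂ)) 1 s := by
      simpa using ((hasDerivAt_id s).sub_const x).ofReal_comp
    exact (((h1.const_mul κ).cexp).mul (hv s)).congr_deriv (by ring)
  have main : ∀ a ≤ x, ‖v x‖ ≤ B * Real.exp (ρ * (a - x)) + A / (ρ - 1) := by
    intro a ha
    have hb : ∀ s, HasDerivAt (fun s : ℝ => ‖w a‖ + A / (ρ - 1) * Real.exp ((ρ - 1) * (s - x)))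
        (A * Real.exp ((ρ - 1) * (s - x))) s := by
      intro s
      have h1 : HasDerivAt (fun s : ℝ => (ρ - 1) * (s - x)) ((ρ - 1) * 1) s :=
        ((hasDerivAt_id s).sub_const x).const_mul _
      refine ((h1.exp.const_mul (A / (ρ - 1))).const_add ‖w a‖).congr_deriv ?_
      have : ρ - 1 ≠ 0 := by linarith
      field_simp
    have key := image_norm_le_of_norm_deriv_right_le_deriv_boundary (f := w) (a := a) (b := x)
      (fun s _ => (hdw s).continuousAt.continuousWithinAt)
      (fun s _ => (hdw s).hasDerivWithinAt)
      (by
        have : 0 ≤ A / (ρ - 1) * Real.exp ((ρ - 1) * (a - x)) :=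
          mul_nonneg (div_nonneg hA (by linarith)) (Real.exp_pos _).le
        linarith) hb
      (fun s hs => by
        rw [norm_mul, hnorm]
        calc Real.exp (ρ * (s - x)) * ‖F s‖
            ≤ Real.exp (ρ * (s - x)) * (A * Real.exp (x - s)) :=
              mul_le_mul_of_nonneg_left (hF s hs.2.le) (Real.exp_pos _).le
          _ = A * (Real.exp (ρ * (s - x)) * Real.exp (x - s)) := by ring
          _ = _ := by rw [← Real.exp_add]; congr 2; ring) (Set.right_mem_Icc.mpr ha)
    have e1 : w x = v x := by simp [hw]
    have e2 : ‖w a‖ ≤ B * Real.exp (ρ * (a - x)) := by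
      rw [hw]
      simp only [norm_mul, hnorm]
      rw [mul_comm]
      exact mul_le_mul_of_nonneg_right (hB a ha) (Real.exp_pos _).le
    simp only [e1, sub_self, mul_zero, Real.exp_zero, mul_one] at key
    linarith
  have hlim : Tendsto (fun a : ℝ => B * Real.exp (ρ * (a - x)) + A / (ρ - 1)) atBot
      (𝓝 (B * 0 + A / (ρ - 1))) := by
    refine ((Real.tendsto_exp_atBot.comp ?_).const_mul B).add_const _
    exact Tendsto.const_mul_atBot (by linarith) (tendsto_atBot_add_const_right _ _ tendsto_id)
  have := ge_of_tendsto hlim (eventually_atBot.mpr ⟨x, main⟩)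
  simpa using this

theorem exists_bound_Iic {f : ℝ → ℂ} (hf : Continuous f) {l : ℂ} (hl : Tendsto f atBot (𝓝 l)) :
    ∃ B, ∀ x ≤ 0, ‖f x‖ ≤ B := by
  have h1 : ∀ᶠ x in atBot, ‖f x‖ ≤ ‖l‖ + 1 :=
    (hl.norm.eventually_lt_const (by linarith)).mono fun x hx => hx.le
  obtain ⟨a, ha⟩ := eventually_atBot.mp h1
  obtain ⟨B, hB⟩ := (isCompact_Icc (a := a) (b := (0 : ℝ))).exists_bound_of_continuousOn
    hf.continuousOn
  refine ⟨max (‖l‖ + 1) B, fun x hx => ?_⟩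
  rcases le_total x a with h | h
  · exact (ha x h).trans (le_max_left _ _)
  · exact (hB x ⟨h, hx⟩).trans (le_max_right _ _)

/-- Rough form of the bounds for the exact solution: a bound `B` for `u + v` gives estimates of
`u - 1` and `v`. -/
theorem ModelSolution.bound_step {ψ : ℝ → ℂ} {m : ℝ → ℝ} {W : ℝ} (hm : IsWeight ψ m W) {κ : ℂ}
    {u v : ℝ → ℂ} (hs : ModelSolution ψ κ u v) (hκ0 : 0 < ‖κ‖) (hκ : 1 < κ.re) {B : ℝ}
    (hB : ∀ x ≤ 0, ‖u x + v x‖ ≤ B) {x : ℝ} (hx : x ≤ 0) :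
    ‖u x - 1‖ ≤ W * B / ‖κ‖ ∧ ‖v x‖ ≤ B * m x / ‖κ‖ / (κ.re - 1) := by
  have hB0 : 0 ≤ B := (norm_nonneg _).trans (hB 0 le_rfl)
  obtain ⟨cu, cv⟩ := hs.contDiff hm.smooth
  have hψc := hm.smooth.continuous
  constructor
  · have main : ∀ a ≤ x, ‖u x - u a‖ ≤ W * B / ‖κ‖ := by
      intro a ha
      have hi := intervalIntegral.integral_eq_sub_of_hasDerivAt (a := a) (b := x)
        (fun t _ => hs.deriv_u t) (by
          apply Continuous.intervalIntegrable
          exact ((hψc.div_const κ).neg).mul (cu.continuous.add cv.continuous))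
      rw [← hi]
      have hle : ‖∫ t in a..x, -(ψ t / κ) * (u t + v t)‖ ≤ ∫ t in a..x, B / ‖κ‖ * ‖ψ t‖ := by
        refine intervalIntegral.norm_integral_le_of_norm_le ha (Eventually.of_forall fun t ht => ?_)
          ((hψc.norm.const_mul _).intervalIntegrable _ _)
        rw [norm_mul, norm_neg, norm_div]
        calc ‖ψ t‖ / ‖κ‖ * ‖u t + v t‖ ≤ ‖ψ t‖ / ‖κ‖ * B :=
              mul_le_mul_of_nonneg_left (hB t (ht.2.trans hx)) (by positivity)
          _ = _ := by ring
      refine hle.trans ?_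
      rw [intervalIntegral.integral_const_mul]
      calc B / ‖κ‖ * _ ≤ B / ‖κ‖ * W :=
            mul_le_mul_of_nonneg_left (hm.integral_le a x ha hx) (by positivity)
        _ = _ := by ring
    have hlim : Tendsto (fun a => ‖u x - u a‖) atBot (𝓝 ‖u x - 1‖) :=
      (tendsto_const_nhds.sub hs.lim_u).norm
    exact le_of_tendsto hlim (eventually_atBot.mpr ⟨x, main⟩)
  · obtain ⟨Bv, hBv⟩ := exists_bound_Iic cv.continuous hs.lim_v
    refine norm_le_of_decay (B := Bv) hs.deriv_v (fun s hsx => ?_)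
      (fun s hsx => hBv s (hsx.trans hx)) hκ
    rw [norm_mul, norm_div]
    have h1 := hm.deriv_le 0 (by norm_num) s (hsx.trans hx)
    rw [iteratedDeriv_zero] at h1
    have h2 := hm.exp_le s x hsx hx
    have h0 := hm.nonneg hx
    calc ‖ψ s‖ / ‖κ‖ * ‖u s + v s‖ ≤ (Real.exp (x - s) * m x) / ‖κ‖ * B := by
          gcongr
          · exact h1.trans h2
          · exact hB s (hsx.trans hx)
      _ = _ := by ring

/-- Constants for the sector `c₀ |κ| ≤ Re κ`: the threshold for `|κ|` from which the estimates of
the exact solution hold. -/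
def kappaBound (W c₀ : ℝ) : ℝ := 1 + 2 / c₀ + 4 * W + 8 * W / c₀

theorem kappaBound_spec {W c₀ : ℝ} (hW : 0 ≤ W) (hc : 0 < c₀) {κ : ℂ}
    (hK : kappaBound W c₀ ≤ ‖κ‖) (hre : c₀ * ‖κ‖ ≤ κ.re) :
    1 ≤ ‖κ‖ ∧ 1 < κ.re ∧ c₀ * ‖κ‖ / 2 ≤ κ.re - 1 ∧ 4 * W ≤ ‖κ‖ ∧ 8 * W ≤ c₀ * ‖κ‖ := by
  unfold kappaBound at hK
  have h1 : 0 < 2 / c₀ := by positivity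
  have h2 : 0 ≤ 8 * W / c₀ := by positivity
  have h3 : c₀ * (2 / c₀) ≤ c₀ * ‖κ‖ := mul_le_mul_of_nonneg_left (by linarith) hc.le
  have h4 : c₀ * (8 * W / c₀) ≤ c₀ * ‖κ‖ := mul_le_mul_of_nonneg_left (by linarith) hc.le
  have e3 : c₀ * (2 / c₀) = 2 := by field_simp
  have e4 : c₀ * (8 * W / c₀) = 8 * W := by field_simp
  refine ⟨by linarith, by linarith, by linarith, by linarith, by linarith⟩

/-- `bound_step` closes up for large `|κ|`: the supremum of `|u + v|` is at most `2`, and this bound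
is fed back into the estimates of `u - 1` and `v`. -/
theorem ModelSolution.norm_le {ψ : ℝ → ℂ} {m : ℝ → ℝ} {W c₀ : ℝ} (hm : IsWeight ψ m W)
    (hc : 0 < c₀) {κ : ℂ} (hK : kappaBound W c₀ ≤ ‖κ‖) (hre : c₀ * ‖κ‖ ≤ κ.re) {u v : ℝ → ℂ}
    (hs : ModelSolution ψ κ u v) {x : ℝ} (hx : x ≤ 0) :
    ‖u x + v x‖ ≤ 2 ∧ ‖u x - 1‖ ≤ 2 * W / ‖κ‖ ∧ ‖v x‖ ≤ 4 / c₀ * (m x / ‖κ‖ ^ 2) := by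
  obtain ⟨k1, k2, k3, k4, k5⟩ := kappaBound_spec hm.bound_nonneg hc hK hre
  have k0 : 0 < ‖κ‖ := by linarith
  have hW := hm.bound_nonneg
  obtain ⟨cu, cv⟩ := hs.contDiff hm.smooth
  have vstep : ∀ B : ℝ, 0 ≤ B → ∀ x ≤ 0, B * m x / ‖κ‖ / (κ.re - 1) ≤
      2 * B / c₀ * (m x / ‖κ‖ ^ 2) := by
    intro B hB x hx
    have h0 := hm.nonneg hx
    calc B * m x / ‖κ‖ / (κ.re - 1) ≤ B * m x / ‖κ‖ / (c₀ * ‖κ‖ / 2) := by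
          apply div_le_div_of_nonneg_left (by positivity) (by positivity) k3
      _ = _ := by field_simp
  have step : ∀ B : ℝ, (∀ x ≤ 0, ‖u x + v x‖ ≤ B) → ∀ x ≤ 0, ‖u x + v x‖ ≤ 1 + B / 2 := by
    intro B hB x hx
    have hB0 : 0 ≤ B := (norm_nonneg _).trans (hB 0 le_rfl)
    obtain ⟨h1, h2⟩ := hs.bound_step hm k0 k2 hB hx
    have e1 : W * B / ‖κ‖ ≤ B / 4 := by
      rw [div_le_iff₀ k0]; nlinarith
    have e2 : 2 * B / c₀ * (m x / ‖κ‖ ^ 2) ≤ B / 4 := by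
      have : 2 * B / c₀ * (m x / ‖κ‖ ^ 2) = 2 * B * m x / (c₀ * ‖κ‖ ^ 2) := by field_simp
      rw [this, div_le_iff₀ (by positivity)]
      have := hm.le x hx
      have : 8 * m x ≤ c₀ * ‖κ‖ ^ 2 := by nlinarith [mul_pos hc k0]
      nlinarith
    have e3 := vstep B hB0 x hx
    calc ‖u x + v x‖ = ‖1 + ((u x - 1) + v x)‖ := by ring_nf
      _ ≤ 1 + (‖u x - 1‖ + ‖v x‖) := by
          refine (norm_add_le _ _).trans ?_
          rw [norm_one]
          gcongr
          exact norm_add_le _ _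
      _ ≤ _ := by linarith
  obtain ⟨B, hB⟩ := exists_bound_Iic (cu.continuous.add cv.continuous) (hs.lim_u.add hs.lim_v)
  have two : ∀ x ≤ 0, ‖u x + v x‖ ≤ 2 := by
    -- the least bound `b` satisfies `b ≤ 1 + b / 2`
    set S : Set ℝ := (fun x => ‖u x + v x‖) '' Set.Iic 0
    have hSb : BddAbove S := ⟨B, by rintro _ ⟨x, hx, rfl⟩; exact hB x hx⟩
    have hSn : S.Nonempty := ⟨_, 0, Set.mem_Iic.mpr le_rfl, rfl⟩
    have h1 : ∀ x ≤ 0, ‖u x + v x‖ ≤ sSup S := fun x hx => le_csSup hSb ⟨x, hx, rfl⟩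
    have h2 : sSup S ≤ 1 + sSup S / 2 :=
      csSup_le hSn (by rintro _ ⟨x, hx, rfl⟩; exact step _ h1 x hx)
    intro x hx
    linarith [h1 x hx]
  obtain ⟨h1, h2⟩ := hs.bound_step hm k0 k2 two hx
  refine ⟨two x hx, h1.trans (le_of_eq (by ring)), h2.trans ((vstep 2 (by norm_num) x hx).trans
    (le_of_eq (by ring)))⟩

/-- All derivatives of the exact solution obey the bounds of its leading order: the solution has
no fast transient. -/
theorem ModelSolution.deriv_le (W c₀ : ℝ) (hW : 0 ≤ W) (hc : 0 < c₀) : ∀ n ≤ 4, ∃ C ≥ 1,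
    ∀ (ψ : ℝ → ℂ) (m : ℝ → ℝ), IsWeight ψ m W → ∀ κ : ℂ, kappaBound W c₀ ≤ ‖κ‖ →
    c₀ * ‖κ‖ ≤ κ.re → ∀ u v : ℝ → ℂ, ModelSolution ψ κ u v → ∀ j ≤ n, ∀ x ≤ 0,
    ‖iteratedDeriv (j + 1) u x‖ ≤ C * (m x / ‖κ‖) ∧
      ‖iteratedDeriv j v x‖ ≤ C * (m x / ‖κ‖ ^ 2) := by
  intro n
  induction n with
  | zero =>
    intro _
    refine ⟨2 + 4 / c₀, by have : 0 < 4 / c₀ := by positivity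
                           linarith, ?_⟩
    intro ψ m hm κ hK hre u v hs j hj x hx
    obtain ⟨k1, -, -, -, -⟩ := kappaBound_spec hW hc hK hre
    obtain rfl : j = 0 := by omega
    obtain ⟨h1, -, h3⟩ := hs.norm_le hm hc hK hre hx
    have h0 := hm.nonneg hx
    have hc4 : 0 < 4 / c₀ := by positivity
    constructor
    · rw [iteratedDeriv_one, (hs.deriv_u x).deriv, norm_mul, norm_neg, norm_div]
      have hψ := hm.deriv_le 0 (by norm_num) x hx
      rw [iteratedDeriv_zero] at hψ
      calc ‖ψ x‖ / ‖κ‖ * ‖u x + v x‖ ≤ m x / ‖κ‖ * 2 := by gcongr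
        _ = 2 * (m x / ‖κ‖) := by ring
        _ ≤ _ := by gcongr; linarith
    · rw [iteratedDeriv_zero]
      refine h3.trans ?_
      gcongr; linarith
  | succ n ih =>
    intro hn
    obtain ⟨C, hC1, ih⟩ := ih (by omega)
    set D := 2 + 2 * C * W with hD
    set E := C + 2 ^ n * D with hE
    set D' := D + E * W with hD'
    have hD0 : 0 < D := by positivity
    have hE0 : 0 < E := by positivity
    have hD0' : 0 < D' := by positivity
    refine ⟨C + 2 ^ (n + 1) * D' * (1 + 2 / c₀), ?_, ?_⟩
    · have : 0 ≤ 2 ^ (n + 1) * D' * (1 + 2 / c₀) := by positivity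
      linarith
    intro ψ m hm κ hK hre u v hs
    obtain ⟨k1, k2, k3, -, -⟩ := kappaBound_spec hW hc hK hre
    have k0 : 0 < ‖κ‖ := by linarith
    have hκ : κ ≠ 0 := norm_pos_iff.mp k0
    obtain ⟨cu, cv⟩ := hs.contDiff hm.smooth
    have IH := ih ψ m hm κ hK hre u v hs
    -- the derivatives of `y = u + v` of order at most `n`
    have yb : ∀ j ≤ n, ∀ x ≤ 0, ‖iteratedDeriv j (fun t => u t + v t) x‖ ≤ D := by
      intro j hj x hx
      have h0 := hm.nonneg hx
      rcases j with _ | j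
      · rw [iteratedDeriv_zero]
        refine (hs.norm_le hm hc hK hre hx).1.trans ?_
        rw [hD]
        nlinarith [mul_nonneg (by linarith : (0 : ℝ) ≤ C) hW]
      · rw [iteratedDeriv_fun_add (contDiffAt_nat cu _ x) (contDiffAt_nat cv _ x)]
        have a1 := (IH j (by omega) x hx).1
        have a2 := (IH (j + 1) hj x hx).2
        have b1 : m x / ‖κ‖ ≤ W := (div_le_self h0 k1).trans (hm.le x hx)
        have b2 : m x / ‖κ‖ ^ 2 ≤ W := (div_le_self h0 (one_le_pow₀ k1)).trans (hm.le x hx)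
        refine (norm_add_le _ _).trans ?_
        nlinarith
    have ψb : ∀ x ≤ 0, DerivBound 4 {x} ψ (m x) := fun x hx =>
      ⟨hm.smooth, fun j hj y hy => by rw [Set.mem_singleton_iff.mp hy]; exact hm.deriv_le j hj x hx⟩
    have prod : ∀ (k : ℕ) (b : ℝ), k ≤ 4 → ∀ x ≤ 0,
        (∀ j ≤ k, ‖iteratedDeriv j (fun t => u t + v t) x‖ ≤ b) →
        ‖iteratedDeriv k (fun t => ψ t * (u t + v t)) x‖ ≤ 2 ^ k * (m x * b) := by
      intro k b hk x hx hb
      exact norm_iteratedDeriv_mul_le (J := k) (s := {x}) ((ψb x hx).mono hk le_rfl le_rfl)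
        ⟨cu.add cv, fun j hj y hy => by rw [Set.mem_singleton_iff.mp hy]; exact hb j hj⟩ le_rfl rfl
    have cp : ContDiff ℝ ∞ (fun t => ψ t * (u t + v t)) := hm.smooth.mul (cu.add cv)
    have eu : deriv u = fun x => -(1 / κ) * (ψ x * (u x + v x)) :=
      funext fun x => by rw [(hs.deriv_u x).deriv]; ring
    have ev : deriv v = fun x => -κ * v x + 1 / κ * (ψ x * (u x + v x)) :=
      funext fun x => by rw [(hs.deriv_v x).deriv]; ring
    have du : ∀ (k : ℕ) (x : ℝ), iteratedDeriv (k + 1) u x =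
        -(1 / κ) * iteratedDeriv k (fun t => ψ t * (u t + v t)) x := by
      intro k x
      rw [iteratedDeriv_succ', eu, iteratedDeriv_const_mul_field]
    have dv : ∀ (k : ℕ) (x : ℝ), iteratedDeriv (k + 1) v x =
        -κ * iteratedDeriv k v x + 1 / κ * iteratedDeriv k (fun t => ψ t * (u t + v t)) x := by
      intro k x
      rw [iteratedDeriv_succ', ev, iteratedDeriv_fun_add
        (contDiffAt_nat (contDiff_const.mul cv) _ x) (contDiffAt_nat (contDiff_const.mul cp) _ x),
        iteratedDeriv_const_mul_field, iteratedDeriv_const_mul_field]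
    have nk : ‖(1 / κ : ℂ)‖ = 1 / ‖κ‖ := by rw [norm_div, norm_one]
    -- a bound without the gain in `1 / κ`, for the next derivative of `v`, from the equation
    have crude : ∀ x ≤ 0, ‖iteratedDeriv (n + 1) v x‖ ≤ E * W := by
      intro x hx
      have h0 := hm.nonneg hx
      rw [dv]
      have a1 := (IH n le_rfl x hx).2
      have a2 := prod n D (by omega) x hx (fun j hj => yb j hj x hx)
      have b1 : m x / ‖κ‖ ≤ W := (div_le_self h0 k1).trans (hm.le x hx)
      calc _ ≤ ‖κ‖ * (C * (m x / ‖κ‖ ^ 2)) + 1 / ‖κ‖ * (2 ^ n * (m x * D)) := by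
            refine (norm_add_le _ _).trans ?_
            rw [norm_mul, norm_mul, norm_neg, nk]
            gcongr
        _ = E * (m x / ‖κ‖) := by rw [hE]; field_simp
        _ ≤ _ := by gcongr
    have yb' : ∀ j ≤ n + 1, ∀ x ≤ 0, ‖iteratedDeriv j (fun t => u t + v t) x‖ ≤ D' := by
      intro j hj x hx
      rcases Nat.lt_or_ge j (n + 1) with h | h
      · exact (yb j (by omega) x hx).trans (by rw [hD']; nlinarith)
      · obtain rfl : j = n + 1 := by omega
        have h0 := hm.nonneg hx
        rw [iteratedDeriv_fun_add (contDiffAt_nat cu _ x) (contDiffAt_nat cv _ x)]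
        have a1 := (IH n le_rfl x hx).1
        have b1 : m x / ‖κ‖ ≤ W := (div_le_self h0 k1).trans (hm.le x hx)
        have a2 := crude x hx
        refine (norm_add_le _ _).trans ?_
        have : C * (m x / ‖κ‖) ≤ D := by rw [hD]; nlinarith
        rw [hD']; linarith
    have prod' := fun x hx => prod (n + 1) D' hn x hx (fun j hj => yb' j hj x hx)
    intro j hj x hx
    have h0 := hm.nonneg hx
    have hcp : 0 < 2 / c₀ := by positivity
    have hP : 0 ≤ 2 ^ (n + 1) * D' := by positivity
    rcases Nat.lt_or_ge j (n + 1) with h | h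
    · obtain ⟨a1, a2⟩ := IH j (by omega) x hx
      refine ⟨a1.trans ?_, a2.trans ?_⟩
      · gcongr
        nlinarith
      · gcongr
        nlinarith
    · obtain rfl : j = n + 1 := by omega
      constructor
      · rw [du, norm_mul, norm_neg, nk]
        calc _ ≤ 1 / ‖κ‖ * (2 ^ (n + 1) * (m x * D')) := by gcongr; exact prod' x hx
          _ = 2 ^ (n + 1) * D' * (m x / ‖κ‖) := by ring
          _ ≤ _ := by gcongr; nlinarith
      · -- the differentiated equation has the same decay rate, and its solution is bounded
        have hode : ∀ s, HasDerivAt (iteratedDeriv (n + 1) v) (-κ * iteratedDeriv (n + 1) v s +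
            1 / κ * iteratedDeriv (n + 1) (fun t => ψ t * (u t + v t)) s) s := by
          intro s
          rw [← dv]
          have : DifferentiableAt ℝ (iteratedDeriv (n + 1) v) s :=
            (cv.differentiable_iteratedDeriv (n + 1) (by exact_mod_cast WithTop.coe_lt_top _)) s
          have h := this.hasDerivAt
          rwa [← iteratedDeriv_succ] at h
        have := norm_le_of_decay (x := x) (A := 2 ^ (n + 1) * D' * (m x / ‖κ‖)) hode
          (fun s hsx => by
            rw [norm_mul, nk]
            have h2 := hm.exp_le s x hsx hx
            calc _ ≤ 1 / ‖κ‖ * (2 ^ (n + 1) * ((Real.exp (x - s) * m x) * D')) := by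
                  gcongr
                  exact (prod' s (hsx.trans hx)).trans (by gcongr)
              _ = _ := by ring)
          (fun s hsx => crude s (hsx.trans hx)) k2
        refine this.trans ?_
        calc 2 ^ (n + 1) * D' * (m x / ‖κ‖) / (κ.re - 1)
            ≤ 2 ^ (n + 1) * D' * (m x / ‖κ‖) / (c₀ * ‖κ‖ / 2) := by
              apply div_le_div_of_nonneg_left (by positivity) (by positivity) k3
          _ = 2 ^ (n + 1) * D' * (2 / c₀) * (m x / ‖κ‖ ^ 2) := by field_simp
          _ ≤ _ := by gcongr; nlinarith

/-! ### Algebra of one step -/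

/-- The denominator `1 + q/2 + q²/12` of the stability function at `-q`. -/
def stabilityDenom (q : ℂ) : ℂ := 1 + q / 2 + q ^ 2 / 12

theorem gaussOffset_complex_sq : (gaussOffset : ℂ) ^ 2 = 1 / 12 := by
  rw [← Complex.ofReal_pow, gaussOffset_sq]; norm_num

theorem norm_gaussOffset : ‖(gaussOffset : ℂ)‖ ≤ 3 / 10 := by
  rw [Complex.norm_real, Real.norm_of_nonneg gaussOffset_pos.le]
  exact gaussOffset_le

theorem stabilityDenom_lower {q : ℂ} (hq : 60 ≤ ‖q‖) : ‖q‖ ^ 2 / 14 ≤ ‖stabilityDenom q‖ := by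
  have h1 : ‖q ^ 2 / 12‖ = ‖q‖ ^ 2 / 12 := by rw [norm_div, norm_pow]; norm_num
  have h2 : ‖1 + q / 2‖ ≤ 1 + ‖q‖ / 2 := by
    refine (norm_add_le _ _).trans ?_
    rw [norm_div]; norm_num
  have h3 : ‖q ^ 2 / 12‖ - ‖1 + q / 2‖ ≤ ‖stabilityDenom q‖ := by
    have := norm_sub_norm_le (q ^ 2 / 12) (-(1 + q / 2))
    rw [norm_neg, sub_neg_eq_add] at this
    have e : stabilityDenom q = q ^ 2 / 12 + (1 + q / 2) := by rw [stabilityDenom]; ring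
    rwa [e]
  rw [h1] at h3
  nlinarith

theorem stabilityDenom_ne_zero {q : ℂ} (hq : 60 ≤ ‖q‖) : stabilityDenom q ≠ 0 := by
  have := stabilityDenom_lower hq
  rw [← norm_pos_iff]
  nlinarith

/-- The stability function `R(-q) = 1 - q / (1 + q/2 + q²/12)` tends to `1` as `q → ∞`, but it
still damps by a factor `1 - O(1/|q|)` in a sector. -/
theorem norm_stability_le {q : ℂ} {c₀ : ℝ} (hc : 0 < c₀) (hq : 60 ≤ ‖q‖) (hre : c₀ * ‖q‖ ≤ q.re) :
    ‖1 - q / stabilityDenom q‖ ≤ 1 - c₀ / ‖q‖ := by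
  have hq0 : 0 < ‖q‖ := by linarith
  have hc1 : c₀ ≤ 1 := by
    have := hre.trans (Complex.re_le_norm q)
    by_contra h
    push Not at h
    nlinarith
  have hd := stabilityDenom_ne_zero hq
  have e : 1 - q / stabilityDenom q = (1 - q / 2 + q ^ 2 / 12) / stabilityDenom q := by
    field_simp
    rw [stabilityDenom]; ring
  have hdn : 0 < ‖stabilityDenom q‖ := norm_pos_iff.mpr hd
  rw [e, norm_div, div_le_iff₀ hdn]
  have hf : 0 ≤ 1 - c₀ / ‖q‖ := by
    rw [sub_nonneg, div_le_one hq0]; linarith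
  have hup : ‖stabilityDenom q‖ ≤ ‖q‖ ^ 2 / 10 := by
    have : ‖stabilityDenom q‖ ≤ 1 + ‖q‖ / 2 + ‖q‖ ^ 2 / 12 := by
      refine (norm_add_le _ _).trans ?_
      gcongr
      · refine (norm_add_le _ _).trans ?_
        rw [norm_div]; norm_num
      · rw [norm_div, norm_pow]; norm_num
    nlinarith
  -- numerator and denominator of `R(-q)` differ in the sign of the odd part, so their squared
  -- moduli differ by a positive multiple of `Re q`
  have hdiff : ‖stabilityDenom q‖ ^ 2 - ‖1 - q / 2 + q ^ 2 / 12‖ ^ 2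
      = 2 * q.re * (1 + ‖q‖ ^ 2 / 12) := by
    rw [stabilityDenom, ← Complex.normSq_eq_norm_sq, ← Complex.normSq_eq_norm_sq,
      ← Complex.normSq_eq_norm_sq]
    simp only [Complex.normSq_apply, Complex.add_re, Complex.add_im, Complex.sub_re,
      Complex.sub_im, Complex.one_re, Complex.one_im, Complex.div_ofNat_re, Complex.div_ofNat_im,
      pow_two, Complex.mul_re, Complex.mul_im]
    ring
  refine le_of_sq_le_sq ?_ (mul_nonneg hf hdn.le)
  rw [mul_pow]
  have h1 : (c₀ / ‖q‖) * ‖stabilityDenom q‖ ^ 2 ≤ c₀ * ‖q‖ ^ 3 / 100 := by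
    calc _ ≤ (c₀ / ‖q‖) * (‖q‖ ^ 2 / 10) ^ 2 := by gcongr
      _ = _ := by field_simp; norm_num
  have h2 : c₀ * ‖q‖ ^ 3 / 6 ≤ 2 * q.re * (1 + ‖q‖ ^ 2 / 12) := by
    have : c₀ * ‖q‖ * ‖q‖ ^ 2 ≤ q.re * ‖q‖ ^ 2 := by gcongr
    have h0 : 0 ≤ q.re := by nlinarith
    nlinarith
  have h3 : 0 ≤ (c₀ / ‖q‖) ^ 2 * ‖stabilityDenom q‖ ^ 2 := by positivity
  have h4 : 0 ≤ c₀ * ‖q‖ ^ 3 := by positivity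
  nlinarith

/-- The solution of the linear system of the stiff stages. -/
theorem stiff_stage_solve {q E₁ E₂ ρ₁ ρ₂ : ℂ}
    (h1 : E₁ + q * (1 / 4 * E₁ + (1 / 4 - gaussOffset) * E₂) = ρ₁)
    (h2 : E₂ + q * ((1 / 4 + gaussOffset) * E₁ + 1 / 4 * E₂) = ρ₂) :
    stabilityDenom q * E₁ = (1 + q / 4) * ρ₁ - q * (1 / 4 - gaussOffset) * ρ₂ ∧
      stabilityDenom q * E₂ = (1 + q / 4) * ρ₂ - q * (1 / 4 + gaussOffset) * ρ₁ := by
  have hr := gaussOffset_complex_sq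
  rw [stabilityDenom, ← h1, ← h2]
  constructor
  · linear_combination (-q ^ 2 * E₁) * hr
  · linear_combination (-q ^ 2 * E₂) * hr

theorem norm_stiff_stage_le {q E₁ E₂ ρ₁ ρ₂ : ℂ} {ρ : ℝ} (hq : 60 ≤ ‖q‖)
    (h1 : E₁ + q * (1 / 4 * E₁ + (1 / 4 - gaussOffset) * E₂) = ρ₁)
    (h2 : E₂ + q * ((1 / 4 + gaussOffset) * E₁ + 1 / 4 * E₂) = ρ₂)
    (hρ1 : ‖ρ₁‖ ≤ ρ) (hρ2 : ‖ρ₂‖ ≤ ρ) : ‖E₁‖ ≤ 12 / ‖q‖ * ρ ∧ ‖E₂‖ ≤ 12 / ‖q‖ * ρ := by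
  have hq0 : 0 < ‖q‖ := by linarith
  have hρ : 0 ≤ ρ := (norm_nonneg _).trans hρ1
  obtain ⟨e1, e2⟩ := stiff_stage_solve h1 h2
  have hd := stabilityDenom_lower hq
  have hr := norm_gaussOffset
  have b0 : ‖1 + q / 4‖ ≤ 1 + ‖q‖ / 4 := by
    refine (norm_add_le _ _).trans ?_
    rw [norm_div]; norm_num
  have b1 : ‖(1 / 4 - gaussOffset : ℂ)‖ ≤ 11 / 20 := by
    refine (norm_sub_le _ _).trans ?_
    have : ‖(1 / 4 : ℂ)‖ = 1 / 4 := by norm_num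
    linarith
  have b2 : ‖(1 / 4 + gaussOffset : ℂ)‖ ≤ 11 / 20 := by
    refine (norm_add_le _ _).trans ?_
    have : ‖(1 / 4 : ℂ)‖ = 1 / 4 := by norm_num
    linarith
  have fin : ∀ {E a b s t : ℂ}, stabilityDenom q * E = (1 + q / 4) * a - q * s * b →
      ‖s‖ ≤ 11 / 20 → ‖a‖ ≤ ρ → ‖b‖ ≤ ρ → ‖E‖ ≤ 12 / ‖q‖ * ρ := by
    intro E a b s t he hs ha hb
    have hn : ‖stabilityDenom q‖ * ‖E‖ ≤ (1 + ‖q‖ / 4) * ρ + ‖q‖ * (11 / 20) * ρ := by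
      rw [← norm_mul, he]
      refine (norm_sub_le _ _).trans ?_
      rw [norm_mul, norm_mul, norm_mul]
      gcongr
    have h5 : ‖q‖ ^ 2 / 14 * ‖E‖ ≤ 49 / 60 * ‖q‖ * ρ := by
      have : ‖q‖ ^ 2 / 14 * ‖E‖ ≤ ‖stabilityDenom q‖ * ‖E‖ := by gcongr
      nlinarith
    rw [div_mul_eq_mul_div, le_div_iff₀ hq0]
    have : ‖q‖ * (‖E‖ * ‖q‖) ≤ ‖q‖ * (12 * ρ) := by nlinarith
    exact le_of_mul_le_mul_left this hq0
  exact ⟨fin (t := 0) e1 b1 hρ1 hρ2, fin (t := 0) e2 b2 hρ2 hρ1⟩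

/-- The equations for the errors of one step: `eu, ev` are the errors at the left end, `eu', ev'`
those at the right end, `EU, EV` those of the stages, `dU, dV, thU, thV` the defects of the exact
solution in the stages and in the update, and `g` the values of `-ψ / κ` at the Gauss nodes. -/
structure StepErrors (κ : ℂ) (h : ℝ) (g₁ g₂ eu ev dU₁ dU₂ dV₁ dV₂ thU thV EU₁ EU₂ EV₁ EV₂
    eu' ev' : ℂ) : Prop where
  stage_u₁ : EU₁ = eu + h * (1 / 4 * (g₁ * (EU₁ + EV₁))
    + (1 / 4 - gaussOffset) * (g₂ * (EU₂ + EV₂))) - dU₁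
  stage_u₂ : EU₂ = eu + h * ((1 / 4 + gaussOffset) * (g₁ * (EU₁ + EV₁))
    + 1 / 4 * (g₂ * (EU₂ + EV₂))) - dU₂
  stage_v₁ : EV₁ = ev + h * (1 / 4 * (-κ * EV₁ - g₁ * (EU₁ + EV₁))
    + (1 / 4 - gaussOffset) * (-κ * EV₂ - g₂ * (EU₂ + EV₂))) - dV₁
  stage_v₂ : EV₂ = ev + h * ((1 / 4 + gaussOffset) * (-κ * EV₁ - g₁ * (EU₁ + EV₁))
    + 1 / 4 * (-κ * EV₂ - g₂ * (EU₂ + EV₂))) - dV₂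
  update_u : eu' = eu + h / 2 * (g₁ * (EU₁ + EV₁) + g₂ * (EU₂ + EV₂)) - thU
  update_v : ev' = ev + h / 2 * ((-κ * EV₁ - g₁ * (EU₁ + EV₁))
    + (-κ * EV₂ - g₂ * (EU₂ + EV₂))) - thV

section Errors

variable {κ : ℂ} {h : ℝ} {g₁ g₂ eu ev dU₁ dU₂ dV₁ dV₂ thU thV EU₁ EU₂ EV₁ EV₂ eu' ev' : ℂ}
  {γ Γ dU dV Y : ℝ}

theorem norm_coeff_sum_le {h : ℝ} (hh : 0 ≤ h) {a b n₁ n₂ : ℂ} {N : ℝ} (ha : ‖a‖ + ‖b‖ ≤ 1)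
    (h1 : ‖n₁‖ ≤ N) (h2 : ‖n₂‖ ≤ N) : ‖(h : ℂ) * (a * n₁ + b * n₂)‖ ≤ h * N := by
  have hN : 0 ≤ N := (norm_nonneg _).trans h1
  rw [norm_mul, Complex.norm_real, Real.norm_of_nonneg hh]
  refine mul_le_mul_of_nonneg_left ((norm_add_le _ _).trans ?_) hh
  rw [norm_mul, norm_mul]
  calc ‖a‖ * ‖n₁‖ + ‖b‖ * ‖n₂‖ ≤ ‖a‖ * N + ‖b‖ * N := by gcongr
    _ = (‖a‖ + ‖b‖) * N := by ring
    _ ≤ 1 * N := by gcongr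
    _ = N := one_mul _

theorem norm_coeff_fst : ‖(1 / 4 : ℂ)‖ + ‖(1 / 4 - gaussOffset : ℂ)‖ ≤ 1 := by
  have := norm_gaussOffset
  have h1 : ‖(1 / 4 : ℂ)‖ = 1 / 4 := by norm_num
  have := norm_sub_le (1 / 4 : ℂ) gaussOffset
  linarith

theorem norm_coeff_snd : ‖(1 / 4 + gaussOffset : ℂ)‖ + ‖(1 / 4 : ℂ)‖ ≤ 1 := by
  have := norm_gaussOffset
  have h1 : ‖(1 / 4 : ℂ)‖ = 1 / 4 := by norm_num
  have := norm_add_le (1 / 4 : ℂ) gaussOffset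
  linarith

theorem norm_offset_mul_le {q : ℂ} (hq : 60 ≤ ‖q‖) :
    ‖1 + q * gaussOffset‖ ≤ 8 / 25 * ‖q‖ ∧ ‖1 - q * gaussOffset‖ ≤ 8 / 25 * ‖q‖ := by
  have hr := norm_gaussOffset
  have h1 : ‖q * gaussOffset‖ ≤ ‖q‖ * (3 / 10) := by
    rw [norm_mul]; gcongr
  constructor
  · refine (norm_add_le _ _).trans ?_
    rw [norm_one]; linarith
  · refine (norm_sub_le _ _).trans ?_
    rw [norm_one]; linarith

/-- The stage errors are bounded by the errors at the left end and the defects. The coupling of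
the stages through `g` is absorbed because `h γ ≤ 1 / 16` and `12 / |h κ| ≤ 1 / 5`; the stiff data
gain the factor `1 / (h |κ|)`. -/
theorem StepErrors.norm_stage_le
    (H : StepErrors κ h g₁ g₂ eu ev dU₁ dU₂ dV₁ dV₂ thU thV EU₁ EU₂ EV₁ EV₂ eu' ev')
    (hh : 0 < h) (hq : 60 ≤ h * ‖κ‖) (hg1 : ‖g₁‖ ≤ γ) (hg2 : ‖g₂‖ ≤ γ) (hγ : h * γ ≤ 1 / 16)
    (hU1 : ‖dU₁‖ ≤ dU) (hU2 : ‖dU₂‖ ≤ dU) (hV1 : ‖dV₁‖ ≤ dV) (hV2 : ‖dV₂‖ ≤ dV) :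
    ‖EU₁ + EV₁‖ ≤ 2 * (‖eu‖ + dU) + 24 / (h * ‖κ‖) * (‖ev‖ + dV) ∧
      ‖EU₂ + EV₂‖ ≤ 2 * (‖eu‖ + dU) + 24 / (h * ‖κ‖) * (‖ev‖ + dV) := by
  have hqn : ‖(h : ℂ) * κ‖ = h * ‖κ‖ := by
    rw [norm_mul, Complex.norm_real, Real.norm_of_nonneg hh.le]
  set q : ℂ := h * κ with hqd
  have hq' : 60 ≤ ‖q‖ := by rw [hqn]; exact hq
  have hγ0 : 0 ≤ γ := (norm_nonneg _).trans hg1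
  rw [← hqn]
  set Y := max ‖EU₁ + EV₁‖ ‖EU₂ + EV₂‖ with hY
  have hY0 : 0 ≤ Y := (norm_nonneg _).trans (le_max_left _ _)
  have n1 : ‖g₁ * (EU₁ + EV₁)‖ ≤ γ * Y := by
    rw [norm_mul]; exact mul_le_mul hg1 (le_max_left _ _) (norm_nonneg _) hγ0
  have n2 : ‖g₂ * (EU₂ + EV₂)‖ ≤ γ * Y := by
    rw [norm_mul]; exact mul_le_mul hg2 (le_max_right _ _) (norm_nonneg _) hγ0
  have w1 := norm_coeff_sum_le hh.le norm_coeff_fst n1 n2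
  have w2 := norm_coeff_sum_le hh.le norm_coeff_snd n1 n2
  set w₁ := (h : ℂ) * (1 / 4 * (g₁ * (EU₁ + EV₁)) + (1 / 4 - gaussOffset) * (g₂ * (EU₂ + EV₂)))
  set w₂ := (h : ℂ) * ((1 / 4 + gaussOffset) * (g₁ * (EU₁ + EV₁)) + 1 / 4 * (g₂ * (EU₂ + EV₂)))
  have hw : h * (γ * Y) ≤ 1 / 16 * Y := by nlinarith
  have ρb : ∀ {w d : ℂ}, ‖w‖ ≤ h * (γ * Y) → ‖d‖ ≤ dV → ‖ev - w - d‖ ≤ ‖ev‖ + 1 / 16 * Y + dV := by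
    intro w d h1 h2
    refine (norm_sub_le _ _).trans (add_le_add ((norm_sub_le _ _).trans ?_) h2)
    linarith
  obtain ⟨v1, v2⟩ := norm_stiff_stage_le hq' (E₁ := EV₁) (E₂ := EV₂) (ρ₁ := ev - w₁ - dV₁)
    (ρ₂ := ev - w₂ - dV₂) (by linear_combination H.stage_v₁) (by linear_combination H.stage_v₂)
    (ρb w1 hV1) (ρb w2 hV2)
  have ub : ∀ {w d : ℂ}, ‖w‖ ≤ h * (γ * Y) → ‖d‖ ≤ dU → ‖eu + w - d‖ ≤ ‖eu‖ + 1 / 16 * Y + dU := by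
    intro w d h1 h2
    refine (norm_sub_le _ _).trans (add_le_add ((norm_add_le _ _).trans ?_) h2)
    linarith
  have u1 : ‖EU₁‖ ≤ ‖eu‖ + 1 / 16 * Y + dU := by rw [H.stage_u₁]; exact ub w1 hU1
  have u2 : ‖EU₂‖ ≤ ‖eu‖ + 1 / 16 * Y + dU := by rw [H.stage_u₂]; exact ub w2 hU2
  have hc : 12 / ‖q‖ ≤ 1 / 5 := by rw [div_le_iff₀ (by linarith)]; linarith
  have hc0 : 0 ≤ 12 / ‖q‖ := by positivity
  have hYle : Y ≤ ‖eu‖ + 1 / 16 * Y + dU + 12 / ‖q‖ * (‖ev‖ + 1 / 16 * Y + dV) := by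
    refine max_le ?_ ?_
    · exact (norm_add_le _ _).trans (add_le_add u1 v1)
    · exact (norm_add_le _ _).trans (add_le_add u2 v2)
  have e24 : 24 / ‖q‖ = 2 * (12 / ‖q‖) := by ring
  have fin : Y ≤ 2 * (‖eu‖ + dU) + 24 / ‖q‖ * (‖ev‖ + dV) := by
    rw [e24]
    have : 12 / ‖q‖ * (1 / 16 * Y) ≤ 1 / 5 * (1 / 16 * Y) := by gcongr
    have h1 := norm_nonneg eu
    have h2 : 0 ≤ 12 / ‖q‖ * (‖ev‖ + dV) :=
      mul_nonneg hc0 (add_nonneg (norm_nonneg _) ((norm_nonneg _).trans hV1))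
    have h3 : 0 ≤ dU := (norm_nonneg _).trans hU1
    nlinarith
  exact ⟨(le_max_left _ _).trans fin, (le_max_right _ _).trans fin⟩

theorem StepErrors.norm_update_u_le
    (H : StepErrors κ h g₁ g₂ eu ev dU₁ dU₂ dV₁ dV₂ thU thV EU₁ EU₂ EV₁ EV₂ eu' ev')
    (hh : 0 < h) (hg1 : ‖g₁‖ ≤ γ) (hg2 : ‖g₂‖ ≤ γ)
    (hY1 : ‖EU₁ + EV₁‖ ≤ Y) (hY2 : ‖EU₂ + EV₂‖ ≤ Y) :
    ‖eu'‖ ≤ ‖eu‖ + h * (γ * Y) + ‖thU‖ := by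
  have hγ0 : 0 ≤ γ := (norm_nonneg _).trans hg1
  have n1 : ‖g₁ * (EU₁ + EV₁)‖ ≤ γ * Y := by
    rw [norm_mul]; exact mul_le_mul hg1 hY1 (norm_nonneg _) hγ0
  have n2 : ‖g₂ * (EU₂ + EV₂)‖ ≤ γ * Y := by
    rw [norm_mul]; exact mul_le_mul hg2 hY2 (norm_nonneg _) hγ0
  have := norm_coeff_sum_le hh.le (a := 1 / 2) (b := 1 / 2) (by norm_num) n1 n2
  rw [H.update_u]
  refine (norm_sub_le _ _).trans
    (add_le_add ((norm_add_le _ _).trans (add_le_add le_rfl ?_)) le_rfl)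
  refine le_of_eq_of_le (congrArg _ ?_) this
  ring

/-- Elimination of the stiff stages multiplies `ev` by the stability function at `-h κ`, and the
coupling terms by `O(1 / κ)` instead of `O(h)`. -/
theorem StepErrors.norm_update_v_le
    (H : StepErrors κ h g₁ g₂ eu ev dU₁ dU₂ dV₁ dV₂ thU thV EU₁ EU₂ EV₁ EV₂ eu' ev')
    (hh : 0 < h) (hq : 60 ≤ h * ‖κ‖) (hg1 : ‖g₁‖ ≤ γ) (hg2 : ‖g₂‖ ≤ γ)
    (hV1 : ‖dV₁‖ ≤ dV) (hV2 : ‖dV₂‖ ≤ dV) (hY1 : ‖EU₁ + EV₁‖ ≤ Y) (hY2 : ‖EU₂ + EV₂‖ ≤ Y) :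
    ‖ev'‖ ≤ ‖1 - h * κ / stabilityDenom (h * κ)‖ * ‖ev‖ + 5 / ‖κ‖ * (γ * Y) + 5 * dV + ‖thV‖ := by
  have hqn : ‖(h : ℂ) * κ‖ = h * ‖κ‖ := by
    rw [norm_mul, Complex.norm_real, Real.norm_of_nonneg hh.le]
  have hκ : 0 < ‖κ‖ := by
    by_contra hc
    have : ‖κ‖ = 0 := le_antisymm (not_lt.mp hc) (norm_nonneg _)
    rw [this] at hq; linarith
  set q : ℂ := h * κ with hqd
  have hq' : 60 ≤ ‖q‖ := by rw [hqn]; exact hq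
  have hq0 : 0 < ‖q‖ := by linarith
  have hγ0 : 0 ≤ γ := (norm_nonneg _).trans hg1
  have hY0 : 0 ≤ Y := (norm_nonneg _).trans hY1
  have hdV0 : 0 ≤ dV := (norm_nonneg _).trans hV1
  have n1 : ‖g₁ * (EU₁ + EV₁)‖ ≤ γ * Y := by
    rw [norm_mul]; exact mul_le_mul hg1 hY1 (norm_nonneg _) hγ0
  have n2 : ‖g₂ * (EU₂ + EV₂)‖ ≤ γ * Y := by
    rw [norm_mul]; exact mul_le_mul hg2 hY2 (norm_nonneg _) hγ0
  set n₁ := g₁ * (EU₁ + EV₁)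
  set n₂ := g₂ * (EU₂ + EV₂)
  have hd := stabilityDenom_lower hq'
  have hne := stabilityDenom_ne_zero hq'
  have hdn : 0 < ‖stabilityDenom q‖ := norm_pos_iff.mpr hne
  obtain ⟨s1, s2⟩ := stiff_stage_solve (q := q) (E₁ := EV₁) (E₂ := EV₂)
    (ρ₁ := ev - h * (1 / 4 * n₁ + (1 / 4 - gaussOffset) * n₂) - dV₁)
    (ρ₂ := ev - h * ((1 / 4 + gaussOffset) * n₁ + 1 / 4 * n₂) - dV₂)
    (by linear_combination H.stage_v₁) (by linear_combination H.stage_v₂)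
  have hr := gaussOffset_complex_sq
  have key : stabilityDenom q * (ev' - (ev - thV)) = -q * ev
      + h / 2 * (n₁ * (-(1 - q * gaussOffset)) - n₂ * (1 + q * gaussOffset))
      + q / 2 * (dV₁ * (1 - q * gaussOffset) + dV₂ * (1 + q * gaussOffset)) := by
    rw [H.update_v]
    have : stabilityDenom q * (ev + h / 2 * ((-κ * EV₁ - n₁) + (-κ * EV₂ - n₂)) - thV
        - (ev - thV)) = -q / 2 * (stabilityDenom q * EV₁ + stabilityDenom q * EV₂)
        - h / 2 * stabilityDenom q * (n₁ + n₂) := by rw [hqd]; ring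
    rw [this, s1, s2, stabilityDenom]
    linear_combination (q ^ 2 * h / 2 * (n₁ + n₂)) * hr
  have e : ev' = (1 - q / stabilityDenom q) * ev
      + h / 2 * (n₁ * (-(1 - q * gaussOffset)) - n₂ * (1 + q * gaussOffset)) / stabilityDenom q
      + q / 2 * (dV₁ * (1 - q * gaussOffset) + dV₂ * (1 + q * gaussOffset)) / stabilityDenom q
      - thV := by
    have k2 : ev' - (ev - thV) = (-q * ev
        + h / 2 * (n₁ * (-(1 - q * gaussOffset)) - n₂ * (1 + q * gaussOffset))
        + q / 2 * (dV₁ * (1 - q * gaussOffset) + dV₂ * (1 + q * gaussOffset)))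
        / stabilityDenom q := by
      rw [eq_div_iff hne]
      linear_combination key
    linear_combination k2
  clear_value n₁ n₂
  obtain ⟨o1, o2⟩ := norm_offset_mul_le hq'
  have hhalf : ‖(h / 2 : ℂ)‖ = h / 2 := by
    rw [norm_div, Complex.norm_real, Real.norm_of_nonneg hh.le]; norm_num
  have hqhalf : ‖(q / 2 : ℂ)‖ = ‖q‖ / 2 := by rw [norm_div]; norm_num
  have t1 : ‖h / 2 * (n₁ * (-(1 - q * gaussOffset)) - n₂ * (1 + q * gaussOffset))
      / stabilityDenom q‖ ≤ 5 / ‖κ‖ * (γ * Y) := by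
    rw [norm_div, norm_mul, hhalf, div_le_iff₀ hdn]
    have hb : ‖n₁ * (-(1 - q * gaussOffset)) - n₂ * (1 + q * gaussOffset)‖
        ≤ γ * Y * (8 / 25 * ‖q‖) + γ * Y * (8 / 25 * ‖q‖) := by
      refine (norm_sub_le _ _).trans ?_
      rw [norm_mul, norm_mul, norm_neg]
      gcongr
    calc h / 2 * ‖n₁ * (-(1 - q * gaussOffset)) - n₂ * (1 + q * gaussOffset)‖
        ≤ h / 2 * (γ * Y * (8 / 25 * ‖q‖) + γ * Y * (8 / 25 * ‖q‖)) := by gcongr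
      _ = 8 / 25 * (h * (γ * Y) * (h * ‖κ‖)) := by rw [hqn]; ring
      _ ≤ 5 / 14 * (h * (γ * Y) * (h * ‖κ‖)) := by
          have : 0 ≤ h * (γ * Y) * (h * ‖κ‖) := by positivity
          linarith
      _ = 5 / ‖κ‖ * (γ * Y) * (‖q‖ ^ 2 / 14) := by rw [hqn]; field_simp
      _ ≤ _ := by gcongr
  have t2 : ‖q / 2 * (dV₁ * (1 - q * gaussOffset) + dV₂ * (1 + q * gaussOffset))
      / stabilityDenom q‖ ≤ 5 * dV := by
    rw [norm_div, norm_mul, hqhalf, div_le_iff₀ hdn]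
    have hb : ‖dV₁ * (1 - q * gaussOffset) + dV₂ * (1 + q * gaussOffset)‖
        ≤ dV * (8 / 25 * ‖q‖) + dV * (8 / 25 * ‖q‖) := by
      refine (norm_add_le _ _).trans ?_
      rw [norm_mul, norm_mul]
      gcongr
    calc ‖q‖ / 2 * ‖dV₁ * (1 - q * gaussOffset) + dV₂ * (1 + q * gaussOffset)‖
        ≤ ‖q‖ / 2 * (dV * (8 / 25 * ‖q‖) + dV * (8 / 25 * ‖q‖)) := by gcongr
      _ = 8 / 25 * (dV * ‖q‖ ^ 2) := by ring
      _ ≤ 5 / 14 * (dV * ‖q‖ ^ 2) := by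
          have : 0 ≤ dV * ‖q‖ ^ 2 := by positivity
          linarith
      _ = 5 * dV * (‖q‖ ^ 2 / 14) := by ring
      _ ≤ _ := by gcongr
  rw [e]
  refine (norm_sub_le _ _).trans (add_le_add ((norm_add_le _ _).trans
    (add_le_add ((norm_add_le _ _).trans (add_le_add ?_ t1)) t2)) le_rfl)
  rw [norm_mul]

/-- The effect of the stiff stage errors on the nonstiff component. The error `ev` enters with the
factor `b^T (I + q 𝒜)⁻¹ 1 = O(q⁻²)` instead of the `O(q⁻¹)` of a single stage; this cancellation
is `R(∞) = 1`. -/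
theorem StepErrors.norm_coupling_le
    (H : StepErrors κ h g₁ g₂ eu ev dU₁ dU₂ dV₁ dV₂ thU thV EU₁ EU₂ EV₁ EV₂ eu' ev')
    (hh : 0 < h) (hq : 60 ≤ h * ‖κ‖) (hg1 : ‖g₁‖ ≤ γ) (hg2 : ‖g₂‖ ≤ γ) (hΓ : ‖g₁ - g₂‖ ≤ Γ)
    (hV1 : ‖dV₁‖ ≤ dV) (hV2 : ‖dV₂‖ ≤ dV) (hY1 : ‖EU₁ + EV₁‖ ≤ Y) (hY2 : ‖EU₂ + EV₂‖ ≤ Y) :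
    ‖h / 2 * (g₁ * EV₁ + g₂ * EV₂)‖ ≤
      14 * h * ‖ev‖ / (h * ‖κ‖) ^ 2 * (γ + h * ‖κ‖ * Γ)
        + 12 / ‖κ‖ * γ * (h * (γ * Y) + dV) := by
  have hqn : ‖(h : ℂ) * κ‖ = h * ‖κ‖ := by
    rw [norm_mul, Complex.norm_real, Real.norm_of_nonneg hh.le]
  have hκ : 0 < ‖κ‖ := by
    by_contra hc
    have : ‖κ‖ = 0 := le_antisymm (not_lt.mp hc) (norm_nonneg _)
    rw [this] at hq; linarith
  set q : ℂ := h * κ with hqd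
  have hq' : 60 ≤ ‖q‖ := by rw [hqn]; exact hq
  have hq0 : 0 < ‖q‖ := by linarith
  have hγ0 : 0 ≤ γ := (norm_nonneg _).trans hg1
  have n1 : ‖g₁ * (EU₁ + EV₁)‖ ≤ γ * Y := by
    rw [norm_mul]; exact mul_le_mul hg1 hY1 (norm_nonneg _) hγ0
  have n2 : ‖g₂ * (EU₂ + EV₂)‖ ≤ γ * Y := by
    rw [norm_mul]; exact mul_le_mul hg2 hY2 (norm_nonneg _) hγ0
  have w1 := norm_coeff_sum_le hh.le norm_coeff_fst n1 n2
  have w2 := norm_coeff_sum_le hh.le norm_coeff_snd n1 n2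
  have hd := stabilityDenom_lower hq'
  have hne := stabilityDenom_ne_zero hq'
  have hdn : 0 < ‖stabilityDenom q‖ := norm_pos_iff.mpr hne
  have hr := gaussOffset_complex_sq
  -- `(P₁, P₂) = (I + q 𝒜)⁻¹ (1, 1)` carries the response of the stages to `ev`
  set P₁ : ℂ := (1 + q * gaussOffset) / stabilityDenom q with hP1
  set P₂ : ℂ := (1 - q * gaussOffset) / stabilityDenom q with hP2
  have p1 : P₁ + q * (1 / 4 * P₁ + (1 / 4 - gaussOffset) * P₂) = 1 := by
    rw [hP1, hP2]
    field_simp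
    rw [stabilityDenom]
    linear_combination 4 * q ^ 2 * hr
  have p2 : P₂ + q * ((1 / 4 + gaussOffset) * P₁ + 1 / 4 * P₂) = 1 := by
    rw [hP1, hP2]
    field_simp
    rw [stabilityDenom]
    linear_combination 4 * q ^ 2 * hr
  obtain ⟨v1, v2⟩ := norm_stiff_stage_le hq' (E₁ := EV₁ - P₁ * ev) (E₂ := EV₂ - P₂ * ev)
    (ρ₁ := -(h * (1 / 4 * (g₁ * (EU₁ + EV₁)) + (1 / 4 - gaussOffset) * (g₂ * (EU₂ + EV₂)))) - dV₁)
    (ρ₂ := -(h * ((1 / 4 + gaussOffset) * (g₁ * (EU₁ + EV₁)) + 1 / 4 * (g₂ * (EU₂ + EV₂)))) - dV₂)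
    (ρ := h * (γ * Y) + dV)
    (by linear_combination H.stage_v₁ - ev * p1) (by linear_combination H.stage_v₂ - ev * p2)
    ((norm_sub_le _ _).trans (add_le_add (by rw [norm_neg]; exact w1) hV1))
    ((norm_sub_le _ _).trans (add_le_add (by rw [norm_neg]; exact w2) hV2))
  have hhalf : ‖(h / 2 : ℂ)‖ = h / 2 := by
    rw [norm_div, Complex.norm_real, Real.norm_of_nonneg hh.le]; norm_num
  have e : h / 2 * (g₁ * EV₁ + g₂ * EV₂)
      = h / 2 * (ev * ((g₁ + g₂) + q * gaussOffset * (g₁ - g₂)) / stabilityDenom q)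
        + h / 2 * (g₁ * (EV₁ - P₁ * ev) + g₂ * (EV₂ - P₂ * ev)) := by
    rw [hP1, hP2]
    field_simp
    ring
  rw [e]
  refine (norm_add_le _ _).trans (add_le_add ?_ ?_)
  · rw [norm_mul, hhalf, norm_div, norm_mul]
    have hΓ0 : 0 ≤ Γ := (norm_nonneg _).trans hΓ
    have hb : ‖(g₁ + g₂) + q * gaussOffset * (g₁ - g₂)‖ ≤ 2 * (γ + ‖q‖ * Γ) := by
      refine (norm_add_le _ _).trans ?_
      rw [norm_mul, norm_mul]
      have a1 := norm_add_le g₁ g₂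
      have a2 : ‖q‖ * ‖(gaussOffset : ℂ)‖ * ‖g₁ - g₂‖ ≤ ‖q‖ * (3 / 10) * Γ := by
        gcongr; exact norm_gaussOffset
      have a3 : 0 ≤ ‖q‖ * Γ := by positivity
      linarith
    calc h / 2 * (‖ev‖ * ‖(g₁ + g₂) + q * gaussOffset * (g₁ - g₂)‖ / ‖stabilityDenom q‖)
        ≤ h / 2 * (‖ev‖ * (2 * (γ + ‖q‖ * Γ)) / (‖q‖ ^ 2 / 14)) := by gcongr
      _ = _ := by rw [hqn]; field_simp
  · rw [norm_mul, hhalf]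
    have hρ0 : 0 ≤ 12 / ‖q‖ * (h * (γ * Y) + dV) := (norm_nonneg _).trans v1
    have hb : ‖g₁ * (EV₁ - P₁ * ev) + g₂ * (EV₂ - P₂ * ev)‖
        ≤ γ * (12 / ‖q‖ * (h * (γ * Y) + dV)) + γ * (12 / ‖q‖ * (h * (γ * Y) + dV)) := by
      refine (norm_add_le _ _).trans ?_
      rw [norm_mul, norm_mul]
      gcongr
    calc h / 2 * ‖g₁ * (EV₁ - P₁ * ev) + g₂ * (EV₂ - P₂ * ev)‖
        ≤ h / 2 * (γ * (12 / ‖q‖ * (h * (γ * Y) + dV)) + γ * (12 / ‖q‖ * (h * (γ * Y) + dV))) := by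
          gcongr
      _ = _ := by rw [hqn]; field_simp; ring

end Errors

/-! ### The exact solution on one cell -/

/-- The symplecticity of the Gauss method, `b_i a_ij + b_j a_ji = b_i b_j`, as a relation between
the quadrature error of `u' (u - u(x + h))` and the stage defects of `u`. -/
theorem gaussDefect_symplectic {u : ℝ → ℂ} (hu : ContDiff ℝ ∞ u) (x h : ℝ) :
    gaussDefect (fun t => deriv u t * (u t - u (x + h))) x h =
      h / 2 * (deriv u (x + (1 / 2 - gaussOffset) * h)
          * stageDefect u x h (1 / 2 - gaussOffset) (1 / 4) (1 / 4 - gaussOffset)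
        + deriv u (x + (1 / 2 + gaussOffset) * h)
          * stageDefect u x h (1 / 2 + gaussOffset) (1 / 4 + gaussOffset) (1 / 4))
      + gaussDefect (deriv u) x h ^ 2 / 2 := by
  have hd : ∀ t, HasDerivAt u (deriv u t) t := fun t =>
    ((hu.differentiable (by simp)) t).hasDerivAt
  have hdc : Continuous (deriv u) := (contDiff_infty_iff_deriv.mp hu).2.continuous
  have i1 : ∫ t in x..(x + h), deriv u t = u (x + h) - u x :=
    intervalIntegral.integral_eq_sub_of_hasDerivAt (fun t _ => hd t) (hdc.intervalIntegrable _ _)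
  have i2 : ∫ t in x..(x + h), deriv u t * (u t - u (x + h)) = -(u (x + h) - u x) ^ 2 / 2 := by
    have hp : ∀ t, HasDerivAt (fun t => (u t - u (x + h)) ^ 2 / 2)
        (deriv u t * (u t - u (x + h))) t := fun t =>
      ((((hd t).sub_const (u (x + h))).pow 2).div_const 2).congr_deriv (by simp; ring)
    have hc : Continuous fun t => deriv u t * (u t - u (x + h)) :=
      hdc.mul (hu.continuous.sub continuous_const)
    rw [intervalIntegral.integral_eq_sub_of_hasDerivAt (fun t _ => hp t)
      (hc.intervalIntegrable _ _)]
    ring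
  simp only [gaussDefect, stageDefect, i1, i2]
  push_cast
  ring

/-- The coefficient `-ψ / κ` of the nonstiff equation. -/
def modelCoeff (ψ : ℝ → ℂ) (κ : ℂ) (x : ℝ) : ℂ := -(ψ x / κ)

theorem ModelSolution.deriv_u_eq {ψ : ℝ → ℂ} {κ : ℂ} {u v : ℝ → ℂ} (hs : ModelSolution ψ κ u v)
    (x : ℝ) : deriv u x = modelCoeff ψ κ x * (u x + v x) := (hs.deriv_u x).deriv

theorem ModelSolution.deriv_v_eq {ψ : ℝ → ℂ} {κ : ℂ} {u v : ℝ → ℂ} (hs : ModelSolution ψ κ u v)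
    (x : ℝ) : deriv v x = -κ * v x - modelCoeff ψ κ x * (u x + v x) := by
  rw [(hs.deriv_v x).deriv, modelCoeff]; ring

theorem IsWeight.le_right_end {ψ : ℝ → ℂ} {m : ℝ → ℝ} {W : ℝ} (hm : IsWeight ψ m W) {x h t : ℝ}
    (h1 : h ≤ 1) (hx : x + h ≤ 0) (ht : t ∈ Set.Icc x (x + h)) : m t ≤ 3 * m (x + h) := by
  have h0 := hm.nonneg hx
  refine (hm.exp_le t (x + h) ht.2 hx).trans ?_
  gcongr
  calc Real.exp (x + h - t) ≤ Real.exp 1 := Real.exp_le_exp.mpr (by linarith [ht.1])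
    _ ≤ 3 := by linarith [Real.exp_one_lt_d9]

/-- The bounds of the exact solution on a cell that the analysis of one step uses; `μ` is the
value of the weight at the right end of the cell. -/
structure CellData (A : ℝ) (ψ : ℝ → ℂ) (κ : ℂ) (u v : ℝ → ℂ) (x h μ : ℝ) : Prop where
  coeff : DerivBound 4 (Set.Icc x (x + h)) (modelCoeff ψ κ) (A * (μ / ‖κ‖))
  deriv_u : DerivBound 4 (Set.Icc x (x + h)) (deriv u) (A * (μ / ‖κ‖))
  v : DerivBound 4 (Set.Icc x (x + h)) v (A * (μ / ‖κ‖ ^ 2))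
  sub_u : DerivBound 4 (Set.Icc x (x + h)) (fun t => u t - u (x + h)) (A * (1 / ‖κ‖))
  smooth : ContDiff ℝ ∞ u
  sub_u_le : ∀ s ∈ Set.Icc x (x + h), ∀ t ∈ Set.Icc x (x + h), ‖u s - u t‖ ≤ A * (h / ‖κ‖)
  half_le : 1 / 2 ≤ ‖u (x + h)‖
  weight_nonneg : 0 ≤ μ
  weight_le : μ ≤ A
  norm_ge : 1 ≤ ‖κ‖
  one_le : 1 ≤ A

/-- The bounds of the exact solution at a point become bounds on a cell, because the weight varies
by a bounded factor over a cell. -/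
theorem exists_cellData (W c₀ : ℝ) (hW : 0 ≤ W) (hc : 0 < c₀) : ∃ A : ℝ, 1 ≤ A ∧
    ∀ (ψ : ℝ → ℂ) (m : ℝ → ℝ), IsWeight ψ m W → ∀ κ : ℂ, kappaBound W c₀ ≤ ‖κ‖ →
    c₀ * ‖κ‖ ≤ κ.re → ∀ u v : ℝ → ℂ, ModelSolution ψ κ u v → ∀ x h : ℝ, 0 < h → h ≤ 1 →
    x + h ≤ 0 → CellData A ψ κ u v x h (m (x + h)) := by
  obtain ⟨C, hC, H⟩ := ModelSolution.deriv_le W c₀ hW hc 4 le_rfl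
  refine ⟨3 * C * (1 + W), by nlinarith, ?_⟩
  intro ψ m hm κ hK hre u v hs x h hh h1 hx
  obtain ⟨k1, k2, k3, k4, -⟩ := kappaBound_spec hW hc hK hre
  have k0 : 0 < ‖κ‖ := by linarith
  have hb := H ψ m hm κ hK hre u v hs
  obtain ⟨cu, cv⟩ := hs.contDiff hm.smooth
  set μ := m (x + h) with hμ
  have hμ0 : 0 ≤ μ := hm.nonneg hx
  have hμW : μ ≤ W := hm.le _ hx
  have ht0 : ∀ t ∈ Set.Icc x (x + h), t ≤ 0 := fun t ht => ht.2.trans hx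
  have htm : ∀ t ∈ Set.Icc x (x + h), m t ≤ 3 * μ := fun t ht => hm.le_right_end h1 hx ht
  have hA3 : 3 * C ≤ 3 * C * (1 + W) := by nlinarith
  have hA : ∀ {a : ℝ}, 0 ≤ a → 3 * C * a ≤ 3 * C * (1 + W) * a := fun ha =>
    mul_le_mul_of_nonneg_right hA3 ha
  have du : ∀ j ≤ 4, ∀ t ∈ Set.Icc x (x + h),
      ‖iteratedDeriv j (deriv u) t‖ ≤ 3 * C * (μ / ‖κ‖) := by
    intro j hj t ht
    rw [← iteratedDeriv_succ']
    refine ((hb j hj t (ht0 t ht)).1).trans ?_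
    calc C * (m t / ‖κ‖) ≤ C * (3 * μ / ‖κ‖) := by gcongr; exact htm t ht
      _ = _ := by ring
  have hdu : ∀ t, HasDerivAt u (deriv u t) t := fun t => (cu.differentiable (by simp) t).hasDerivAt
  have sub : ∀ s ∈ Set.Icc x (x + h), ∀ t ∈ Set.Icc x (x + h),
      ‖u s - u t‖ ≤ 3 * C * W * (h / ‖κ‖) := by
    intro s hs' t ht
    have := (convex_Icc x (x + h)).norm_image_sub_le_of_norm_deriv_le (f := u)
      (C := 3 * C * (μ / ‖κ‖)) (fun y _ => (hdu y).differentiableAt)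
      (fun y hy => by simpa using du 0 (by norm_num) y hy) ht hs'
    refine this.trans ?_
    have hst : ‖s - t‖ ≤ h := by
      rw [Real.norm_eq_abs, abs_le]
      constructor <;> linarith [hs'.1, hs'.2, ht.1, ht.2]
    calc 3 * C * (μ / ‖κ‖) * ‖s - t‖ ≤ 3 * C * (W / ‖κ‖) * h := by gcongr
      _ = _ := by ring
  have hxr : x + h ∈ Set.Icc x (x + h) := ⟨by linarith, le_rfl⟩
  refine ⟨⟨?_, ?_⟩, ⟨?_, ?_⟩, ⟨cv, ?_⟩, ⟨cu.sub contDiff_const, ?_⟩, cu, ?_, ?_, hμ0, ?_, k1, ?_⟩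
  · exact (hm.smooth.div_const κ).neg
  · intro j hj t ht
    have e : modelCoeff ψ κ = fun t => -(1 / κ) * ψ t := by
      funext t; rw [modelCoeff]; ring
    rw [e, iteratedDeriv_const_mul_field, norm_mul, norm_neg, norm_div, norm_one]
    have h2 := (hm.deriv_le j hj t (ht0 t ht)).trans (htm t ht)
    calc 1 / ‖κ‖ * ‖iteratedDeriv j ψ t‖ ≤ 1 / ‖κ‖ * (3 * μ) := by gcongr
      _ = 3 * 1 * (μ / ‖κ‖) := by ring
      _ ≤ 3 * C * (μ / ‖κ‖) := by gcongr
      _ ≤ _ := hA (by positivity)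
  · exact (contDiff_infty_iff_deriv.mp cu).2
  · exact fun j hj t ht => (du j hj t ht).trans (hA (by positivity))
  · intro j hj t ht
    refine ((hb j hj t (ht0 t ht)).2).trans ?_
    calc C * (m t / ‖κ‖ ^ 2) ≤ C * (3 * μ / ‖κ‖ ^ 2) := by gcongr; exact htm t ht
      _ = 3 * C * (μ / ‖κ‖ ^ 2) := by ring
      _ ≤ _ := hA (by positivity)
  · intro j hj t ht
    rcases j with _ | j
    · rw [iteratedDeriv_zero]
      refine (sub t ht _ hxr).trans ?_
      have : h / ‖κ‖ ≤ 1 / ‖κ‖ := by gcongr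
      calc 3 * C * W * (h / ‖κ‖) ≤ 3 * C * W * (1 / ‖κ‖) := by gcongr
        _ ≤ _ := by gcongr; linarith
    · have e : deriv (fun t => u t - u (x + h)) = deriv u := by
        funext y; exact deriv_sub_const _
      rw [iteratedDeriv_succ', e]
      refine (du j (by omega) t ht).trans ?_
      calc 3 * C * (μ / ‖κ‖) ≤ 3 * C * (W / ‖κ‖) := by gcongr
        _ = 3 * C * W * (1 / ‖κ‖) := by ring
        _ ≤ _ := by gcongr; linarith
  · intro s hs' t ht
    refine (sub s hs' t ht).trans ?_
    gcongr; linarith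
  · have h2 := (hs.norm_le hm hc hK hre hx).2.1
    have h3 : 2 * W / ‖κ‖ ≤ 1 / 2 := by rw [div_le_iff₀ k0]; linarith
    have h4 := norm_sub_norm_le (1 : ℂ) (1 - u (x + h))
    rw [norm_one, sub_sub_cancel, norm_sub_rev] at h4
    linarith
  · nlinarith
  · nlinarith

section Cell

variable {A : ℝ} {ψ : ℝ → ℂ} {κ : ℂ} {u v : ℝ → ℂ} {x h μ : ℝ}

theorem CellData.norm_coeff_le (D : CellData A ψ κ u v x h μ) (hh : 0 < h) :
    ‖modelCoeff ψ κ (x + (1 / 2 - gaussOffset) * h)‖ ≤ A * (μ / ‖κ‖) ∧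
    ‖modelCoeff ψ κ (x + (1 / 2 + gaussOffset) * h)‖ ≤ A * (μ / ‖κ‖) :=
  ⟨D.coeff.norm_le (gauss_node_mem hh).1, D.coeff.norm_le (gauss_node_mem hh).2⟩

theorem CellData.norm_coeff_sub_le (D : CellData A ψ κ u v x h μ) (hh : 0 < h) :
    ‖modelCoeff ψ κ (x + (1 / 2 - gaussOffset) * h)
      - modelCoeff ψ κ (x + (1 / 2 + gaussOffset) * h)‖ ≤ A * (h * μ / ‖κ‖) := by
  obtain ⟨n1, n2⟩ := gauss_node_mem (x := x) hh
  have hμ := D.weight_nonneg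
  have hA := D.one_le
  have := (convex_Icc x (x + h)).norm_image_sub_le_of_norm_deriv_le (f := modelCoeff ψ κ)
    (C := A * (μ / ‖κ‖)) (fun y _ => D.coeff.1.differentiable (by simp) y)
    (fun y hy => by simpa using D.coeff.2 1 (by norm_num) y hy) n2 n1
  refine this.trans ?_
  have hst : ‖x + (1 / 2 - gaussOffset) * h - (x + (1 / 2 + gaussOffset) * h)‖ ≤ h := by
    rw [Real.norm_eq_abs, abs_le]
    constructor <;> linarith [n1.1, n1.2, n2.1, n2.2]
  calc A * (μ / ‖κ‖) * _ ≤ A * (μ / ‖κ‖) * h := by gcongr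
    _ = _ := by ring

theorem CellData.norm_stageDefect_u_le (D : CellData A ψ κ u v x h μ) (hh : 0 < h) :
    ‖stageDefect u x h (1 / 2 - gaussOffset) (1 / 4) (1 / 4 - gaussOffset)‖
        ≤ 3 * A * (h ^ 3 * μ / ‖κ‖) ∧
    ‖stageDefect u x h (1 / 2 + gaussOffset) (1 / 4 + gaussOffset) (1 / 4)‖
        ≤ 3 * A * (h ^ 3 * μ / ‖κ‖) := by
  have p := gaussOffset_pos
  have l := gaussOffset_le
  have s := gaussOffset_sq
  have hB : ∀ t ∈ Set.Icc x (x + h), ‖iteratedDeriv 3 u t‖ ≤ A * (μ / ‖κ‖) := fun t ht => by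
    rw [iteratedDeriv_succ']; exact D.deriv_u.2 2 (by norm_num) t ht
  have e : 3 * (A * (μ / ‖κ‖)) * h ^ 3 = 3 * A * (h ^ 3 * μ / ‖κ‖) := by ring
  rw [← e]
  constructor
  · exact norm_stageDefect_le hh D.smooth hB ⟨by linarith, by linarith⟩
      (by rw [abs_le]; constructor <;> linarith) (by rw [abs_le]; constructor <;> linarith)
      (by ring) (by linear_combination (-3 / 2) * s)
  · exact norm_stageDefect_le hh D.smooth hB ⟨by linarith, by linarith⟩
      (by rw [abs_le]; constructor <;> linarith) (by rw [abs_le]; constructor <;> linarith)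
      (by ring) (by linear_combination (-3 / 2) * s)

theorem CellData.norm_stageDefect_v_le (D : CellData A ψ κ u v x h μ) (hh : 0 < h) :
    ‖stageDefect v x h (1 / 2 - gaussOffset) (1 / 4) (1 / 4 - gaussOffset)‖
        ≤ 3 * A * (h ^ 3 * μ / ‖κ‖ ^ 2) ∧
    ‖stageDefect v x h (1 / 2 + gaussOffset) (1 / 4 + gaussOffset) (1 / 4)‖
        ≤ 3 * A * (h ^ 3 * μ / ‖κ‖ ^ 2) ∧
    ‖stageDefect v x h 1 (1 / 2) (1 / 2)‖ ≤ 3 * A * (h ^ 3 * μ / ‖κ‖ ^ 2) := by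
  have p := gaussOffset_pos
  have l := gaussOffset_le
  have s := gaussOffset_sq
  have hB : ∀ t ∈ Set.Icc x (x + h), ‖iteratedDeriv 3 v t‖ ≤ A * (μ / ‖κ‖ ^ 2) := fun t ht =>
    D.v.2 3 (by norm_num) t ht
  have e : 3 * (A * (μ / ‖κ‖ ^ 2)) * h ^ 3 = 3 * A * (h ^ 3 * μ / ‖κ‖ ^ 2) := by ring
  rw [← e]
  refine ⟨?_, ?_, ?_⟩
  · exact norm_stageDefect_le hh D.v.1 hB ⟨by linarith, by linarith⟩
      (by rw [abs_le]; constructor <;> linarith) (by rw [abs_le]; constructor <;> linarith)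
      (by ring) (by linear_combination (-3 / 2) * s)
  · exact norm_stageDefect_le hh D.v.1 hB ⟨by linarith, by linarith⟩
      (by rw [abs_le]; constructor <;> linarith) (by rw [abs_le]; constructor <;> linarith)
      (by ring) (by linear_combination (-3 / 2) * s)
  · exact norm_stageDefect_le hh D.v.1 hB ⟨by norm_num, by norm_num⟩
      (by norm_num) (by norm_num) (by norm_num) (by ring)

/-- The update defect of `u` is the quadrature error of `u'`. -/
theorem CellData.stageDefect_update (D : CellData A ψ κ u v x h μ) :
    stageDefect u x h 1 (1 / 2) (1 / 2) = -gaussDefect (deriv u) x h := by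
  have hd : ∀ t, HasDerivAt u (deriv u t) t := fun t =>
    (D.smooth.differentiable (by simp) t).hasDerivAt
  have i1 : ∫ t in x..(x + h), deriv u t = u (x + h) - u x :=
    intervalIntegral.integral_eq_sub_of_hasDerivAt (fun t _ => hd t)
      (D.deriv_u.1.continuous.intervalIntegrable _ _)
  rw [stageDefect, gaussDefect, i1, one_mul]
  push_cast
  ring

theorem CellData.norm_gaussDefect_deriv_le (D : CellData A ψ κ u v x h μ) (hh : 0 < h) :
    ‖gaussDefect (deriv u) x h‖ ≤ 2 * A * (h ^ 5 * μ / ‖κ‖) :=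
  (norm_gaussDefect_le hh D.deriv_u).trans (le_of_eq (by ring))

theorem CellData.norm_gaussDefect_coeff_le (D : CellData A ψ κ u v x h μ) (hh : 0 < h) :
    ‖gaussDefect (modelCoeff ψ κ) x h‖ ≤ 2 * A * (h ^ 5 * μ / ‖κ‖) :=
  (norm_gaussDefect_le hh D.coeff).trans (le_of_eq (by ring))

/-- One quadrature step for `u` compared with the exact step. -/
theorem CellData.norm_factor_sub_le (D : CellData A ψ κ u v x h μ) (hs : ModelSolution ψ κ u v)
    (hh : 0 < h) (hq : 1 ≤ h * ‖κ‖) :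
    ‖u x * (1 + h / 2 * (modelCoeff ψ κ (x + (1 / 2 - gaussOffset) * h)
      + modelCoeff ψ κ (x + (1 / 2 + gaussOffset) * h))) - u (x + h)‖
      ≤ 3 * A ^ 3 * (h ^ 2 * μ / ‖κ‖ ^ 2 + h ^ 5 * μ / ‖κ‖) := by
  obtain ⟨n1, n2⟩ := gauss_node_mem (x := x) hh
  obtain ⟨c1, c2⟩ := D.norm_coeff_le hh
  have hx : x ∈ Set.Icc x (x + h) := ⟨le_rfl, by linarith⟩
  have hA := D.one_le
  have hK := D.norm_ge
  have hμ := D.weight_nonneg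
  have hμA := D.weight_le
  have hKh : 1 / ‖κ‖ ≤ h := by rw [div_le_iff₀ (by linarith)]; exact hq
  have e := D.stageDefect_update
  rw [stageDefect, hs.deriv_u_eq, hs.deriv_u_eq, one_mul] at e
  push_cast at e
  have hn : ∀ t ∈ Set.Icc x (x + h), ‖u x - u t - v t‖ ≤ 2 * A ^ 2 * (h / ‖κ‖) := by
    intro t ht
    have a1 := D.sub_u_le x hx t ht
    have a2 := D.v.norm_le ht
    have a3 : A * (μ / ‖κ‖ ^ 2) ≤ A ^ 2 * (h / ‖κ‖) := by
      calc A * (μ / ‖κ‖ ^ 2) = A * μ * ((1 / ‖κ‖) / ‖κ‖) := by field_simp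
        _ ≤ A * A * (h / ‖κ‖) := by gcongr
        _ = _ := by ring
    have a4 : A * (h / ‖κ‖) ≤ A ^ 2 * (h / ‖κ‖) := by
      gcongr; nlinarith
    refine (norm_sub_le _ _).trans ?_
    linarith
  set g₁ := modelCoeff ψ κ (x + (1 / 2 - gaussOffset) * h)
  set g₂ := modelCoeff ψ κ (x + (1 / 2 + gaussOffset) * h)
  have e2 : u x * (1 + h / 2 * (g₁ + g₂)) - u (x + h)
      = h * (1 / 2 * (g₁ * (u x - u (x + (1 / 2 - gaussOffset) * h)
          - v (x + (1 / 2 - gaussOffset) * h)))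
        + 1 / 2 * (g₂ * (u x - u (x + (1 / 2 + gaussOffset) * h)
          - v (x + (1 / 2 + gaussOffset) * h)))) + gaussDefect (deriv u) x h := by
    linear_combination -e
  rw [e2]
  have m1 : ‖g₁ * (u x - u (x + (1 / 2 - gaussOffset) * h) - v (x + (1 / 2 - gaussOffset) * h))‖
      ≤ A * (μ / ‖κ‖) * (2 * A ^ 2 * (h / ‖κ‖)) := by
    rw [norm_mul]; gcongr; exact hn _ n1
  have m2 : ‖g₂ * (u x - u (x + (1 / 2 + gaussOffset) * h) - v (x + (1 / 2 + gaussOffset) * h))‖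
      ≤ A * (μ / ‖κ‖) * (2 * A ^ 2 * (h / ‖κ‖)) := by
    rw [norm_mul]; gcongr; exact hn _ n2
  have m3 := norm_coeff_sum_le hh.le (a := 1 / 2) (b := 1 / 2) (by norm_num) m1 m2
  refine (norm_add_le _ _).trans ((add_le_add m3 (D.norm_gaussDefect_deriv_le hh)).trans ?_)
  have q1 : 0 ≤ h ^ 2 * μ / ‖κ‖ ^ 2 := by positivity
  have q2 : 0 ≤ h ^ 5 * μ / ‖κ‖ := by positivity
  have q3 : A ≤ A ^ 3 := le_self_pow₀ hA (by norm_num)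
  calc h * (A * (μ / ‖κ‖) * (2 * A ^ 2 * (h / ‖κ‖))) + 2 * A * (h ^ 5 * μ / ‖κ‖)
      = 2 * A ^ 3 * (h ^ 2 * μ / ‖κ‖ ^ 2) + 2 * A * (h ^ 5 * μ / ‖κ‖) := by field_simp
    _ ≤ 3 * A ^ 3 * (h ^ 2 * μ / ‖κ‖ ^ 2) + 3 * A ^ 3 * (h ^ 5 * μ / ‖κ‖) := by
        gcongr <;> linarith
    _ = _ := by ring

/-- The defects of the step, up to the quadrature error of the coefficient, are of third order in
`1 / κ` (or quadratic in the quadrature error): the terms of second order cancel because the method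
is symplectic. -/
theorem CellData.norm_secondOrder_le (D : CellData A ψ κ u v x h μ) (hs : ModelSolution ψ κ u v)
    (hh : 0 < h) (hq : 1 ≤ h * ‖κ‖) :
    ‖gaussDefect (deriv u) x h - u (x + h) * gaussDefect (modelCoeff ψ κ) x h
      - h / 2 * (modelCoeff ψ κ (x + (1 / 2 - gaussOffset) * h)
          * stageDefect u x h (1 / 2 - gaussOffset) (1 / 4) (1 / 4 - gaussOffset)
        + modelCoeff ψ κ (x + (1 / 2 + gaussOffset) * h)
          * stageDefect u x h (1 / 2 + gaussOffset) (1 / 4 + gaussOffset) (1 / 4))‖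
      ≤ 3000 * A ^ 5 * (μ * (h ^ 5 / ‖κ‖ ^ 3 + h ^ 10 / ‖κ‖ ^ 2)) := by
  obtain ⟨n1, n2⟩ := gauss_node_mem (x := x) hh
  obtain ⟨c1, c2⟩ := D.norm_coeff_le hh
  obtain ⟨d1, d2⟩ := D.norm_stageDefect_u_le hh
  have hxr : x + h ∈ Set.Icc x (x + h) := ⟨by linarith, le_rfl⟩
  have hA := D.one_le
  have hK := D.norm_ge
  have hμ := D.weight_nonneg
  have hμA := D.weight_le
  have hK0 : 0 < ‖κ‖ := by linarith
  have hKh : 1 / ‖κ‖ ≤ h := by rw [div_le_iff₀ hK0]; exact hq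
  have sym := gaussDefect_symplectic D.smooth x h
  have bQ := D.norm_gaussDefect_deriv_le hh
  have hu1 := D.half_le
  have edu : deriv u = fun t => modelCoeff ψ κ t * (u t + v t) := funext hs.deriv_u_eq
  set g := modelCoeff ψ κ with hg
  set u₁ := u (x + h) with hu₁
  set δ₁ := stageDefect u x h (1 / 2 - gaussOffset) (1 / 4) (1 / 4 - gaussOffset)
  set δ₂ := stageDefect u x h (1 / 2 + gaussOffset) (1 / 4 + gaussOffset) (1 / 4)
  set Q := gaussDefect (deriv u) x h with hQ
  have hgc : Continuous g := D.coeff.1.continuous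
  have huc : Continuous u := D.smooth.continuous
  have hvc : Continuous v := D.v.1.continuous
  -- splitting of `u' = g (u₁ + (u - u₁) + v)`
  have s1 : Q = u₁ * gaussDefect g x h + gaussDefect (fun t => g t * (u t - u₁)) x h
      + gaussDefect (fun t => g t * v t) x h := by
    rw [hQ, ← gaussDefect_const_mul, ← gaussDefect_add (by fun_prop) (by fun_prop),
      ← gaussDefect_add (by fun_prop) (by fun_prop), edu]
    congr 1
    funext t; ring
  have s2 : gaussDefect (fun t => deriv u t * (u t - u₁)) x h
      = u₁ * gaussDefect (fun t => g t * (u t - u₁)) x h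
        + gaussDefect (fun t => g t * (u t - u₁) * (u t - u₁)) x h
        + gaussDefect (fun t => g t * v t * (u t - u₁)) x h := by
    rw [← gaussDefect_const_mul, ← gaussDefect_add (by fun_prop) (by fun_prop),
      ← gaussDefect_add (by fun_prop) (by fun_prop), edu]
    congr 1
    funext t; ring
  have b1 := norm_gaussDefect_le hh (D.coeff.mul D.v)
  have b2 := norm_gaussDefect_le hh ((D.coeff.mul D.sub_u).mul D.sub_u)
  have b3 := norm_gaussDefect_le hh ((D.coeff.mul D.v).mul D.sub_u)
  set P := μ * (h ^ 5 / ‖κ‖ ^ 3) with hP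
  set R := μ * (h ^ 10 / ‖κ‖ ^ 2) with hR
  have hP0 : 0 ≤ P := by positivity
  have hR0 : 0 ≤ R := by positivity
  have b1' : ‖gaussDefect (fun t => g t * v t) x h‖ ≤ 32 * A ^ 4 * P := by
    refine b1.trans ?_
    calc 2 * (2 ^ 4 * (A * (μ / ‖κ‖) * (A * (μ / ‖κ‖ ^ 2)))) * h ^ 5
        ≤ 2 * (2 ^ 4 * (A * (μ / ‖κ‖) * (A * (A / ‖κ‖ ^ 2)))) * h ^ 5 := by gcongr
      _ = 32 * A ^ 3 * P := by rw [hP]; field_simp; ring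
      _ ≤ _ := by gcongr; norm_num
  have b2' : ‖gaussDefect (fun t => g t * (u t - u₁) * (u t - u₁)) x h‖ ≤ 512 * A ^ 4 * P := by
    refine b2.trans ?_
    calc _ = 512 * A ^ 3 * P := by rw [hP]; field_simp; ring
      _ ≤ _ := by gcongr; norm_num
  have b3' : ‖gaussDefect (fun t => g t * v t * (u t - u₁)) x h‖ ≤ 512 * A ^ 4 * P := by
    refine b3.trans ?_
    calc 2 * (2 ^ 4 * (2 ^ 4 * (A * (μ / ‖κ‖) * (A * (μ / ‖κ‖ ^ 2))) * (A * (1 / ‖κ‖)))) * h ^ 5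
        ≤ 2 * (2 ^ 4 * (2 ^ 4 * (A * (μ / ‖κ‖) * (A * (A / ‖κ‖ ^ 2))) * (A * (1 / 1))))
            * h ^ 5 := by
          gcongr
      _ = 512 * A ^ 4 * P := by rw [hP]; field_simp; ring
  have stage : ∀ {t : ℝ} {δ : ℂ}, t ∈ Set.Icc x (x + h) → ‖δ‖ ≤ 3 * A * (h ^ 3 * μ / ‖κ‖) →
      ‖g t * ((u t - u₁ + v t) * δ)‖ ≤ 6 * A ^ 5 * (P / h) := by
    intro t δ ht hδ
    have a1 := D.sub_u_le t ht _ hxr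
    have a2 := D.v.norm_le ht
    have a3 : A * (μ / ‖κ‖ ^ 2) ≤ A * A * (h / ‖κ‖) := by
      calc A * (μ / ‖κ‖ ^ 2) = A * μ * ((1 / ‖κ‖) / ‖κ‖) := by field_simp
        _ ≤ A * A * (h / ‖κ‖) := by gcongr
    have a4 : A * (h / ‖κ‖) ≤ A * A * (h / ‖κ‖) := by
      gcongr; nlinarith
    have a5 : ‖u t - u₁ + v t‖ ≤ 2 * A ^ 2 * (h / ‖κ‖) := by
      refine (norm_add_le _ _).trans ?_
      linarith
    rw [norm_mul, norm_mul]
    calc ‖g t‖ * (‖u t - u₁ + v t‖ * ‖δ‖)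
        ≤ A * (A / ‖κ‖) * (2 * A ^ 2 * (h / ‖κ‖) * (3 * A * (h ^ 3 * μ / ‖κ‖))) := by
          gcongr
          exact (D.coeff.norm_le ht).trans (by gcongr)
      _ = 6 * A ^ 5 * (P / h) := by rw [hP]; field_simp; ring
  have e1 := norm_coeff_sum_le hh.le (a := 1 / 2) (b := 1 / 2) (by norm_num)
    (stage n1 d1) (stage n2 d2)
  have eP : h * (6 * A ^ 5 * (P / h)) = 6 * A ^ 5 * P := by field_simp
  rw [eP] at e1
  have bQ2 : ‖Q ^ 2 / 2‖ ≤ 2 * A ^ 5 * R := by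
    rw [norm_div, norm_pow]
    calc ‖Q‖ ^ 2 / ‖(2 : ℂ)‖ ≤ (2 * A * (h ^ 5 * μ / ‖κ‖)) ^ 2 / 2 := by
          rw [Complex.norm_ofNat]; gcongr
      _ = 2 * A ^ 2 * (μ * R) := by rw [hR]; field_simp
      _ ≤ 2 * A ^ 2 * (A * R) := by gcongr
      _ = 2 * A ^ 3 * R := by ring
      _ ≤ _ := by gcongr; norm_num
  -- The symplectic identity gives `u₁` times the difference of the quadrature error of
  -- `g (u - u₁)` and the stage defects `S`; `u₁` is divided out at the end, with `|u₁| ≥ 1 / 2`.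
  set S := (h : ℂ) / 2 * (g (x + (1 / 2 - gaussOffset) * h) * δ₁
    + g (x + (1 / 2 + gaussOffset) * h) * δ₂) with hS
  have eX : u₁ * (gaussDefect (fun t => g t * (u t - u₁)) x h - S) = Q ^ 2 / 2
      - gaussDefect (fun t => g t * (u t - u₁) * (u t - u₁)) x h
      - gaussDefect (fun t => g t * v t * (u t - u₁)) x h
      + h * (1 / 2 * (g (x + (1 / 2 - gaussOffset) * h) * ((u (x + (1 / 2 - gaussOffset) * h)
          - u₁ + v (x + (1 / 2 - gaussOffset) * h)) * δ₁))
        + 1 / 2 * (g (x + (1 / 2 + gaussOffset) * h) * ((u (x + (1 / 2 + gaussOffset) * h)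
          - u₁ + v (x + (1 / 2 + gaussOffset) * h)) * δ₂))) := by
    rw [hs.deriv_u_eq, hs.deriv_u_eq] at sym
    rw [hS]
    linear_combination sym - s2
  have bX : ‖u₁ * (gaussDefect (fun t => g t * (u t - u₁)) x h - S)‖
      ≤ 2 * A ^ 5 * R + 512 * A ^ 4 * P + 512 * A ^ 4 * P + 6 * A ^ 5 * P := by
    rw [eX]
    exact (norm_add_le _ _).trans (add_le_add ((norm_sub_le _ _).trans (add_le_add
      ((norm_sub_le _ _).trans (add_le_add bQ2 b2')) b3')) e1)
  rw [norm_mul] at bX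
  have e : Q - u₁ * gaussDefect g x h - S
      = (gaussDefect (fun t => g t * (u t - u₁)) x h - S)
        + gaussDefect (fun t => g t * v t) x h := by
    linear_combination s1
  rw [e]
  refine (norm_add_le _ _).trans ((add_le_add le_rfl b1').trans ?_)
  have q4 : A ^ 4 * P ≤ A ^ 5 * P := by gcongr; norm_num
  have q5 : 0 ≤ A ^ 5 * P := by positivity
  have q6 : 0 ≤ A ^ 5 * R := by positivity
  have q7 : 1 / 2 * ‖gaussDefect (fun t => g t * (u t - u₁)) x h - S‖
      ≤ ‖u₁‖ * ‖gaussDefect (fun t => g t * (u t - u₁)) x h - S‖ := by gcongr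
  have q8 : 3000 * A ^ 5 * (μ * (h ^ 5 / ‖κ‖ ^ 3 + h ^ 10 / ‖κ‖ ^ 2))
      = 3000 * (A ^ 5 * P) + 3000 * (A ^ 5 * R) := by rw [hP, hR]; ring
  rw [q8]
  linarith

end Cell

/-! ### Local and global errors of the model problem -/

/-- One step of the two-stage Gauss-Legendre method for the equations of `ModelSolution`, in terms
of the stage values `U, V`. -/
def IsModelStep (ψ : ℝ → ℂ) (κ : ℂ) (h x : ℝ) (a b a' b' : ℂ) : Prop :=
  ∃ U₁ U₂ V₁ V₂ g₁ g₂ : ℂ, g₁ = modelCoeff ψ κ (x + (1 / 2 - gaussOffset) * h) ∧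
    g₂ = modelCoeff ψ κ (x + (1 / 2 + gaussOffset) * h) ∧
    U₁ = a + h * (1 / 4 * (g₁ * (U₁ + V₁)) + (1 / 4 - gaussOffset) * (g₂ * (U₂ + V₂))) ∧
    U₂ = a + h * ((1 / 4 + gaussOffset) * (g₁ * (U₁ + V₁)) + 1 / 4 * (g₂ * (U₂ + V₂))) ∧
    V₁ = b + h * (1 / 4 * (-κ * V₁ - g₁ * (U₁ + V₁))
      + (1 / 4 - gaussOffset) * (-κ * V₂ - g₂ * (U₂ + V₂))) ∧
    V₂ = b + h * ((1 / 4 + gaussOffset) * (-κ * V₁ - g₁ * (U₁ + V₁))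
      + 1 / 4 * (-κ * V₂ - g₂ * (U₂ + V₂))) ∧
    a' = a + h / 2 * (g₁ * (U₁ + V₁) + g₂ * (U₂ + V₂)) ∧
    b' = b + h / 2 * ((-κ * V₁ - g₁ * (U₁ + V₁)) + (-κ * V₂ - g₂ * (U₂ + V₂)))

theorem IsModelStep.stepErrors {ψ : ℝ → ℂ} {κ : ℂ} {h x : ℝ} {a b a' b' : ℂ} {u v : ℝ → ℂ}
    (H : IsModelStep ψ κ h x a b a' b') (hs : ModelSolution ψ κ u v) :
    ∃ EU₁ EU₂ EV₁ EV₂ : ℂ, StepErrors κ h (modelCoeff ψ κ (x + (1 / 2 - gaussOffset) * h))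
      (modelCoeff ψ κ (x + (1 / 2 + gaussOffset) * h)) (a - u x) (b - v x)
      (stageDefect u x h (1 / 2 - gaussOffset) (1 / 4) (1 / 4 - gaussOffset))
      (stageDefect u x h (1 / 2 + gaussOffset) (1 / 4 + gaussOffset) (1 / 4))
      (stageDefect v x h (1 / 2 - gaussOffset) (1 / 4) (1 / 4 - gaussOffset))
      (stageDefect v x h (1 / 2 + gaussOffset) (1 / 4 + gaussOffset) (1 / 4))
      (stageDefect u x h 1 (1 / 2) (1 / 2)) (stageDefect v x h 1 (1 / 2) (1 / 2))
      EU₁ EU₂ EV₁ EV₂ (a' - u (x + h)) (b' - v (x + h)) := by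
  obtain ⟨U₁, U₂, V₁, V₂, g₁, g₂, hg1, hg2, h1, h2, h3, h4, h5, h6⟩ := H
  refine ⟨U₁ - u (x + (1 / 2 - gaussOffset) * h), U₂ - u (x + (1 / 2 + gaussOffset) * h),
    V₁ - v (x + (1 / 2 - gaussOffset) * h), V₂ - v (x + (1 / 2 + gaussOffset) * h), ?_⟩
  rw [← hg1, ← hg2]
  constructor <;>
    simp only [stageDefect, hs.deriv_u_eq, hs.deriv_v_eq, ← hg1, ← hg2, one_mul] <;> push_cast
  · linear_combination h1
  · linear_combination h2
  · linear_combination h3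
  · linear_combination h4
  · linear_combination h5
  · linear_combination h6

/-- The bound for the stage errors in terms of the errors `E, F` at the left end of the cell. -/
def stageBound (A K h μ E F : ℝ) : ℝ :=
  2 * (E + 3 * A * (h ^ 3 * μ / K)) + 24 / (h * K) * (F + 3 * A * (h ^ 3 * μ / K ^ 2))

/-- Errors of the expected sizes `h ^ 4 / K` and `h ^ 2 / K ^ 2` give stage errors of size
`h ^ 3 / K`. -/
theorem stageBound_le {A K h μ E F t : ℝ} (hA : 1 ≤ A) (hμA : μ ≤ A)
    (hK : 1 ≤ K) (hh : 0 < h) (h1 : h ≤ 1) (hq : 1 ≤ h * K)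
    (hE : E ≤ h ^ 4 / K * t) (hF : F ≤ h ^ 2 / K ^ 2 * t) (ht : 0 ≤ t) :
    stageBound A K h μ E F ≤ 78 * A ^ 2 * (h ^ 3 / K) * (1 + t) := by
  have hK0 : 0 < K := by linarith
  have hKh : 1 / K ≤ h := by rw [div_le_iff₀ hK0]; exact hq
  have hX : 0 ≤ h ^ 3 / K := by positivity
  have e1 : E ≤ h ^ 3 / K * t := by
    have h43 : h ^ 4 ≤ h ^ 3 := pow_le_pow_of_le_one hh.le h1 (by norm_num)
    exact hE.trans (by gcongr)
  have e2 : 3 * A * (h ^ 3 * μ / K) ≤ 3 * A ^ 2 * (h ^ 3 / K) := by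
    calc 3 * A * (h ^ 3 * μ / K) ≤ 3 * A * (h ^ 3 * A / K) := by gcongr
      _ = _ := by ring
  have e3 : 24 / (h * K) * F ≤ 24 * (h ^ 3 / K) * t := by
    calc 24 / (h * K) * F ≤ 24 / (h * K) * (h ^ 2 / K ^ 2 * t) := by gcongr
      _ = 24 * (h * (1 / K) * (1 / K) / K) * t := by field_simp
      _ ≤ 24 * (h * h * h / K) * t := by gcongr
      _ = _ := by ring
  have e4 : 24 / (h * K) * (3 * A * (h ^ 3 * μ / K ^ 2)) ≤ 72 * A ^ 2 * (h ^ 3 / K) := by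
    calc 24 / (h * K) * (3 * A * (h ^ 3 * μ / K ^ 2))
        ≤ 24 / (h * K) * (3 * A * (h ^ 3 * A / K ^ 2)) := by gcongr
      _ = 72 * A ^ 2 * (h ^ 2 * (1 / K) * (1 / K) / K) := by field_simp; ring
      _ ≤ 72 * A ^ 2 * (h ^ 2 * h * 1 / K) := by gcongr; linarith
      _ = _ := by ring
  have e5 : 26 * (h ^ 3 / K * t) ≤ 78 * A ^ 2 * (h ^ 3 / K * t) := by
    gcongr
    nlinarith
  unfold stageBound
  linarith

section Step

variable {A : ℝ} {ψ : ℝ → ℂ} {κ : ℂ} {u v : ℝ → ℂ} {x h μ : ℝ} {a b a' b' : ℂ}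

/-- The growth of the error in one step. -/
theorem IsModelStep.norm_error_le (H : IsModelStep ψ κ h x a b a' b') (hs : ModelSolution ψ κ u v)
    (D : CellData A ψ κ u v x h μ) (hh : 0 < h) (h1 : h ≤ 1) (hq : 60 ≤ h * ‖κ‖)
    (hK : 16 * A ^ 2 ≤ ‖κ‖) {Y : ℝ} (hY : stageBound A ‖κ‖ h μ ‖a - u x‖ ‖b - v x‖ ≤ Y) :
    ‖a' - u (x + h)‖ ≤ ‖a - u x‖ + h * (A * (μ / ‖κ‖) * Y) + 2 * A * (h ^ 5 * μ / ‖κ‖) ∧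
    ‖b' - v (x + h)‖ ≤ ‖1 - h * κ / stabilityDenom (h * κ)‖ * ‖b - v x‖
      + 5 / ‖κ‖ * (A * (μ / ‖κ‖) * Y) + 18 * A * (h ^ 3 * μ / ‖κ‖ ^ 2) := by
  obtain ⟨EU₁, EU₂, EV₁, EV₂, SE⟩ := H.stepErrors hs
  obtain ⟨c1, c2⟩ := D.norm_coeff_le hh
  obtain ⟨d1, d2⟩ := D.norm_stageDefect_u_le hh
  obtain ⟨f1, f2, f3⟩ := D.norm_stageDefect_v_le hh
  have hK1 := D.norm_ge
  have hA := D.one_le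
  have hμ := D.weight_nonneg
  have hγ : h * (A * (μ / ‖κ‖)) ≤ 1 / 16 := by
    calc h * (A * (μ / ‖κ‖)) ≤ 1 * (A * (A / ‖κ‖)) := by gcongr; exact D.weight_le
      _ = A ^ 2 / ‖κ‖ := by ring
      _ ≤ 1 / 16 := by rw [div_le_iff₀ (by linarith)]; linarith
  obtain ⟨y1, y2⟩ := SE.norm_stage_le hh hq c1 c2 hγ d1 d2 f1 f2
  have y1' := y1.trans hY
  have y2' := y2.trans hY
  have r1 := SE.norm_update_u_le hh c1 c2 y1' y2'
  have r2 := SE.norm_update_v_le hh hq c1 c2 f1 f2 y1' y2'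
  rw [D.stageDefect_update, norm_neg] at r1
  have bQ := D.norm_gaussDefect_deriv_le hh
  exact ⟨by linarith, by linarith⟩

/-- The error of `u` relative to the accumulated quadrature error `S`, in one step. -/
theorem IsModelStep.norm_fine_error_le (H : IsModelStep ψ κ h x a b a' b')
    (hs : ModelSolution ψ κ u v) (D : CellData A ψ κ u v x h μ) (hh : 0 < h) (h1 : h ≤ 1)
    (hq : 60 ≤ h * ‖κ‖) (hK : 16 * A ^ 2 ≤ ‖κ‖) {Y : ℝ}
    (hY : stageBound A ‖κ‖ h μ ‖a - u x‖ ‖b - v x‖ ≤ Y) (S : ℂ) :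
    ‖a' - u (x + h) - u (x + h) * (S + gaussDefect (modelCoeff ψ κ) x h)‖ ≤
      (1 + A * (h * μ)) * ‖a - u x - u x * S‖
      + ‖S‖ * (3 * A ^ 3 * (h ^ 2 * μ / ‖κ‖ ^ 2 + h ^ 5 * μ / ‖κ‖))
      + 3000 * A ^ 5 * (μ * (h ^ 5 / ‖κ‖ ^ 3 + h ^ 10 / ‖κ‖ ^ 2))
      + h * (A * (μ / ‖κ‖) * (h * (A * (μ / ‖κ‖) * Y)))
      + (14 * h * ‖b - v x‖ / (h * ‖κ‖) ^ 2 * (A * (μ / ‖κ‖) + h * ‖κ‖ * (A * (h * μ / ‖κ‖)))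
        + 12 / ‖κ‖ * (A * (μ / ‖κ‖))
          * (h * (A * (μ / ‖κ‖) * Y) + 3 * A * (h ^ 3 * μ / ‖κ‖ ^ 2))) := by
  obtain ⟨EU₁, EU₂, EV₁, EV₂, SE⟩ := H.stepErrors hs
  obtain ⟨c1, c2⟩ := D.norm_coeff_le hh
  obtain ⟨d1, d2⟩ := D.norm_stageDefect_u_le hh
  obtain ⟨f1, f2, f3⟩ := D.norm_stageDefect_v_le hh
  have hK1 := D.norm_ge
  have hA := D.one_le
  have hμ := D.weight_nonneg
  have hγ : h * (A * (μ / ‖κ‖)) ≤ 1 / 16 := by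
    calc h * (A * (μ / ‖κ‖)) ≤ 1 * (A * (A / ‖κ‖)) := by gcongr; exact D.weight_le
      _ = A ^ 2 / ‖κ‖ := by ring
      _ ≤ 1 / 16 := by rw [div_le_iff₀ (by linarith)]; linarith
  obtain ⟨y1, y2⟩ := SE.norm_stage_le hh hq c1 c2 hγ d1 d2 f1 f2
  have y1' := y1.trans hY
  have y2' := y2.trans hY
  have r3 := SE.norm_coupling_le hh hq c1 c2 (D.norm_coeff_sub_le hh) f1 f2 y1' y2'
  have r4 := D.norm_factor_sub_le hs hh (by linarith)
  have r5 := D.norm_secondOrder_le hs hh (by linarith)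
  have e1 := SE.update_u
  have e2 := SE.stage_u₁
  have e3 := SE.stage_u₂
  rw [D.stageDefect_update] at e1
  set g₁ := modelCoeff ψ κ (x + (1 / 2 - gaussOffset) * h)
  set g₂ := modelCoeff ψ κ (x + (1 / 2 + gaussOffset) * h)
  have hY0 : 0 ≤ Y := (norm_nonneg _).trans y1'
  have n1 : ‖g₁ * (EU₁ + EV₁)‖ ≤ A * (μ / ‖κ‖) * Y := by
    rw [norm_mul]; gcongr
  have n2 : ‖g₂ * (EU₂ + EV₂)‖ ≤ A * (μ / ‖κ‖) * Y := by
    rw [norm_mul]; gcongr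
  have w1 := norm_coeff_sum_le hh.le norm_coeff_fst n1 n2
  have w2 := norm_coeff_sum_le hh.le norm_coeff_snd n1 n2
  set w₁ := (h : ℂ) * (1 / 4 * (g₁ * (EU₁ + EV₁)) + (1 / 4 - gaussOffset) * (g₂ * (EU₂ + EV₂)))
  set w₂ := (h : ℂ) * ((1 / 4 + gaussOffset) * (g₁ * (EU₁ + EV₁)) + 1 / 4 * (g₂ * (EU₂ + EV₂)))
  have m1 : ‖g₁ * w₁‖ ≤ A * (μ / ‖κ‖) * (h * (A * (μ / ‖κ‖) * Y)) := by
    rw [norm_mul]; gcongr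
  have m2 : ‖g₂ * w₂‖ ≤ A * (μ / ‖κ‖) * (h * (A * (μ / ‖κ‖) * Y)) := by
    rw [norm_mul]; gcongr
  have r6 := norm_coeff_sum_le hh.le (a := 1 / 2) (b := 1 / 2) (by norm_num) m1 m2
  have k1 : ‖g₁‖ ≤ A * μ := c1.trans (by gcongr; exact div_le_self hμ hK1)
  have k2 : ‖g₂‖ ≤ A * μ := c2.trans (by gcongr; exact div_le_self hμ hK1)
  have r7 : ‖1 + h * (1 / 2 * g₁ + 1 / 2 * g₂)‖ ≤ 1 + A * (h * μ) := by
    refine (norm_add_le _ _).trans ?_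
    rw [norm_one]
    have := norm_coeff_sum_le hh.le (a := 1 / 2) (b := 1 / 2) (by norm_num) k1 k2
    linarith
  set Qd := gaussDefect (deriv u) x h
  set Qg := gaussDefect (modelCoeff ψ κ) x h
  set δ₁ := stageDefect u x h (1 / 2 - gaussOffset) (1 / 4) (1 / 4 - gaussOffset)
  set δ₂ := stageDefect u x h (1 / 2 + gaussOffset) (1 / 4 + gaussOffset) (1 / 4)
  -- the new relative error: propagation of the old one, change of `u` over the cell, defects of
  -- second order, and the reaction of the stages to `w₁, w₂` and to the stiff errors
  have e : a' - u (x + h) - u (x + h) * (S + Qg) =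
      (1 + h * (1 / 2 * g₁ + 1 / 2 * g₂)) * (a - u x - u x * S)
      + S * (u x * (1 + h / 2 * (g₁ + g₂)) - u (x + h))
      + (Qd - u (x + h) * Qg - h / 2 * (g₁ * δ₁ + g₂ * δ₂))
      + h * (1 / 2 * (g₁ * w₁) + 1 / 2 * (g₂ * w₂))
      + h / 2 * (g₁ * EV₁ + g₂ * EV₂) := by
    linear_combination e1 + h / 2 * g₁ * e2 + h / 2 * g₂ * e3
  rw [e]
  refine (norm_add_le _ _).trans (add_le_add ((norm_add_le _ _).trans (add_le_add
    ((norm_add_le _ _).trans (add_le_add ((norm_add_le _ _).trans (add_le_add ?_ ?_)) r5)) r6)) r3)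
  · rw [norm_mul]; gcongr
  · rw [norm_mul]; gcongr

/-- The local errors: one step from exact values. -/
theorem IsModelStep.norm_localError_le (H : IsModelStep ψ κ h x (u x) (v x) a' b')
    (hs : ModelSolution ψ κ u v) (D : CellData A ψ κ u v x h μ) (hh : 0 < h) (h1 : h ≤ 1)
    (hq : 60 ≤ h * ‖κ‖) (hK : 16 * A ^ 2 ≤ ‖κ‖) :
    ‖a' - u (x + h)‖ ≤ 500 * A ^ 4 * (h ^ 5 / ‖κ‖) ∧
    ‖b' - v (x + h)‖ ≤ 500 * A ^ 4 * (h ^ 3 / ‖κ‖ ^ 2) := by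
  have hK1 := D.norm_ge
  have hK0 : 0 < ‖κ‖ := by linarith
  have hA := D.one_le
  have hμ := D.weight_nonneg
  have hμA := D.weight_le
  have hKh : 1 / ‖κ‖ ≤ h := by rw [div_le_iff₀ hK0]; linarith
  have hY : stageBound A ‖κ‖ h μ ‖u x - u x‖ ‖v x - v x‖ ≤ 78 * A ^ 2 * (h ^ 3 / ‖κ‖) * (1 + 0) :=
    stageBound_le hA hμA hK1 hh h1 (by linarith) (by simp) (by simp) le_rfl
  rw [add_zero, mul_one] at hY
  obtain ⟨r1, r2⟩ := H.norm_error_le hs D hh h1 hq hK hY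
  simp only [sub_self, norm_zero, mul_zero, zero_add] at r1 r2
  have p2 : A ^ 2 ≤ A ^ 4 := pow_le_pow_right₀ hA (by norm_num)
  constructor
  · refine r1.trans ?_
    calc h * (A * (μ / ‖κ‖) * (78 * A ^ 2 * (h ^ 3 / ‖κ‖))) + 2 * A * (h ^ 5 * μ / ‖κ‖)
        ≤ h * (A * (A / ‖κ‖) * (78 * A ^ 2 * (h ^ 3 / ‖κ‖))) + 2 * A * (h ^ 5 * A / ‖κ‖) := by
          gcongr
      _ = 78 * A ^ 4 * (h ^ 4 * (1 / ‖κ‖) / ‖κ‖) + 2 * A ^ 2 * (h ^ 5 / ‖κ‖) := by field_simp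
      _ ≤ 78 * A ^ 4 * (h ^ 4 * h / ‖κ‖) + 2 * A ^ 4 * (h ^ 5 / ‖κ‖) := by gcongr
      _ = 80 * A ^ 4 * (h ^ 5 / ‖κ‖) := by ring
      _ ≤ _ := by gcongr; norm_num
  · refine r2.trans ?_
    calc 5 / ‖κ‖ * (A * (μ / ‖κ‖) * (78 * A ^ 2 * (h ^ 3 / ‖κ‖)))
          + 18 * A * (h ^ 3 * μ / ‖κ‖ ^ 2)
        ≤ 5 / ‖κ‖ * (A * (A / ‖κ‖) * (78 * A ^ 2 * (h ^ 3 / 1)))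
          + 18 * A * (h ^ 3 * A / ‖κ‖ ^ 2) := by gcongr
      _ = 390 * A ^ 4 * (h ^ 3 / ‖κ‖ ^ 2) + 18 * A ^ 2 * (h ^ 3 / ‖κ‖ ^ 2) := by
          field_simp; ring
      _ ≤ 390 * A ^ 4 * (h ^ 3 / ‖κ‖ ^ 2) + 18 * A ^ 4 * (h ^ 3 / ‖κ‖ ^ 2) := by gcongr
      _ = 408 * A ^ 4 * (h ^ 3 / ‖κ‖ ^ 2) := by ring
      _ ≤ _ := by gcongr; norm_num

end Step

/-- The discrete Gronwall lemma in product form. -/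
theorem le_exp_sum_of_le_mul {s c : ℕ → ℝ} {N : ℕ} (h0 : ∀ k ≤ N, 0 ≤ s k)
    (hs : ∀ k < N, s (k + 1) ≤ (1 + c k) * s k) {n : ℕ} (hn : n ≤ N) :
    s n ≤ s 0 * Real.exp (∑ k ∈ Finset.range n, c k) := by
  induction n with
  | zero => simp
  | succ n ih =>
    have ih := ih (by omega)
    rw [Finset.sum_range_succ, Real.exp_add]
    calc s (n + 1) ≤ (1 + c n) * s n := hs n (by omega)
      _ ≤ Real.exp (c n) * s n := by
          have := Real.add_one_le_exp (c n)
          exact mul_le_mul_of_nonneg_right (by linarith) (h0 n (by omega))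
      _ ≤ Real.exp (c n) * (s 0 * Real.exp (∑ k ∈ Finset.range n, c k)) := by gcongr
      _ = _ := by ring

/-- The numerical solution `a, b` of the model problem on the grid `-N h + k h`, starting from
exact values. -/
structure IsModelRun (ψ : ℝ → ℂ) (κ : ℂ) (h : ℝ) (N : ℕ) (u v : ℝ → ℂ) (a b : ℕ → ℂ) : Prop where
  init_u : a 0 = u (-(N * h))
  init_v : b 0 = v (-(N * h))
  step : ∀ k < N, IsModelStep ψ κ h (-(N * h) + k * h) (a k) (b k) (a (k + 1)) (b (k + 1))

section Global

variable {A W c₀ : ℝ} {ψ : ℝ → ℂ} {m : ℝ → ℝ} {κ : ℂ} {u v : ℝ → ℂ} {h : ℝ} {N : ℕ} {a b : ℕ → ℂ}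

/-- The grid point `-N h + k h`. -/
def gridPoint (h : ℝ) (N : ℕ) (k : ℕ) : ℝ := -(N * h) + k * h

theorem gridPoint_succ (h : ℝ) (N k : ℕ) : gridPoint h N k + h = gridPoint h N (k + 1) := by
  simp only [gridPoint]; push_cast; ring

theorem gridPoint_nonpos {h : ℝ} (hh : 0 < h) {N k : ℕ} (hk : k ≤ N) : gridPoint h N k ≤ 0 := by
  have : (k : ℝ) ≤ N := by exact_mod_cast hk
  simp only [gridPoint]; nlinarith

/-- Accumulation of the errors by the discrete Gronwall lemma, in units of their expected sizes. -/
theorem IsModelRun.norm_error_le (H : IsModelRun ψ κ h N u v a b) (hm : IsWeight ψ m W)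
    (hs : ModelSolution ψ κ u v) (hA : 1 ≤ A)
    (D : ∀ k < N, CellData A ψ κ u v (gridPoint h N k) h (m (gridPoint h N (k + 1))))
    (hc : 0 < c₀) (hh : 0 < h) (h1 : h ≤ 1) (hq : 60 ≤ h * ‖κ‖) (hK : 16 * A ^ 2 ≤ ‖κ‖)
    (hre : c₀ * ‖κ‖ ≤ κ.re) {n : ℕ} (hn : n ≤ N) :
    ‖a n - u (gridPoint h N n)‖ ≤ h ^ 4 / ‖κ‖ * Real.exp (500 * A ^ 3 * W) ∧
    ‖b n - v (gridPoint h N n)‖ ≤ h ^ 2 / ‖κ‖ ^ 2 * Real.exp (500 * A ^ 3 * W) := by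
  have hK1 : 1 ≤ ‖κ‖ := by nlinarith
  have hK0 : 0 < ‖κ‖ := by linarith
  have hKh : 1 / ‖κ‖ ≤ h := by rw [div_le_iff₀ hK0]; linarith
  have hqn : ‖(h : ℂ) * κ‖ = h * ‖κ‖ := by
    rw [norm_mul, Complex.norm_real, Real.norm_of_nonneg hh.le]
  have hqre : c₀ * ‖(h : ℂ) * κ‖ ≤ ((h : ℂ) * κ).re := by
    rw [hqn, Complex.re_ofReal_mul]; nlinarith
  have hR : ‖1 - h * κ / stabilityDenom (h * κ)‖ ≤ 1 := by
    refine (norm_stability_le hc (by rw [hqn]; exact hq) hqre).trans ?_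
    have : 0 ≤ c₀ / ‖(h : ℂ) * κ‖ := by positivity
    linarith
  -- the errors in units of their expected size
  set E : ℕ → ℝ := fun k => ‖a k - u (gridPoint h N k)‖ with hE
  set F : ℕ → ℝ := fun k => ‖b k - v (gridPoint h N k)‖ with hF
  set t : ℕ → ℝ := fun k => E k * (‖κ‖ / h ^ 4) + F k * (‖κ‖ ^ 2 / h ^ 2) with ht
  have hE0 : ∀ k, 0 ≤ E k := fun k => norm_nonneg _
  have hF0 : ∀ k, 0 ≤ F k := fun k => norm_nonneg _
  have ht0 : ∀ k, 0 ≤ t k := fun k => by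
    have := hE0 k
    have := hF0 k
    positivity
  have Et : ∀ k, E k ≤ h ^ 4 / ‖κ‖ * t k := by
    intro k
    have : h ^ 4 / ‖κ‖ * t k = E k + h ^ 4 / ‖κ‖ * (F k * (‖κ‖ ^ 2 / h ^ 2)) := by
      simp only [ht]; field_simp
    have := hF0 k
    have : 0 ≤ h ^ 4 / ‖κ‖ * (F k * (‖κ‖ ^ 2 / h ^ 2)) := by positivity
    linarith
  have Ft : ∀ k, F k ≤ h ^ 2 / ‖κ‖ ^ 2 * t k := by
    intro k
    have : h ^ 2 / ‖κ‖ ^ 2 * t k = F k + h ^ 2 / ‖κ‖ ^ 2 * (E k * (‖κ‖ / h ^ 4)) := by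
      simp only [ht]; field_simp; ring
    have := hE0 k
    have : 0 ≤ h ^ 2 / ‖κ‖ ^ 2 * (E k * (‖κ‖ / h ^ 4)) := by positivity
    linarith
  have step : ∀ k < N, 1 + t (k + 1) ≤
      (1 + 500 * A ^ 3 * (h * m (-(N * h) + (k + 1) * h))) * (1 + t k) := by
    intro k hk
    have Dk := D k hk
    have hμ := Dk.weight_nonneg
    have hμA := Dk.weight_le
    have em : m (-(N * h) + (k + 1) * h) = m (gridPoint h N (k + 1)) := by
      simp only [gridPoint]; push_cast; rfl
    rw [em]
    set μ := m (gridPoint h N (k + 1))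
    have hY := stageBound_le hA hμA hK1 hh h1 (by linarith) (Et k) (Ft k) (ht0 k)
    obtain ⟨r1, r2⟩ := (H.step k hk).norm_error_le hs Dk hh h1 hq hK hY
    change ‖a (k + 1) - u (gridPoint h N k + h)‖ ≤ E k + _ + _ at r1
    change ‖b (k + 1) - v (gridPoint h N k + h)‖ ≤ _ * F k + _ + _ at r2
    rw [gridPoint_succ] at r1 r2
    have htk := ht0 k
    have s1 : E (k + 1) * (‖κ‖ / h ^ 4)
        ≤ E k * (‖κ‖ / h ^ 4) + 80 * A ^ 3 * (h * μ) * (1 + t k) := by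
      calc E (k + 1) * (‖κ‖ / h ^ 4)
          ≤ (E k + h * (A * (μ / ‖κ‖) * (78 * A ^ 2 * (h ^ 3 / ‖κ‖) * (1 + t k)))
            + 2 * A * (h ^ 5 * μ / ‖κ‖)) * (‖κ‖ / h ^ 4) := by gcongr
        _ = E k * (‖κ‖ / h ^ 4) + 78 * A ^ 3 * (1 / ‖κ‖ * μ) * (1 + t k) + 2 * A * (h * μ) * 1 := by
            field_simp
        _ ≤ E k * (‖κ‖ / h ^ 4) + 78 * A ^ 3 * (h * μ) * (1 + t k)
            + 2 * A ^ 3 * (h * μ) * (1 + t k) := by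
            gcongr
            · exact le_self_pow₀ hA (by norm_num)
            · linarith
        _ = _ := by ring
    have s2 : F (k + 1) * (‖κ‖ ^ 2 / h ^ 2)
        ≤ F k * (‖κ‖ ^ 2 / h ^ 2) + 408 * A ^ 3 * (h * μ) * (1 + t k) := by
      calc F (k + 1) * (‖κ‖ ^ 2 / h ^ 2)
          ≤ (1 * F k + 5 / ‖κ‖ * (A * (μ / ‖κ‖) * (78 * A ^ 2 * (h ^ 3 / ‖κ‖) * (1 + t k)))
            + 18 * A * (h ^ 3 * μ / ‖κ‖ ^ 2)) * (‖κ‖ ^ 2 / h ^ 2) := by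
            have := hF0 k
            gcongr
            exact r2.trans (by gcongr)
        _ = F k * (‖κ‖ ^ 2 / h ^ 2) + 390 * A ^ 3 * (h / ‖κ‖ * μ) * (1 + t k)
            + 18 * A * (h * μ) * 1 := by
            field_simp; ring
        _ ≤ F k * (‖κ‖ ^ 2 / h ^ 2) + 390 * A ^ 3 * (h / 1 * μ) * (1 + t k)
            + 18 * A ^ 3 * (h * μ) * (1 + t k) := by
            gcongr
            · exact le_self_pow₀ hA (by norm_num)
            · linarith
        _ = _ := by ring
    have s3 : 0 ≤ A ^ 3 * (h * μ) * (1 + t k) := by positivity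
    have : t (k + 1) = E (k + 1) * (‖κ‖ / h ^ 4) + F (k + 1) * (‖κ‖ ^ 2 / h ^ 2) := rfl
    have : t k = E k * (‖κ‖ / h ^ 4) + F k * (‖κ‖ ^ 2 / h ^ 2) := rfl
    nlinarith
  have init : t 0 = 0 := by
    have e0 : gridPoint h N 0 = -(N * h) := by simp [gridPoint]
    simp only [ht, hE, hF, e0, H.init_u, H.init_v]
    simp
  have key := le_exp_sum_of_le_mul (s := fun k => 1 + t k)
    (fun k _ => by have := ht0 k; linarith) step hn
  simp only [init, add_zero, one_mul] at key
  have hT : t n ≤ Real.exp (500 * A ^ 3 * W) := by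
    have : Real.exp (∑ k ∈ Finset.range n, 500 * A ^ 3 * (h * m (-(N * h) + (k + 1) * h)))
        ≤ Real.exp (500 * A ^ 3 * W) := by
      rw [← Finset.mul_sum]
      gcongr
      exact hm.sum_le h hh h1 N n hn
    linarith
  exact ⟨(Et n).trans (by gcongr), (Ft n).trans (by gcongr)⟩

/-- The stiff error is also `O(h⁴ / |κ|)`, because the method damps stiff perturbations by the
factor `1 - O(1 / (h |κ|))` per step. -/
theorem IsModelRun.norm_stiff_error_le (H : IsModelRun ψ κ h N u v a b) (hs : ModelSolution ψ κ u v)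
    (hA : 1 ≤ A)
    (D : ∀ k < N, CellData A ψ κ u v (gridPoint h N k) h (m (gridPoint h N (k + 1))))
    (hc : 0 < c₀) (hh : 0 < h) (h1 : h ≤ 1) (hq : 60 ≤ h * ‖κ‖) (hK : 16 * A ^ 2 ≤ ‖κ‖)
    (hre : c₀ * ‖κ‖ ≤ κ.re) {T : ℝ} (hT : 0 ≤ T)
    (hE : ∀ n ≤ N, ‖a n - u (gridPoint h N n)‖ ≤ h ^ 4 / ‖κ‖ * T)
    (hF : ∀ n ≤ N, ‖b n - v (gridPoint h N n)‖ ≤ h ^ 2 / ‖κ‖ ^ 2 * T) {n : ℕ} (hn : n ≤ N) :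
    ‖b n - v (gridPoint h N n)‖ ≤ 408 * A ^ 4 * (1 + T) / c₀ * (h ^ 4 / ‖κ‖) := by
  have hK1 : 1 ≤ ‖κ‖ := by nlinarith
  have hK0 : 0 < ‖κ‖ := by linarith
  have hqn : ‖(h : ℂ) * κ‖ = h * ‖κ‖ := by
    rw [norm_mul, Complex.norm_real, Real.norm_of_nonneg hh.le]
  have hqre : c₀ * ‖(h : ℂ) * κ‖ ≤ ((h : ℂ) * κ).re := by
    rw [hqn, Complex.re_ofReal_mul]; nlinarith
  have hR := norm_stability_le hc (by rw [hqn]; exact hq) hqre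
  rw [hqn] at hR
  induction n with
  | zero =>
    have e0 : gridPoint h N 0 = -(N * h) := by simp [gridPoint]
    rw [e0, H.init_v, sub_self, norm_zero]
    positivity
  | succ k ih =>
    have hk : k < N := by omega
    have ih := ih hk.le
    have Dk := D k hk
    have hμ := Dk.weight_nonneg
    have hμA := Dk.weight_le
    set μ := m (gridPoint h N (k + 1))
    have hY := stageBound_le hA hμA hK1 hh h1 (by linarith) (hE k hk.le) (hF k hk.le) hT
    obtain ⟨-, r2⟩ := (H.step k hk).norm_error_le hs Dk hh h1 hq hK hY
    change ‖b (k + 1) - v (gridPoint h N k + h)‖ ≤ _ * ‖b k - v (gridPoint h N k)‖ + _ + _ at r2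
    rw [gridPoint_succ] at r2
    set F := ‖b k - v (gridPoint h N k)‖
    set B := 408 * A ^ 4 * (1 + T) / c₀ * (h ^ 4 / ‖κ‖) with hB
    have hF0 : 0 ≤ F := norm_nonneg _
    have hR0 := (norm_nonneg _).trans hR
    have s1 : 5 / ‖κ‖ * (A * (μ / ‖κ‖) * (78 * A ^ 2 * (h ^ 3 / ‖κ‖) * (1 + T)))
        + 18 * A * (h ^ 3 * μ / ‖κ‖ ^ 2) ≤ c₀ / (h * ‖κ‖) * B := by
      calc _ ≤ 5 / ‖κ‖ * (A * (A / ‖κ‖) * (78 * A ^ 2 * (h ^ 3 / 1) * (1 + T)))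
            + 18 * A * (h ^ 3 * A / ‖κ‖ ^ 2) := by gcongr
        _ = 390 * A ^ 4 * (1 + T) * (h ^ 3 / ‖κ‖ ^ 2) + 18 * A ^ 2 * 1 * (h ^ 3 / ‖κ‖ ^ 2) := by
            field_simp; ring
        _ ≤ 390 * A ^ 4 * (1 + T) * (h ^ 3 / ‖κ‖ ^ 2)
            + 18 * A ^ 4 * (1 + T) * (h ^ 3 / ‖κ‖ ^ 2) := by
            gcongr
            · norm_num
            · linarith
        _ = _ := by rw [hB]; field_simp; ring
    calc ‖b (k + 1) - v (gridPoint h N (k + 1))‖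
        ≤ (1 - c₀ / (h * ‖κ‖)) * F + c₀ / (h * ‖κ‖) * B := by
          have := mul_le_mul_of_nonneg_right hR hF0
          linarith
      _ ≤ (1 - c₀ / (h * ‖κ‖)) * B + c₀ / (h * ‖κ‖) * B := by gcongr
      _ = B := by ring

/-- The error of `u` is the accumulated quadrature error of the coefficient, up to terms that are
of second order in `1 / κ` only where they are of eighth order in `h`. -/
theorem IsModelRun.norm_fine_error_le (H : IsModelRun ψ κ h N u v a b) (hm : IsWeight ψ m W)
    (hs : ModelSolution ψ κ u v) (hA : 1 ≤ A)
    (D : ∀ k < N, CellData A ψ κ u v (gridPoint h N k) h (m (gridPoint h N (k + 1))))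
    (hh : 0 < h) (h1 : h ≤ 1) (hq : 60 ≤ h * ‖κ‖) (hK : 16 * A ^ 2 ≤ ‖κ‖) {T B : ℝ} (hT : 0 ≤ T)
    (hB : 0 ≤ B) (hE : ∀ n ≤ N, ‖a n - u (gridPoint h N n)‖ ≤ h ^ 4 / ‖κ‖ * T)
    (hF : ∀ n ≤ N, ‖b n - v (gridPoint h N n)‖ ≤ h ^ 2 / ‖κ‖ ^ 2 * T)
    (hG : ∀ n ≤ N, ‖b n - v (gridPoint h N n)‖ ≤ B * (h ^ 4 / ‖κ‖)) {n : ℕ} (hn : n ≤ N) :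
    ‖∑ j ∈ Finset.range n, gaussDefect (modelCoeff ψ κ) (gridPoint h N j) h‖
        ≤ 2 * A * W * (h ^ 4 / ‖κ‖) ∧
    ‖a n - u (gridPoint h N n) - u (gridPoint h N n)
        * ∑ j ∈ Finset.range n, gaussDefect (modelCoeff ψ κ) (gridPoint h N j) h‖
      ≤ Real.exp ((6 * A ^ 4 * W + 5000 * A ^ 5 * (1 + T) + 14 * A * B) * W)
        * (h ^ 4 / ‖κ‖ ^ 3 + h ^ 2 / ‖κ‖ ^ 4 + h ^ 8 / ‖κ‖ ^ 2) := by
  have hK1 : 1 ≤ ‖κ‖ := by nlinarith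
  have hK0 : 0 < ‖κ‖ := by linarith
  have hW := hm.bound_nonneg
  have em : ∀ k : ℕ, m (-(N * h) + (k + 1) * h) = m (gridPoint h N (k + 1)) := by
    intro k
    simp only [gridPoint]; push_cast; rfl
  have hS : ∀ n ≤ N, ‖∑ j ∈ Finset.range n, gaussDefect (modelCoeff ψ κ) (gridPoint h N j) h‖
      ≤ 2 * A * W * (h ^ 4 / ‖κ‖) := by
    intro n hn
    have hsum := hm.sum_le h hh h1 N n hn
    calc _ ≤ ∑ j ∈ Finset.range n, 2 * A * (h ^ 4 / ‖κ‖) * (h * m (-(N * h) + (j + 1) * h)) := by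
          refine (norm_sum_le _ _).trans (Finset.sum_le_sum fun j hj => ?_)
          rw [em]
          refine ((D j (by have := Finset.mem_range.mp hj; omega)).norm_gaussDefect_coeff_le
            hh).trans (le_of_eq (by ring))
      _ = 2 * A * (h ^ 4 / ‖κ‖) * ∑ j ∈ Finset.range n, h * m (-(N * h) + (j + 1) * h) := by
          rw [Finset.mul_sum]
      _ ≤ 2 * A * (h ^ 4 / ‖κ‖) * W := by gcongr
      _ = _ := by ring
  refine ⟨hS n hn, ?_⟩
  set C := 6 * A ^ 4 * W + 5000 * A ^ 5 * (1 + T) + 14 * A * B with hC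
  set τ := h ^ 4 / ‖κ‖ ^ 3 + h ^ 2 / ‖κ‖ ^ 4 + h ^ 8 / ‖κ‖ ^ 2 with hτ
  have hτ0 : 0 ≤ τ := by positivity
  set S : ℕ → ℂ := fun n =>
    ∑ j ∈ Finset.range n, gaussDefect (modelCoeff ψ κ) (gridPoint h N j) h with hSd
  -- the summand `τ` makes the recursion for the error homogeneous
  set s : ℕ → ℝ := fun n =>
    τ + ‖a n - u (gridPoint h N n) - u (gridPoint h N n) * S n‖ with hsd
  have step : ∀ k < N, s (k + 1) ≤ (1 + C * (h * m (-(N * h) + (k + 1) * h))) * s k := by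
    intro k hk
    have Dk := D k hk
    have hμ := Dk.weight_nonneg
    have hμA := Dk.weight_le
    rw [em]
    set μ := m (gridPoint h N (k + 1))
    have hY := stageBound_le hA hμA hK1 hh h1 (by linarith) (hE k hk.le) (hF k hk.le) hT
    have key := (H.step k hk).norm_fine_error_le hs Dk hh h1 hq hK hY (S k)
    change ‖a (k + 1) - u (gridPoint h N k + h) - u (gridPoint h N k + h)
      * (S k + gaussDefect (modelCoeff ψ κ) (gridPoint h N k) h)‖ ≤
      (1 + A * (h * μ)) * ‖a k - u (gridPoint h N k) - u (gridPoint h N k) * S k‖ + _ + _ + _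
      + (14 * h * ‖b k - v (gridPoint h N k)‖ / (h * ‖κ‖) ^ 2
        * (A * (μ / ‖κ‖) + h * ‖κ‖ * (A * (h * μ / ‖κ‖))) + _) at key
    have eS : S k + gaussDefect (modelCoeff ψ κ) (gridPoint h N k) h = S (k + 1) := by
      simp only [hSd, Finset.sum_range_succ]
    rw [gridPoint_succ, eS] at key
    set d := ‖a k - u (gridPoint h N k) - u (gridPoint h N k) * S k‖ with hd
    set F := ‖b k - v (gridPoint h N k)‖ with hFd
    have hF0 : 0 ≤ F := norm_nonneg _
    have hd0 : 0 ≤ d := norm_nonneg _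
    have p1 : 0 ≤ h * μ := by positivity
    have t1 : h ^ 4 / ‖κ‖ ^ 3 ≤ τ := by
      have : 0 ≤ h ^ 2 / ‖κ‖ ^ 4 := by positivity
      have : 0 ≤ h ^ 8 / ‖κ‖ ^ 2 := by positivity
      linarith
    have t2 : h ^ 2 / ‖κ‖ ^ 4 ≤ τ := by
      have : 0 ≤ h ^ 4 / ‖κ‖ ^ 3 := by positivity
      have : 0 ≤ h ^ 8 / ‖κ‖ ^ 2 := by positivity
      linarith
    have t3 : h ^ 4 / ‖κ‖ ^ 3 + h ^ 8 / ‖κ‖ ^ 2 ≤ τ := by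
      have : 0 ≤ h ^ 2 / ‖κ‖ ^ 4 := by positivity
      linarith
    have h54 : h ^ 5 ≤ h ^ 4 := pow_le_pow_of_le_one hh.le h1 (by norm_num)
    have h98 : h ^ 9 ≤ h ^ 8 := pow_le_pow_of_le_one hh.le h1 (by norm_num)
    have h32 : h ^ 3 ≤ h ^ 2 := pow_le_pow_of_le_one hh.le h1 (by norm_num)
    have a35 : A ^ 3 ≤ A ^ 5 := pow_le_pow_right₀ hA (by norm_num)
    have a45 : A ^ 4 ≤ A ^ 5 := pow_le_pow_right₀ hA (by norm_num)
    have a15 : A ≤ A ^ 5 := le_self_pow₀ hA (by norm_num)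
    -- each contribution of the step is a multiple of `h μ τ`
    have q1 : ‖S k‖ * (3 * A ^ 3 * (h ^ 2 * μ / ‖κ‖ ^ 2 + h ^ 5 * μ / ‖κ‖))
        ≤ 6 * A ^ 4 * W * (h * μ * τ) := by
      calc _ ≤ 2 * A * W * (h ^ 4 / ‖κ‖)
            * (3 * A ^ 3 * (h ^ 2 * μ / ‖κ‖ ^ 2 + h ^ 5 * μ / ‖κ‖)) := by
            gcongr; exact hS k hk.le
        _ = 6 * A ^ 4 * W * (h * μ * (h ^ 5 / ‖κ‖ ^ 3 + h ^ 8 / ‖κ‖ ^ 2)) := by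
            field_simp; ring
        _ ≤ 6 * A ^ 4 * W * (h * μ * (h ^ 4 / ‖κ‖ ^ 3 + h ^ 8 / ‖κ‖ ^ 2)) := by gcongr
        _ ≤ _ := by gcongr
    have q2 : 3000 * A ^ 5 * (μ * (h ^ 5 / ‖κ‖ ^ 3 + h ^ 10 / ‖κ‖ ^ 2))
        ≤ 3000 * A ^ 5 * (h * μ * τ) := by
      calc _ = 3000 * A ^ 5 * (h * μ * (h ^ 4 / ‖κ‖ ^ 3 + h ^ 9 / ‖κ‖ ^ 2)) := by ring
        _ ≤ 3000 * A ^ 5 * (h * μ * (h ^ 4 / ‖κ‖ ^ 3 + h ^ 8 / ‖κ‖ ^ 2)) := by gcongr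
        _ ≤ _ := by gcongr
    have q3 : h * (A * (μ / ‖κ‖) * (h * (A * (μ / ‖κ‖) * (78 * A ^ 2 * (h ^ 3 / ‖κ‖) * (1 + T)))))
        ≤ 78 * A ^ 5 * (1 + T) * (h * μ * τ) := by
      calc _ ≤ h * (A * (μ / ‖κ‖) * (h * (A * (A / ‖κ‖)
            * (78 * A ^ 2 * (h ^ 3 / ‖κ‖) * (1 + T))))) := by gcongr
        _ = 78 * A ^ 5 * (1 + T) * (h * μ * (h ^ 4 / ‖κ‖ ^ 3)) := by field_simp
        _ ≤ _ := by gcongr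
    have q4 : 14 * h * F / (h * ‖κ‖) ^ 2 * (A * (μ / ‖κ‖) + h * ‖κ‖ * (A * (h * μ / ‖κ‖)))
        ≤ (14 * A * B + 14 * A ^ 5 * (1 + T)) * (h * μ * τ) := by
      have r1 : 14 * h * F / (h * ‖κ‖) ^ 2 * (A * (μ / ‖κ‖)) ≤ 14 * A * B * (h * μ * τ) := by
        calc _ ≤ 14 * h * (B * (h ^ 4 / ‖κ‖)) / (h * ‖κ‖) ^ 2 * (A * (μ / ‖κ‖)) := by
              gcongr; exact hG k hk.le
          _ = 14 * A * B * (h * μ * (h ^ 2 / ‖κ‖ ^ 4)) := by field_simp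
          _ ≤ _ := by gcongr
      have r2 : 14 * h * F / (h * ‖κ‖) ^ 2 * (h * ‖κ‖ * (A * (h * μ / ‖κ‖)))
          ≤ 14 * A ^ 5 * (1 + T) * (h * μ * τ) := by
        calc _ ≤ 14 * h * (h ^ 2 / ‖κ‖ ^ 2 * T) / (h * ‖κ‖) ^ 2
              * (h * ‖κ‖ * (A * (h * μ / ‖κ‖))) := by
              gcongr; exact hF k hk.le
          _ = 14 * A * T * (h * μ * (h ^ 2 / ‖κ‖ ^ 4)) := by field_simp
          _ ≤ 14 * A ^ 5 * (1 + T) * (h * μ * τ) := by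
              gcongr
              linarith
      linarith
    have q5 : 12 / ‖κ‖ * (A * (μ / ‖κ‖)) * (h * (A * (μ / ‖κ‖)
          * (78 * A ^ 2 * (h ^ 3 / ‖κ‖) * (1 + T))) + 3 * A * (h ^ 3 * μ / ‖κ‖ ^ 2))
        ≤ 972 * A ^ 5 * (1 + T) * (h * μ * τ) := by
      calc _ ≤ 12 / ‖κ‖ * (A * (μ / ‖κ‖)) * (h * (A * (A / ‖κ‖)
            * (78 * A ^ 2 * (h ^ 3 / ‖κ‖) * (1 + T))) + 3 * A * (h ^ 3 * A / ‖κ‖ ^ 2)) := by gcongr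
        _ = 936 * A ^ 5 * (1 + T) * (h * μ * (h ^ 3 / ‖κ‖ ^ 4))
            + 36 * A ^ 3 * 1 * (h * μ * (h ^ 2 / ‖κ‖ ^ 4)) := by field_simp; ring
        _ ≤ 936 * A ^ 5 * (1 + T) * (h * μ * (h ^ 2 / ‖κ‖ ^ 4))
            + 36 * A ^ 5 * (1 + T) * (h * μ * (h ^ 2 / ‖κ‖ ^ 4)) := by
            gcongr
            linarith
        _ = 972 * A ^ 5 * (1 + T) * (h * μ * (h ^ 2 / ‖κ‖ ^ 4)) := by ring
        _ ≤ _ := by gcongr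
    have q6 : 0 ≤ A ^ 5 * T := by positivity
    have q7 : A ≤ C := by
      have : 0 ≤ 6 * A ^ 4 * W := by positivity
      have : 0 ≤ 14 * A * B := by positivity
      have : 0 ≤ A ^ 5 := by positivity
      rw [hC]; linarith
    have e1 : s (k + 1) = τ + ‖a (k + 1) - u (gridPoint h N (k + 1))
      - u (gridPoint h N (k + 1)) * S (k + 1)‖ := rfl
    have e2 : s k = τ + d := rfl
    rw [e1, e2]
    have p2 : 0 ≤ h * μ * τ := by positivity
    have q8 : A * (h * μ) * d ≤ C * (h * μ) * d := by gcongr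
    have q9 : 3000 * A ^ 5 * (h * μ * τ) ≤ 3000 * A ^ 5 * (1 + T) * (h * μ * τ) := by
      have : 0 ≤ A ^ 5 * T * (h * μ * τ) := by positivity
      linarith
    have q10 : 0 ≤ A ^ 5 * (1 + T) * (h * μ * τ) := by positivity
    have q11 : C * (h * μ) * τ = 6 * A ^ 4 * W * (h * μ * τ) + 5000 * A ^ 5 * (1 + T) * (h * μ * τ)
        + 14 * A * B * (h * μ * τ) := by rw [hC]; ring
    have q12 : (1 + C * (h * μ)) * (τ + d) = τ + d + C * (h * μ) * d + C * (h * μ) * τ := by ring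
    rw [q12, q11]
    linarith
  have e0 : s 0 = τ := by
    have e0 : gridPoint h N 0 = -(N * h) := by simp [gridPoint]
    simp only [hsd, hSd, e0, H.init_u]
    simp
  have key := le_exp_sum_of_le_mul (s := s)
    (fun k _ => add_nonneg hτ0 (norm_nonneg _)) step hn
  rw [e0, ← Finset.mul_sum] at key
  have hC0 : 0 ≤ C := by positivity
  calc _ ≤ s n := by simp only [hsd]; linarith
    _ ≤ τ * Real.exp (C * W) := key.trans (by
        gcongr
        exact hm.sum_le h hh h1 N n hn)
    _ = _ := mul_comm _ _

end Global

/-! ### The quadrature error vanishes at all orders -/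

theorem hasDerivAt_iteratedDeriv {f : ℝ → ℂ} (hf : ContDiff ℝ ∞ f) (n : ℕ) (x : ℝ) :
    HasDerivAt (iteratedDeriv n f) (iteratedDeriv (n + 1) f x) x := by
  have : DifferentiableAt ℝ (iteratedDeriv n f) x :=
    (hf.differentiable_iteratedDeriv n (by exact_mod_cast WithTop.coe_lt_top _)) x
  rw [iteratedDeriv_succ]
  exact this.hasDerivAt

theorem continuous_iteratedDeriv {f : ℝ → ℂ} (hf : ContDiff ℝ ∞ f) (n : ℕ) :
    Continuous (iteratedDeriv n f) :=
  hf.continuous_iteratedDeriv n (by exact_mod_cast le_top)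

theorem iteratedDeriv_comp_affine {f : ℝ → ℂ} (hf : ContDiff ℝ ∞ f) (x h : ℝ) (n : ℕ) :
    iteratedDeriv n (fun s => f (x + s * h)) =
      fun s => (h : ℂ) ^ n * iteratedDeriv n f (x + s * h) := by
  induction n with
  | zero => simp
  | succ n ih =>
    rw [iteratedDeriv_succ, ih]
    funext s
    have h1 : HasDerivAt (fun s : ℝ => x + s * h) h s := by
      simpa using ((hasDerivAt_id s).mul_const h).const_add x
    have h2 : HasDerivAt (fun s : ℝ => (h : ℂ) ^ n * iteratedDeriv n f (x + s * h))
        ((h : ℂ) ^ n * (h • iteratedDeriv (n + 1) f (x + s * h))) s :=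
      ((hasDerivAt_iteratedDeriv hf n (x + s * h)).scomp s h1).const_mul ((h : ℂ) ^ n)
    rw [h2.deriv, Complex.real_smul]
    ring

/-- The Peano kernel, for second derivatives, of the quadrature rule `F ↦ F c` on `[0, 1]`. -/
def peanoKernel (c s : ℝ) : ℝ := s ^ 2 / 2 - max (s - c) 0 - (c - 1 / 2) * s

theorem continuous_peanoKernel (c : ℝ) : Continuous (peanoKernel c) := by
  unfold peanoKernel; fun_prop

theorem integral_max_mul {F : ℝ → ℂ} (hF : ContDiff ℝ ∞ F) {c : ℝ} (hc : c ∈ Set.Icc (0 : ℝ) 1) :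
    ∫ s in (0 : ℝ)..1, ((max (s - c) 0 : ℝ) : ℂ) * iteratedDeriv 2 F s
      = (1 - c) * deriv F 1 - F 1 + F c := by
  have cont : Continuous fun s : ℝ => ((max (s - c) 0 : ℝ) : ℂ) * iteratedDeriv 2 F s :=
    (Complex.continuous_ofReal.comp (by fun_prop)).mul (continuous_iteratedDeriv hF 2)
  have d0 : ∀ s, HasDerivAt F (deriv F s) s := fun s => by
    simpa using hasDerivAt_iteratedDeriv hF 0 s
  have d1 : ∀ s, HasDerivAt (deriv F) (iteratedDeriv 2 F s) s := fun s => by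
    simpa [iteratedDeriv_one] using hasDerivAt_iteratedDeriv hF 1 s
  rw [← intervalIntegral.integral_add_adjacent_intervals (b := c) (cont.intervalIntegrable _ _)
    (cont.intervalIntegrable _ _)]
  have z : ∫ s in (0 : ℝ)..c, ((max (s - c) 0 : ℝ) : ℂ) * iteratedDeriv 2 F s = 0 := by
    rw [intervalIntegral.integral_congr (g := fun _ => 0)]
    · simp
    · intro s hs
      rw [Set.uIcc_of_le hc.1] at hs
      simp [max_eq_right (sub_nonpos.mpr hs.2)]
  have e : ∫ s in c..1, ((max (s - c) 0 : ℝ) : ℂ) * iteratedDeriv 2 F s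
      = ∫ s in c..1, ((s - c : ℝ) : ℂ) * iteratedDeriv 2 F s := by
    apply intervalIntegral.integral_congr
    intro s hs
    rw [Set.uIcc_of_le hc.2] at hs
    simp [max_eq_left (sub_nonneg.mpr hs.1)]
  have hd : ∀ s, HasDerivAt (fun s : ℝ => ((s - c : ℝ) : ℂ) * deriv F s - F s)
      (((s - c : ℝ) : ℂ) * iteratedDeriv 2 F s) s := by
    intro s
    have h1 : HasDerivAt (fun t : ℝ => ((t - c : ℝ) : ℂ)) 1 s := by
      simpa using ((hasDerivAt_id s).sub_const c).ofReal_comp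
    exact ((h1.mul (d1 s)).sub (d0 s)).congr_deriv (by ring)
  have hc1 : Continuous fun s : ℝ => ((s - c : ℝ) : ℂ) * iteratedDeriv 2 F s :=
    (by fun_prop : Continuous fun s : ℝ => ((s - c : ℝ) : ℂ)).mul (continuous_iteratedDeriv hF 2)
  rw [z, e, intervalIntegral.integral_eq_sub_of_hasDerivAt (fun s _ => hd s)
    (hc1.intervalIntegrable _ _)]
  push_cast
  ring

/-- Integration by parts, twice, against the Peano kernel. The linear term makes the kernel vanish
at `1`, so that the boundary terms contain only `F`. -/
theorem point_sub_integral_eq {F : ℝ → ℂ} (hF : ContDiff ℝ ∞ F) {c : ℝ}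
    (hc : c ∈ Set.Icc (0 : ℝ) 1) :
    F c - ∫ s in (0 : ℝ)..1, F s = (c - 1 / 2) * (F 1 - F 0)
      - ∫ s in (0 : ℝ)..1, (peanoKernel c s : ℂ) * iteratedDeriv 2 F s := by
  have d0 : ∀ s, HasDerivAt F (deriv F s) s := fun s => by
    simpa using hasDerivAt_iteratedDeriv hF 0 s
  have d1 : ∀ s, HasDerivAt (deriv F) (iteratedDeriv 2 F s) s := fun s => by
    simpa [iteratedDeriv_one] using hasDerivAt_iteratedDeriv hF 1 s
  have c2 := continuous_iteratedDeriv hF 2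
  set p : ℝ → ℂ := fun s => (s : ℂ) ^ 2 / 2 - (c - 1 / 2) * s with hp
  have hpd : ∀ s : ℝ, HasDerivAt p (s - (c - 1 / 2)) s := by
    intro s
    have h1 : HasDerivAt (fun t : ℝ => (t : ℂ)) 1 s := (hasDerivAt_id s).ofReal_comp
    exact (((h1.pow 2).div_const 2).sub (h1.const_mul ((c : ℂ) - 1 / 2))).congr_deriv
      (by simp)
  have hp'd : ∀ s : ℝ, HasDerivAt (fun s : ℝ => (s : ℂ) - (c - 1 / 2)) 1 s := fun s =>
    (hasDerivAt_id s).ofReal_comp.sub_const _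
  have hd : ∀ s, HasDerivAt (fun s : ℝ => p s * deriv F s - (s - (c - 1 / 2)) * F s)
      (p s * iteratedDeriv 2 F s - F s) s := by
    intro s
    exact (((hpd s).mul (d1 s)).sub ((hp'd s).mul (d0 s))).congr_deriv (by ring)
  have hpc : Continuous fun s => p s * iteratedDeriv 2 F s :=
    (by fun_prop : Continuous p).mul c2
  have i1 : ∫ s in (0 : ℝ)..1, (p s * iteratedDeriv 2 F s - F s)
      = (p 1 * deriv F 1 - (1 - (c - 1 / 2)) * F 1)
        - (p 0 * deriv F 0 - (0 - (c - 1 / 2)) * F 0) := by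
    rw [intervalIntegral.integral_eq_sub_of_hasDerivAt (fun s _ => hd s)
      ((hpc.sub hF.continuous).intervalIntegrable _ _)]
    push_cast
    ring
  rw [intervalIntegral.integral_sub (hpc.intervalIntegrable _ _)
    (hF.continuous.intervalIntegrable _ _)] at i1
  have i2 := integral_max_mul hF hc
  have cm : Continuous fun s : ℝ => ((max (s - c) 0 : ℝ) : ℂ) * iteratedDeriv 2 F s :=
    (Complex.continuous_ofReal.comp (by fun_prop)).mul c2
  have i3 : ∫ s in (0 : ℝ)..1, (peanoKernel c s : ℂ) * iteratedDeriv 2 F s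
      = (∫ s in (0 : ℝ)..1, p s * iteratedDeriv 2 F s)
        - ∫ s in (0 : ℝ)..1, ((max (s - c) 0 : ℝ) : ℂ) * iteratedDeriv 2 F s := by
    rw [← intervalIntegral.integral_sub (hpc.intervalIntegrable _ _)
      (cm.intervalIntegrable _ _)]
    congr 1
    funext s
    rw [peanoKernel, hp]
    push_cast
    ring
  rw [i3, i2]
  simp only [hp] at i1 ⊢
  push_cast at i1
  linear_combination i1

/-- The Euler-Maclaurin expansion for the two-point Gauss rule on `[0, 1]`, up to any order. -/
theorem exists_eulerMaclaurin (n : ℕ) : ∃ (a : ℕ → ℝ) (k : ℝ → ℝ), Continuous k ∧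
    ∀ F : ℝ → ℂ, ContDiff ℝ ∞ F →
      (F (1 / 2 - gaussOffset) + F (1 / 2 + gaussOffset)) / 2 - ∫ s in (0 : ℝ)..1, F s
        = ∑ p ∈ Finset.range n, a p * (iteratedDeriv (p + 1) F 1 - iteratedDeriv (p + 1) F 0)
          + ∫ s in (0 : ℝ)..1, (k s : ℂ) * iteratedDeriv (n + 2) F s := by
  induction n with
  | zero =>
    have hp := gaussOffset_pos
    have hl := gaussOffset_le
    refine ⟨0, fun s => -(peanoKernel (1 / 2 - gaussOffset) s
      + peanoKernel (1 / 2 + gaussOffset) s) / 2, ?_, ?_⟩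
    · exact (((continuous_peanoKernel _).add (continuous_peanoKernel _)).neg).div_const 2
    · intro F hF
      have e1 := point_sub_integral_eq hF (c := 1 / 2 - gaussOffset) ⟨by linarith, by linarith⟩
      have e2 := point_sub_integral_eq hF (c := 1 / 2 + gaussOffset) ⟨by linarith, by linarith⟩
      have c2 := continuous_iteratedDeriv hF 2
      have k1 : Continuous fun s : ℝ => (peanoKernel (1 / 2 - gaussOffset) s : ℂ)
          * iteratedDeriv 2 F s :=
        (Complex.continuous_ofReal.comp (continuous_peanoKernel _)).mul c2
      have k2 : Continuous fun s : ℝ => (peanoKernel (1 / 2 + gaussOffset) s : ℂ)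
          * iteratedDeriv 2 F s :=
        (Complex.continuous_ofReal.comp (continuous_peanoKernel _)).mul c2
      have i : ∫ s in (0 : ℝ)..1, ((-(peanoKernel (1 / 2 - gaussOffset) s
          + peanoKernel (1 / 2 + gaussOffset) s) / 2 : ℝ) : ℂ) * iteratedDeriv (0 + 2) F s
          = -(1 / 2) * ((∫ s in (0 : ℝ)..1, (peanoKernel (1 / 2 - gaussOffset) s : ℂ)
            * iteratedDeriv 2 F s) + ∫ s in (0 : ℝ)..1,
              (peanoKernel (1 / 2 + gaussOffset) s : ℂ) * iteratedDeriv 2 F s) := by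
        rw [← intervalIntegral.integral_add (k1.intervalIntegrable _ _)
          (k2.intervalIntegrable _ _), ← intervalIntegral.integral_const_mul]
        congr 1
        funext s
        push_cast
        ring
      rw [i, Finset.sum_range_zero]
      push_cast at e1 e2
      linear_combination e1 / 2 + e2 / 2
  | succ n ih =>
    obtain ⟨a, k, hk, H⟩ := ih
    -- the mean of the kernel gives the next boundary term, and the rest is integrated by parts
    set kbar := ∫ s in (0 : ℝ)..1, k s with hkbar
    set A : ℝ → ℝ := fun s => ∫ t in (0 : ℝ)..s, (k t - kbar) with hA
    have hkc : Continuous fun t => k t - kbar := hk.sub continuous_const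
    have hAd : ∀ s, HasDerivAt A (k s - kbar) s := fun s =>
      intervalIntegral.integral_hasDerivAt_right (hkc.intervalIntegrable _ _)
        hkc.stronglyMeasurable.stronglyMeasurableAtFilter hkc.continuousAt
    have hAc : Continuous A := continuous_iff_continuousAt.mpr fun s => (hAd s).continuousAt
    have hA0 : A 0 = 0 := by simp [hA]
    have hA1 : A 1 = 0 := by
      simp only [hA]
      rw [intervalIntegral.integral_sub (hk.intervalIntegrable _ _)
        (continuous_const.intervalIntegrable _ _)]
      simp [hkbar]
    refine ⟨Function.update a n kbar, fun s => -A s, hAc.neg, fun F hF => ?_⟩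
    rw [H F hF, Finset.sum_range_succ]
    have s1 : ∑ p ∈ Finset.range n, ((Function.update a n kbar p : ℝ) : ℂ)
        * (iteratedDeriv (p + 1) F 1 - iteratedDeriv (p + 1) F 0)
        = ∑ p ∈ Finset.range n, (a p : ℂ)
          * (iteratedDeriv (p + 1) F 1 - iteratedDeriv (p + 1) F 0) := by
      refine Finset.sum_congr rfl fun p hp => ?_
      rw [Function.update_of_ne (by have := Finset.mem_range.mp hp; omega)]
    have c2 := continuous_iteratedDeriv hF (n + 2)
    have c3 := continuous_iteratedDeriv hF (n + 3)
    have hd : ∀ s, HasDerivAt (fun s : ℝ => (A s : ℂ) * iteratedDeriv (n + 2) F s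
        + kbar * iteratedDeriv (n + 1) F s) ((k s : ℂ) * iteratedDeriv (n + 2) F s
          + (A s : ℂ) * iteratedDeriv (n + 3) F s) s := by
      intro s
      exact (((hAd s).ofReal_comp.mul (hasDerivAt_iteratedDeriv hF (n + 2) s)).add
        ((hasDerivAt_iteratedDeriv hF (n + 1) s).const_mul (kbar : ℂ))).congr_deriv
        (by push_cast; ring)
    have k1 : Continuous fun s : ℝ => (k s : ℂ) * iteratedDeriv (n + 2) F s :=
      (Complex.continuous_ofReal.comp hk).mul c2
    have k2 : Continuous fun s : ℝ => (A s : ℂ) * iteratedDeriv (n + 3) F s :=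
      (Complex.continuous_ofReal.comp hAc).mul c3
    have i := intervalIntegral.integral_eq_sub_of_hasDerivAt (a := 0) (b := 1) (fun s _ => hd s)
      ((k1.add k2).intervalIntegrable _ _)
    rw [intervalIntegral.integral_add (k1.intervalIntegrable _ _) (k2.intervalIntegrable _ _),
      hA0, hA1] at i
    have j : ∫ s in (0 : ℝ)..1, ((-A s : ℝ) : ℂ) * iteratedDeriv (n + 1 + 2) F s
        = -∫ s in (0 : ℝ)..1, (A s : ℂ) * iteratedDeriv (n + 3) F s := by
      rw [← intervalIntegral.integral_neg]
      congr 1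
      funext s
      push_cast
      ring
    rw [s1, j, Function.update_self]
    push_cast at i
    linear_combination i

/-- The Euler-Maclaurin expansion on a cell of length `h`. -/
theorem exists_gaussDefect_expansion (n : ℕ) : ∃ (a : ℕ → ℝ) (B : ℝ), 0 ≤ B ∧
    ∀ (f : ℝ → ℂ), ContDiff ℝ ∞ f → ∀ x h : ℝ, 0 < h →
      ‖gaussDefect f x h - ∑ p ∈ Finset.range n, (a p : ℂ) * (h : ℂ) ^ (p + 2)
        * (iteratedDeriv (p + 1) f (x + h) - iteratedDeriv (p + 1) f x)‖
      ≤ B * h ^ (n + 2) * ∫ t in x..(x + h), ‖iteratedDeriv (n + 2) f t‖ := by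
  obtain ⟨a, k, hk, H⟩ := exists_eulerMaclaurin n
  obtain ⟨B, hB⟩ := (isCompact_Icc (a := (0 : ℝ)) (b := 1)).exists_bound_of_continuousOn
    hk.continuousOn
  have hB0 : 0 ≤ B := (norm_nonneg _).trans (hB 0 ⟨le_rfl, zero_le_one⟩)
  refine ⟨a, B, hB0, fun f hf x h hh => ?_⟩
  have hF : ContDiff ℝ ∞ fun s : ℝ => f (x + s * h) :=
    hf.comp (contDiff_const.add (contDiff_id.mul contDiff_const))
  have e := H _ hF
  simp only [iteratedDeriv_comp_affine hf x h] at e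
  have hint : ∀ g : ℝ → ℂ, (h : ℂ) * ∫ s in (0 : ℝ)..1, g (x + s * h) = ∫ t in x..(x + h), g t := by
    intro g
    have := intervalIntegral.smul_integral_comp_add_mul (a := 0) (b := 1) g h x
    simp only [mul_zero, add_zero, mul_one] at this
    rw [← this, Complex.real_smul]
    congr 2
    funext s
    rw [mul_comm]
  have hintr : ∀ g : ℝ → ℝ, h * ∫ s in (0 : ℝ)..1, g (x + s * h) = ∫ t in x..(x + h), g t := by
    intro g
    have := intervalIntegral.smul_integral_comp_add_mul (a := 0) (b := 1) g h x
    simp only [mul_zero, add_zero, mul_one] at this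
    rw [← this, smul_eq_mul]
    congr 2
    funext s
    rw [mul_comm]
  have e2 : gaussDefect f x h - ∑ p ∈ Finset.range n, (a p : ℂ) * (h : ℂ) ^ (p + 2)
        * (iteratedDeriv (p + 1) f (x + h) - iteratedDeriv (p + 1) f x)
      = h * ∫ s in (0 : ℝ)..1,
          (k s : ℂ) * ((h : ℂ) ^ (n + 2) * iteratedDeriv (n + 2) f (x + s * h)) := by
    have s1 : ∑ p ∈ Finset.range n, (a p : ℂ) * (h : ℂ) ^ (p + 2)
        * (iteratedDeriv (p + 1) f (x + h) - iteratedDeriv (p + 1) f x)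
        = h * ∑ p ∈ Finset.range n, (a p : ℂ) * ((h : ℂ) ^ (p + 1)
          * iteratedDeriv (p + 1) f (x + 1 * h) - (h : ℂ) ^ (p + 1)
            * iteratedDeriv (p + 1) f (x + 0 * h)) := by
      rw [Finset.mul_sum]
      refine Finset.sum_congr rfl fun p _ => ?_
      rw [one_mul, zero_mul, add_zero]
      ring
    rw [s1, gaussDefect, ← hint f]
    linear_combination h * e
  rw [e2, norm_mul, Complex.norm_real, Real.norm_of_nonneg hh.le, ← hintr, mul_left_comm]
  refine mul_le_mul_of_nonneg_left ?_ hh.le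
  rw [← intervalIntegral.integral_const_mul]
  have c2 := continuous_iteratedDeriv hf (n + 2)
  refine intervalIntegral.norm_integral_le_of_norm_le zero_le_one
    (Eventually.of_forall fun s hs => ?_) (Continuous.intervalIntegrable (by fun_prop) _ _)
  rw [norm_mul, norm_mul, norm_pow, Complex.norm_real, Complex.norm_real,
    Real.norm_of_nonneg hh.le, mul_assoc]
  have := hB s ⟨hs.1.le, hs.2⟩
  gcongr

theorem iteratedDeriv_ofReal_comp {f : ℝ → ℝ} (hf : ContDiff ℝ ∞ f) (n : ℕ) :
    iteratedDeriv n (fun x => (f x : ℂ)) = fun x => ((iteratedDeriv n f x : ℝ) : ℂ) := by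
  induction n with
  | zero => simp
  | succ n ih =>
    rw [iteratedDeriv_succ, ih]
    funext x
    have : DifferentiableAt ℝ (iteratedDeriv n f) x :=
      (hf.differentiable_iteratedDeriv n (by exact_mod_cast WithTop.coe_lt_top _)) x
    rw [iteratedDeriv_succ]
    exact this.hasDerivAt.ofReal_comp.deriv

theorem contDiff_ofReal_comp {f : ℝ → ℝ} (hf : ContDiff ℝ ∞ f) :
    ContDiff ℝ ∞ fun x => (f x : ℂ) :=
  Complex.ofRealCLM.contDiff.comp hf

/-- The composite quadrature error as a sum over the cells. -/
theorem quadratureDefect_eq_sum {φ : ℝ → ℝ} (hφ : Continuous φ) (h : ℝ) (N : ℕ) :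
    (quadratureDefect φ h N : ℂ)
      = ∑ j ∈ Finset.range (2 * N), gaussDefect (fun x => (φ x : ℂ)) (gridPoint h N j) h := by
  have hc : Continuous fun x => (φ x : ℂ) := Complex.continuous_ofReal.comp hφ
  have i : ∑ j ∈ Finset.range (2 * N), ∫ t in (gridPoint h N j)..(gridPoint h N (j + 1)), (φ t : ℂ)
      = ∫ t in (gridPoint h N 0)..(gridPoint h N (2 * N)), (φ t : ℂ) :=
    intervalIntegral.sum_integral_adjacent_intervals fun k _ => hc.intervalIntegrable _ _
  have e0 : gridPoint h N 0 = -(N * h) := by simp [gridPoint]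
  have e1 : gridPoint h N (2 * N) = N * h := by simp only [gridPoint]; push_cast; ring
  rw [e0, e1] at i
  simp only [gaussDefect, gridPoint_succ]
  rw [Finset.sum_sub_distrib, i, quadratureDefect, intervalIntegral.integral_ofReal]
  push_cast
  congr 1

/-- In the sum of the Euler-Maclaurin expansions of the cells the boundary terms telescope to
derivatives of `φ` at `± N h`, which are negligible, and the remainders add up to a multiple of
`h ^ (M + 2) ∫ |φ^(M + 2)|`. -/
theorem quadratureDefect_isBigO {φ : ℝ → ℝ} (hφ : ContDiff ℝ ∞ φ)
    (hderiv : ∀ p : ℕ, 1 ≤ p → Integrable (iteratedDeriv p φ)) {N : ℝ → ℕ}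
    (hN : ∀ p : ℕ, 1 ≤ p → ∀ M : ℕ,
      (fun h : ℝ => iteratedDeriv p φ (-(N h * h))) =O[𝓝[>] 0] (fun h : ℝ => h ^ M) ∧
      (fun h : ℝ => iteratedDeriv p φ (N h * h)) =O[𝓝[>] 0] (fun h : ℝ => h ^ M)) (M : ℕ) :
    (fun h : ℝ => quadratureDefect φ h (N h)) =O[𝓝[>] 0] (fun h : ℝ => h ^ M) := by
  obtain ⟨a, B, hB, H⟩ := exists_gaussDefect_expansion M
  have hf := contDiff_ofReal_comp hφ
  set I := ∫ t, ‖iteratedDeriv (M + 2) φ t‖ with hI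
  -- the boundary terms
  have hb : (fun h : ℝ => ∑ p ∈ Finset.range M, a p * h ^ (p + 2)
      * (iteratedDeriv (p + 1) φ (N h * h) - iteratedDeriv (p + 1) φ (-(N h * h))))
      =O[𝓝[>] 0] (fun h : ℝ => h ^ M) := by
    refine IsBigO.fun_sum fun p _ => ?_
    have h1 := (hN (p + 1) (by omega) M).2.sub (hN (p + 1) (by omega) M).1
    have h2 : (fun h : ℝ => a p * h ^ (p + 2)) =O[𝓝[>] 0] (fun _ : ℝ => (1 : ℝ)) := by
      have : Tendsto (fun h : ℝ => a p * h ^ (p + 2)) (𝓝[>] 0) (𝓝 (a p * 0 ^ (p + 2))) :=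
        ((by fun_prop : Continuous fun h : ℝ => a p * h ^ (p + 2)).tendsto 0).mono_left
          nhdsWithin_le_nhds
      exact this.isBigO_one ℝ
    simpa using h2.mul h1
  have hr : (fun h : ℝ => quadratureDefect φ h (N h) - ∑ p ∈ Finset.range M, a p * h ^ (p + 2)
      * (iteratedDeriv (p + 1) φ (N h * h) - iteratedDeriv (p + 1) φ (-(N h * h))))
      =O[𝓝[>] 0] (fun h : ℝ => h ^ M) := by
    refine IsBigO.of_bound (B * I) ?_
    filter_upwards [Ioo_mem_nhdsGT (zero_lt_one' ℝ)] with h hh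
    have e0 : gridPoint h (N h) 0 = -(N h * h) := by simp [gridPoint]
    have e1 : gridPoint h (N h) (2 * N h) = N h * h := by simp only [gridPoint]; push_cast; ring
    have e : ((quadratureDefect φ h (N h) - ∑ p ∈ Finset.range M, a p * h ^ (p + 2)
        * (iteratedDeriv (p + 1) φ (N h * h) - iteratedDeriv (p + 1) φ (-(N h * h))) : ℝ) : ℂ)
        = ∑ j ∈ Finset.range (2 * N h), (gaussDefect (fun x => (φ x : ℂ)) (gridPoint h (N h) j) h
          - ∑ p ∈ Finset.range M, (a p : ℂ) * (h : ℂ) ^ (p + 2)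
            * (iteratedDeriv (p + 1) (fun x => (φ x : ℂ)) (gridPoint h (N h) j + h)
              - iteratedDeriv (p + 1) (fun x => (φ x : ℂ)) (gridPoint h (N h) j))) := by
      rw [Finset.sum_sub_distrib, ← quadratureDefect_eq_sum hφ.continuous, Finset.sum_comm]
      push_cast
      congr 1
      refine Finset.sum_congr rfl fun p _ => ?_
      rw [← Finset.mul_sum]
      congr 1
      simp only [gridPoint_succ, iteratedDeriv_ofReal_comp hφ]
      rw [Finset.sum_range_sub (fun j => ((iteratedDeriv (p + 1) φ (gridPoint h (N h) j) : ℝ) : ℂ)),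
        e0, e1]
    rw [← Complex.norm_real (quadratureDefect φ h (N h) - _), e]
    have c2 : Continuous fun t => ‖iteratedDeriv (M + 2) (fun x => (φ x : ℂ)) t‖ :=
      (continuous_iteratedDeriv hf (M + 2)).norm
    have isum : ∑ j ∈ Finset.range (2 * N h),
        ∫ t in (gridPoint h (N h) j)..(gridPoint h (N h) j + h),
          ‖iteratedDeriv (M + 2) (fun x => (φ x : ℂ)) t‖ ≤ I := by
      simp only [gridPoint_succ]
      rw [intervalIntegral.sum_integral_adjacent_intervals
        (fun k _ => c2.intervalIntegrable _ _), e0, e1]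
      simp only [iteratedDeriv_ofReal_comp hφ, Complex.norm_real]
      have : -(N h * h) ≤ N h * h := by
        have : 0 ≤ N h * h := mul_nonneg (Nat.cast_nonneg _) hh.1.le
        linarith
      rw [intervalIntegral.integral_of_le this]
      exact setIntegral_le_integral (hderiv (M + 2) (by omega)).norm
        (Eventually.of_forall fun t => norm_nonneg _)
    calc _ ≤ ∑ j ∈ Finset.range (2 * N h), B * h ^ (M + 2) *
          ∫ t in (gridPoint h (N h) j)..(gridPoint h (N h) j + h),
            ‖iteratedDeriv (M + 2) (fun x => (φ x : ℂ)) t‖ :=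
          (norm_sum_le _ _).trans (Finset.sum_le_sum fun j _ => H _ hf _ _ hh.1)
      _ ≤ B * h ^ (M + 2) * I := by
          rw [← Finset.mul_sum]
          have := hh.1.le
          gcongr
      _ ≤ B * h ^ M * I := by
          have hI0 : 0 ≤ I := integral_nonneg fun t => norm_nonneg _
          have := hh.1.le
          have h2 : h ^ (M + 2) ≤ h ^ M := pow_le_pow_of_le_one this hh.2.le (by omega)
          gcongr
      _ = B * I * ‖h ^ M‖ := by
          rw [norm_pow, Real.norm_of_nonneg hh.1.le]; ring
  simpa using hr.add hb

/-! ### The weight of a potential with integrable derivatives -/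

/-- A function is bounded at a point by the mean of itself and of its derivative over the preceding
unit interval. -/
theorem norm_le_integral_unit {f f' : ℝ → ℂ} (hf : ∀ x, HasDerivAt f (f' x) x)
    (hc : Continuous f') (x : ℝ) : ‖f x‖ ≤ ∫ s in (x - 1)..x, (‖f s‖ + ‖f' s‖) := by
  have hfc : Continuous f := continuous_iff_continuousAt.mpr fun x => (hf x).continuousAt
  have i1 : IntervalIntegrable (fun s => ‖f s‖) volume (x - 1) x := hfc.norm.intervalIntegrable _ _
  have i2 : IntervalIntegrable (fun s => ‖f' s‖) volume (x - 1) x := hc.norm.intervalIntegrable _ _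
  set D := ∫ t in (x - 1)..x, ‖f' t‖ with hD
  have h1 : ∀ s ∈ Set.Icc (x - 1) x, ‖f x‖ ≤ ‖f s‖ + D := by
    intro s hs
    have e : ∫ t in s..x, f' t = f x - f s :=
      intervalIntegral.integral_eq_sub_of_hasDerivAt (fun t _ => hf t) (hc.intervalIntegrable _ _)
    have b1 : ‖f x - f s‖ ≤ ∫ t in s..x, ‖f' t‖ := by
      rw [← e]; exact intervalIntegral.norm_integral_le_integral_norm hs.2
    have b2 : ∫ t in s..x, ‖f' t‖ ≤ D :=
      intervalIntegral.integral_mono_interval hs.1 hs.2 le_rfl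
        (Eventually.of_forall fun t => norm_nonneg _) i2
    have := norm_sub_norm_le (f x) (f s)
    linarith
  have h2 := intervalIntegral.integral_mono_on (by linarith : x - 1 ≤ x)
    (intervalIntegrable_const (c := ‖f x‖)) (i1.add intervalIntegrable_const) h1
  rw [intervalIntegral.integral_const, intervalIntegral.integral_add i1 intervalIntegrable_const,
    intervalIntegral.integral_const] at h2
  rw [intervalIntegral.integral_add i1 i2]
  simpa using h2

/-- The weight is `m x = exp (1 - x) ∫_{-∞}^x (∑_{j ≤ 5} |ψ^(j)|) exp s ds`: an exponential average
of the derivatives over the past, which is comparable with itself at distances `O(1)`. -/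
theorem exists_isWeight {φ : ℝ → ℝ} (hφ : ContDiff ℝ ∞ φ) {p : ℝ}
    (h0 : IntegrableOn (fun x => φ x - p) (Set.Iic 0))
    (hd : ∀ j : ℕ, 1 ≤ j → Integrable (iteratedDeriv j φ)) :
    ∃ m W, IsWeight (fun x => ((φ x - p : ℝ) : ℂ)) m W := by
  have hr : ContDiff ℝ ∞ fun x => φ x - p := hφ.sub contDiff_const
  set ψ : ℝ → ℂ := fun x => ((φ x - p : ℝ) : ℂ) with hψ
  have hs : ContDiff ℝ ∞ ψ := contDiff_ofReal_comp hr
  have hint : ∀ j, IntegrableOn (iteratedDeriv j ψ) (Set.Iic 0) := by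
    intro j
    rw [hψ, iteratedDeriv_ofReal_comp hr]
    rcases Nat.eq_zero_or_pos j with rfl | hj
    · simpa [IntegrableOn] using Integrable.ofReal (𝕜 := ℂ) h0
    · obtain ⟨j, rfl⟩ := Nat.exists_eq_succ_of_ne_zero hj.ne'
      have e : iteratedDeriv (j + 1) (fun x => φ x - p) = iteratedDeriv (j + 1) φ := by
        rw [iteratedDeriv_succ', iteratedDeriv_succ']
        congr 1
        funext x
        rw [deriv_sub_const]
      rw [Nat.succ_eq_add_one, e]
      exact (Integrable.ofReal (𝕜 := ℂ) (hd (j + 1) (by omega))).integrableOn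
  set F : ℝ → ℝ := fun s => ∑ j ∈ Finset.range 6, ‖iteratedDeriv j ψ s‖ with hF
  have hFc : Continuous F :=
    continuous_finsetSum _ fun j _ => (continuous_iteratedDeriv hs j).norm
  have hF0 : ∀ s, 0 ≤ F s := fun s => Finset.sum_nonneg fun j _ => norm_nonneg _
  have hFi : IntegrableOn F (Set.Iic 0) :=
    integrable_finsetSum _ fun j _ => (hint j).norm
  set I := ∫ s in Set.Iic 0, F s with hI
  have hI0 : 0 ≤ I := integral_nonneg fun s => hF0 s
  have hFile : ∀ a x, a ≤ x → x ≤ 0 → ∫ s in a..x, F s ≤ I := by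
    intro a x ha hx
    rw [intervalIntegral.integral_of_le ha]
    exact setIntegral_mono_set hFi (Eventually.of_forall fun s => hF0 s)
      (Eventually.of_forall fun s (hs : s ∈ Set.Ioc a x) => hs.2.trans hx)
  set E : ℝ → ℝ := fun s => F s * Real.exp s with hE
  have hEc : Continuous E := hFc.mul Real.continuous_exp
  have hE0 : ∀ s, 0 ≤ E s := fun s => mul_nonneg (hF0 s) (Real.exp_pos s).le
  have hEi : IntegrableOn E (Set.Iic 0) := by
    refine Integrable.mono' hFi hEc.aestronglyMeasurable ?_
    filter_upwards [ae_restrict_mem measurableSet_Iic] with s hs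
    rw [Real.norm_of_nonneg (hE0 s)]
    have : Real.exp s ≤ 1 := Real.exp_le_one_iff.mpr hs
    exact mul_le_of_le_one_right (hF0 s) this
  have hsub : ∀ x ≤ (0 : ℝ), Set.Iic x ⊆ Set.Iic 0 := fun x hx => Set.Iic_subset_Iic.mpr hx
  set G : ℝ → ℝ := fun x => ∫ s in Set.Iic x, E s with hG
  have hG0 : ∀ x, 0 ≤ G x := fun x => integral_nonneg fun s => hE0 s
  have hGdiff : ∀ a x, a ≤ x → x ≤ 0 → G x - G a = ∫ s in a..x, E s := fun a x ha hx =>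
    intervalIntegral.integral_Iic_sub_Iic (hEi.mono_set (hsub a (ha.trans hx)))
      (hEi.mono_set (hsub x hx))
  have hEle : ∀ a x, a ≤ x → ∫ s in a..x, E s ≤ Real.exp x * ∫ s in a..x, F s := by
    intro a x ha
    rw [← intervalIntegral.integral_const_mul]
    refine intervalIntegral.integral_mono_on ha (hEc.intervalIntegrable _ _)
      ((continuous_const.mul hFc).intervalIntegrable _ _) fun s hs => ?_
    have := Real.exp_le_exp.mpr hs.2
    have := hF0 s
    simp only [hE]
    nlinarith
  have hGmono : ∀ a x, a ≤ x → x ≤ 0 → G a ≤ G x := by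
    intro a x ha hx
    have h1 := hGdiff a x ha hx
    have h2 : 0 ≤ ∫ s in a..x, E s := intervalIntegral.integral_nonneg ha fun s _ => hE0 s
    linarith
  have hGle : ∀ x ≤ 0, G x ≤ Real.exp x * I := by
    intro x hx
    have h1 : G x ≤ ∫ s in Set.Iic x, Real.exp x * F s := by
      refine setIntegral_mono_on (hEi.mono_set (hsub x hx))
        ((hFi.mono_set (hsub x hx)).const_mul _) measurableSet_Iic fun s hs => ?_
      have := Real.exp_le_exp.mpr (show s ≤ x from hs)
      have := hF0 s
      simp only [hE]
      nlinarith
    rw [integral_const_mul] at h1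
    refine h1.trans (mul_le_mul_of_nonneg_left ?_ (Real.exp_pos x).le)
    exact setIntegral_mono_set hFi (Eventually.of_forall fun s => hF0 s)
      (Eventually.of_forall (hsub x hx))
  set m : ℝ → ℝ := fun x => Real.exp (1 - x) * G x with hm
  have hm0 : ∀ x, 0 ≤ m x := fun x => mul_nonneg (Real.exp_pos _).le (hG0 x)
  have hmle : ∀ x ≤ 0, m x ≤ Real.exp 1 * I := by
    intro x hx
    calc m x ≤ Real.exp (1 - x) * (Real.exp x * I) :=
          mul_le_mul_of_nonneg_left (hGle x hx) (Real.exp_pos _).le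
      _ = Real.exp 1 * I := by rw [← mul_assoc, ← Real.exp_add]; congr 2; ring
  have he1 : 1 ≤ Real.exp 1 := Real.one_le_exp (by norm_num)
  have heI : 0 ≤ Real.exp 1 * I := by positivity
  refine ⟨m, 6 * (Real.exp 1 * I), hs, ?_, ?_, ?_, ?_, ?_⟩
  · intro j hj x hx
    have h1 := norm_le_integral_unit (hasDerivAt_iteratedDeriv hs j)
      (continuous_iteratedDeriv hs (j + 1)) x
    have h2 : ∫ s in (x - 1)..x, (‖iteratedDeriv j ψ s‖ + ‖iteratedDeriv (j + 1) ψ s‖)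
        ≤ ∫ s in (x - 1)..x, Real.exp (1 - x) * E s := by
      refine intervalIntegral.integral_mono_on (by linarith)
        ((((continuous_iteratedDeriv hs j).norm.add
          (continuous_iteratedDeriv hs (j + 1)).norm)).intervalIntegrable _ _)
        ((continuous_const.mul hEc).intervalIntegrable _ _) fun s hs => ?_
      have hsum : ‖iteratedDeriv j ψ s‖ + ‖iteratedDeriv (j + 1) ψ s‖ ≤ F s := by
        rw [← Finset.sum_pair (f := fun j => ‖iteratedDeriv j ψ s‖) (by omega : j ≠ j + 1)]
        refine Finset.sum_le_sum_of_subset_of_nonneg ?_ fun _ _ _ => norm_nonneg _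
        intro i hi
        simp only [Finset.mem_insert, Finset.mem_singleton] at hi
        rw [Finset.mem_range]
        omega
      have hge : 1 ≤ Real.exp (1 - x) * Real.exp s := by
        rw [← Real.exp_add]; exact Real.one_le_exp (by linarith [hs.1])
      have := hF0 s
      calc _ ≤ F s := hsum
        _ ≤ (Real.exp (1 - x) * Real.exp s) * F s := le_mul_of_one_le_left this hge
        _ = _ := by simp only [hE]; ring
    rw [intervalIntegral.integral_const_mul, ← hGdiff (x - 1) x (by linarith) hx] at h2
    have h3 : Real.exp (1 - x) * (G x - G (x - 1)) ≤ m x :=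
      mul_le_mul_of_nonneg_left (by linarith [hG0 (x - 1)]) (Real.exp_pos _).le
    exact (h1.trans h2).trans h3
  · intro x hx
    exact (hmle x hx).trans (by linarith)
  · intro s x hsx hx
    calc m s ≤ Real.exp (1 - s) * G x :=
          mul_le_mul_of_nonneg_left (hGmono s x hsx hx) (Real.exp_pos _).le
      _ = _ := by simp only [hm]; rw [← mul_assoc, ← Real.exp_add]; congr 2; ring
  · intro a x ha hx
    have h1 : ∫ t in a..x, ‖ψ t‖ ≤ ∫ t in a..x, F t := by
      refine intervalIntegral.integral_mono_on ha (hs.continuous.norm.intervalIntegrable _ _)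
        (hFc.intervalIntegrable _ _) fun s _ => ?_
      have := Finset.single_le_sum (f := fun j => ‖iteratedDeriv j ψ s‖)
        (fun j _ => norm_nonneg _) (Finset.mem_range.mpr (by norm_num : 0 < 6))
      simpa using this
    have h2 := hFile a x ha hx
    nlinarith
  · intro h hh h1 N n hn
    -- one cell: the gain `exp (-h)` of the exponential average pays for a term of the sum
    have cell : ∀ k < N, h / 2 * m (gridPoint h N (k + 1)) + m (gridPoint h N (k + 1))
        ≤ m (gridPoint h N k)
          + 2 * Real.exp 1 * ∫ s in (gridPoint h N k)..(gridPoint h N (k + 1)), F s := by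
      intro k hk
      have hx := gridPoint_nonpos hh (show k + 1 ≤ N by omega)
      rw [← gridPoint_succ] at hx ⊢
      set x := gridPoint h N k
      have hxx : x ≤ x + h := by linarith
      set J := ∫ s in x..(x + h), F s with hJ
      have hJ0 : 0 ≤ J := intervalIntegral.integral_nonneg hxx fun s _ => hF0 s
      have hg : G (x + h) ≤ G x + Real.exp (x + h) * J := by
        have e1 := hGdiff x (x + h) hxx hx
        have e2 := hEle x (x + h) hxx
        linarith
      have hmx : m (x + h) ≤ Real.exp (-h) * m x + Real.exp 1 * J := by
        calc m (x + h) ≤ Real.exp (1 - (x + h)) * (G x + Real.exp (x + h) * J) :=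
              mul_le_mul_of_nonneg_left hg (Real.exp_pos _).le
          _ = (Real.exp (1 - (x + h))) * G x
              + (Real.exp (1 - (x + h)) * Real.exp (x + h)) * J := by ring
          _ = _ := by
              rw [← Real.exp_add]
              simp only [hm]
              rw [← mul_assoc, ← Real.exp_add]
              congr 3 <;> ring_nf
      have hexp : (1 + h / 2) * Real.exp (-h) ≤ 1 := by
        have h2 := Real.add_one_le_exp h
        rw [Real.exp_neg, ← div_eq_mul_inv, div_le_one (Real.exp_pos h)]
        linarith
      have hmx0 := hm0 x
      calc h / 2 * m (x + h) + m (x + h) = (1 + h / 2) * m (x + h) := by ring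
        _ ≤ (1 + h / 2) * (Real.exp (-h) * m x + Real.exp 1 * J) := by gcongr
        _ = ((1 + h / 2) * Real.exp (-h)) * m x + (1 + h / 2) * (Real.exp 1 * J) := by ring
        _ ≤ 1 * m x + 2 * (Real.exp 1 * J) := by gcongr; linarith
        _ = _ := by ring
    have acc : ∀ n ≤ N, ∑ k ∈ Finset.range n, h / 2 * m (gridPoint h N (k + 1))
        + m (gridPoint h N n) ≤ m (gridPoint h N 0)
          + 2 * Real.exp 1 * ∫ s in (gridPoint h N 0)..(gridPoint h N n), F s := by
      intro n
      induction n with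
      | zero => intro _; simp
      | succ n ih =>
        intro hn
        have a1 := ih (by omega)
        have a2 := cell n (by omega)
        rw [← intervalIntegral.integral_add_adjacent_intervals
          (hFc.intervalIntegrable (gridPoint h N 0) (gridPoint h N n))
          (hFc.intervalIntegrable _ _), Finset.sum_range_succ]
        linarith
    have hmono : gridPoint h N 0 ≤ gridPoint h N n := by
      simp only [gridPoint]
      have : 0 ≤ (n : ℝ) * h := by positivity
      push_cast; linarith
    have b1 := acc n hn
    have b2 := hFile _ _ hmono (gridPoint_nonpos hh hn)
    have b3 := hmle _ (gridPoint_nonpos hh (Nat.zero_le N))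
    have b4 := hm0 (gridPoint h N n)
    have b5 : ∑ k ∈ Finset.range n, h * m (-(N * h) + (k + 1) * h)
        = 2 * ∑ k ∈ Finset.range n, h / 2 * m (gridPoint h N (k + 1)) := by
      rw [Finset.mul_sum]
      refine Finset.sum_congr rfl fun k _ => ?_
      simp only [gridPoint]
      push_cast
      ring
    rw [b5]
    have b6 : 2 * Real.exp 1 * ∫ s in (gridPoint h N 0)..(gridPoint h N n), F s
        ≤ 2 * Real.exp 1 * I := by gcongr
    linarith

/-- A function with an integrable derivative is bounded. -/
theorem exists_bound_of_integrable_deriv {φ : ℝ → ℝ} (hφ : ContDiff ℝ ∞ φ)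
    (hd : Integrable (deriv φ)) : ∃ B, ∀ x, |φ x| ≤ B := by
  refine ⟨|φ 0| + ∫ t, ‖deriv φ t‖, fun x => ?_⟩
  have hc : Continuous (deriv φ) := hφ.continuous_deriv (by exact_mod_cast le_top)
  have e : ∫ t in (0 : ℝ)..x, deriv φ t = φ x - φ 0 :=
    intervalIntegral.integral_deriv_eq_sub
      (fun t _ => (hφ.differentiable (by simp)) t) (hc.intervalIntegrable _ _)
  have b : |φ x - φ 0| ≤ ∫ t, ‖deriv φ t‖ := by
    rw [← e, ← Real.norm_eq_abs]
    refine intervalIntegral.norm_integral_le_integral_norm_uIoc.trans ?_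
    exact setIntegral_le_integral hd.norm (Eventually.of_forall fun t => norm_nonneg _)
  have := abs_sub_abs_le_abs_sub (φ x) (φ 0)
  linarith

/-! ### Reduction to the model problem -/

theorem hasDerivAt_mulVec {n : Type*} [Fintype n] (M : Matrix n n ℂ) {y : ℝ → n → ℂ}
    {y' : n → ℂ} {x : ℝ} (hy : HasDerivAt y y' x) :
    HasDerivAt (fun x => M *ᵥ y x) (M *ᵥ y') x := by
  rw [hasDerivAt_pi] at hy ⊢
  intro i
  simp only [Matrix.mulVec, dotProduct]
  exact HasDerivAt.fun_sum fun j _ => (hy j).const_mul (M i j)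

theorem isUnit_det_eigMatrix {c p : ℝ} {lam : ℂ} (hk : kappa c p lam ≠ 0) :
    IsUnit (eigMatrix c p lam).det := by
  rw [det_eigMatrix]; exact (neg_ne_zero.mpr hk).isUnit

theorem hasDerivAt_rescale {φ : ℝ → ℝ} {c p : ℝ} {lam : ℂ} (hk : kappa c p lam ≠ 0) (mu : ℂ)
    {y : ℝ → Fin 2 → ℂ} {x : ℝ} (hy : HasDerivAt y (evansMatrix φ c lam x *ᵥ y x) x) :
    HasDerivAt (rescale c p lam mu y)
      (rescaledMatrix φ c p lam mu x *ᵥ rescale c p lam mu y x) x := by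
  have hB := isUnit_det_eigMatrix hk
  have h1 : HasDerivAt (fun x : ℝ => Complex.exp (-(mu * (x : ℂ))))
      (Complex.exp (-(mu * (x : ℂ))) * -(mu * 1)) x :=
    (((hasDerivAt_id x).ofReal_comp.const_mul mu).neg).cexp
  refine (h1.smul (hasDerivAt_mulVec (eigMatrix c p lam)⁻¹ hy)).congr_deriv ?_
  simp only [rescale, rescaledMatrix, Matrix.sub_mulVec, Matrix.mulVec_smul, Matrix.smul_mulVec,
    Matrix.one_mulVec, ← Matrix.mulVec_mulVec]
  rw [Matrix.mulVec_mulVec _ (eigMatrix c p lam), Matrix.mul_nonsing_inv _ hB, Matrix.one_mulVec]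
  rw [smul_sub, smul_smul, mul_neg, neg_smul, mul_one, sub_eq_add_neg]

theorem eigMatrix_mulVec_rescale_zero {c p : ℝ} {lam : ℂ} (hk : kappa c p lam ≠ 0) (mu : ℂ)
    (y : ℝ → Fin 2 → ℂ) : eigMatrix c p lam *ᵥ rescale c p lam mu y 0 = y 0 := by
  simp only [rescale, Complex.ofReal_zero, mul_zero, neg_zero, Complex.exp_zero, one_smul]
  rw [Matrix.mulVec_mulVec, Matrix.mul_nonsing_inv _ (isUnit_det_eigMatrix hk), Matrix.one_mulVec]

/-- The potential of the left problem, measured from its limit. -/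
def leftPotential (φ : ℝ → ℝ) (p : ℝ) (x : ℝ) : ℂ := ((φ x - p : ℝ) : ℂ)

/-- The potential of the right problem, measured from its limit and reflected to `(-∞, 0]`. -/
def rightPotential (φ : ℝ → ℝ) (p : ℝ) (x : ℝ) : ℂ := ((φ (-x) - p : ℝ) : ℂ)

theorem leftMatrix_mulVec (φ : ℝ → ℝ) (c p : ℝ) (lam : ℂ) (x : ℝ) (hk : kappa c p lam ≠ 0)
    (w : Fin 2 → ℂ) : leftMatrix φ c p lam x *ᵥ w =
      ![modelCoeff (leftPotential φ p) (kappa c p lam) x * (w 0 + w 1),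
        -kappa c p lam * w 1
          - modelCoeff (leftPotential φ p) (kappa c p lam) x * (w 0 + w 1)] := by
  rw [leftMatrix_eq φ c p lam x hk]
  ext i
  fin_cases i <;>
    simp [Matrix.mulVec, dotProduct, Fin.sum_univ_two, modelCoeff, leftPotential] <;> ring

theorem rightMatrix_mulVec (φ : ℝ → ℝ) (c p : ℝ) (lam : ℂ) (x : ℝ) (hk : kappa c p lam ≠ 0)
    (w : Fin 2 → ℂ) : rightMatrix φ c p lam x *ᵥ w =
      ![-(-kappa c p lam * w 0
          - modelCoeff (rightPotential φ p) (kappa c p lam) (-x) * (w 1 + w 0)),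
        -(modelCoeff (rightPotential φ p) (kappa c p lam) (-x) * (w 1 + w 0))] := by
  rw [rightMatrix_eq φ c p lam x hk]
  ext i
  fin_cases i <;>
    simp [Matrix.mulVec, dotProduct, Fin.sum_univ_two, modelCoeff, rightPotential] <;> ring

theorem IsLeftSolution.modelSolution {φ : ℝ → ℝ} {c p : ℝ} {lam : ℂ} {y : ℝ → Fin 2 → ℂ}
    (H : IsLeftSolution φ c p lam y) (hk : kappa c p lam ≠ 0) :
    ModelSolution (leftPotential φ p) (kappa c p lam) (fun x => leftCoords c p lam y x 0)
      (fun x => leftCoords c p lam y x 1) := by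
  have hd : ∀ x, HasDerivAt (leftCoords c p lam y)
      (leftMatrix φ c p lam x *ᵥ leftCoords c p lam y x) x := fun x =>
    hasDerivAt_rescale hk _ (H.ode x)
  have hl := tendsto_pi_nhds.mp H.normalised
  refine ⟨fun x => ?_, fun x => ?_, by simpa using hl 0, by simpa using hl 1⟩
  · have := hasDerivAt_pi.mp (hd x) 0
    rw [leftMatrix_mulVec φ c p lam x hk] at this
    exact this
  · have := hasDerivAt_pi.mp (hd x) 1
    rw [leftMatrix_mulVec φ c p lam x hk] at this
    refine this.congr_deriv ?_
    simp only [Matrix.cons_val_one, Matrix.cons_val_zero, modelCoeff]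
    ring

theorem IsRightSolution.modelSolution {φ : ℝ → ℝ} {c p : ℝ} {lam : ℂ} {y : ℝ → Fin 2 → ℂ}
    (H : IsRightSolution φ c p lam y) (hk : kappa c p lam ≠ 0) :
    ModelSolution (rightPotential φ p) (kappa c p lam) (fun x => rightCoords c p lam y (-x) 1)
      (fun x => rightCoords c p lam y (-x) 0) := by
  have hd : ∀ x, HasDerivAt (rightCoords c p lam y)
      (rightMatrix φ c p lam x *ᵥ rightCoords c p lam y x) x := fun x =>
    hasDerivAt_rescale hk _ (H.ode x)
  have hl := tendsto_pi_nhds.mp (H.normalised.comp tendsto_neg_atBot_atTop)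
  refine ⟨fun x => ?_, fun x => ?_, by simpa using hl 1, by simpa using hl 0⟩
  · have := hasDerivAt_pi.mp (hd (-x)) 1
    rw [rightMatrix_mulVec φ c p lam _ hk] at this
    refine (this.scomp x (hasDerivAt_neg x)).congr_deriv ?_
    simp [modelCoeff]
  · have := hasDerivAt_pi.mp (hd (-x)) 0
    rw [rightMatrix_mulVec φ c p lam _ hk] at this
    refine (this.scomp x (hasDerivAt_neg x)).congr_deriv ?_
    simp [modelCoeff]
    ring

/-- The slopes of a step on the left are the right-hand sides of the model problem at the stage
values. -/
theorem isGL4Step_leftMatrix_iff {φ : ℝ → ℝ} {c p : ℝ} {lam : ℂ} (hk : kappa c p lam ≠ 0)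
    {h x : ℝ} {a b : Fin 2 → ℂ} : IsGL4Step (leftMatrix φ c p lam) h x a b ↔
      IsModelStep (leftPotential φ p) (kappa c p lam) h x (a 0) (a 1) (b 0) (b 1) := by
  constructor
  · rintro ⟨s₁, s₂, h1, h2, h3⟩
    obtain ⟨w₁, hw₁⟩ : ∃ w, w = a + ((1 / 4) * h) • s₁ + ((1 / 4 - √3 / 6) * h) • s₂ := ⟨_, rfl⟩
    obtain ⟨w₂, hw₂⟩ : ∃ w, w = a + ((1 / 4 + √3 / 6) * h) • s₁ + ((1 / 4) * h) • s₂ := ⟨_, rfl⟩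
    rw [leftMatrix_mulVec φ c p lam _ hk, ← hw₁] at h1
    rw [leftMatrix_mulVec φ c p lam _ hk, ← hw₂] at h2
    have h10 := congrFun h1 0
    have h11 := congrFun h1 1
    have h20 := congrFun h2 0
    have h21 := congrFun h2 1
    simp only [Matrix.cons_val_zero, Matrix.cons_val_one] at h10 h11 h20 h21
    refine ⟨w₁ 0, w₂ 0, w₁ 1, w₂ 1, _, _, rfl, rfl, ?_, ?_, ?_, ?_, ?_, ?_⟩ <;>
      simp only [gaussOffset] <;> first | rw [← h11, ← h21] | rw [← h10, ← h20]
    · rw [hw₁]; simp; ring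
    · rw [hw₂]; simp; ring
    · rw [hw₁]; simp; ring
    · rw [hw₂]; simp; ring
    · rw [h3]; simp; ring
    · rw [h3]; simp; ring
  · rintro ⟨U₁, U₂, V₁, V₂, g₁, g₂, hg1, hg2, h1, h2, h3, h4, h5, h6⟩
    have e1 : a + ((1 / 4) * h) • ![g₁ * (U₁ + V₁), -kappa c p lam * V₁ - g₁ * (U₁ + V₁)]
        + ((1 / 4 - √3 / 6) * h) • ![g₂ * (U₂ + V₂), -kappa c p lam * V₂ - g₂ * (U₂ + V₂)]
        = ![U₁, V₁] := by
      ext i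
      fin_cases i
      · simp [gaussOffset, Matrix.vecHead, Matrix.vecTail] at h1 ⊢; linear_combination -h1
      · simp [gaussOffset, Matrix.vecHead, Matrix.vecTail] at h3 ⊢; linear_combination -h3
    have e2 : a + ((1 / 4 + √3 / 6) * h)
          • ![g₁ * (U₁ + V₁), -kappa c p lam * V₁ - g₁ * (U₁ + V₁)]
        + ((1 / 4) * h) • ![g₂ * (U₂ + V₂), -kappa c p lam * V₂ - g₂ * (U₂ + V₂)]
        = ![U₂, V₂] := by
      ext i
      fin_cases i
      · simp [gaussOffset, Matrix.vecHead, Matrix.vecTail] at h2 ⊢; linear_combination -h2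
      · simp [gaussOffset, Matrix.vecHead, Matrix.vecTail] at h4 ⊢; linear_combination -h4
    refine ⟨![g₁ * (U₁ + V₁), -kappa c p lam * V₁ - g₁ * (U₁ + V₁)],
      ![g₂ * (U₂ + V₂), -kappa c p lam * V₂ - g₂ * (U₂ + V₂)], ?_, ?_, ?_⟩
    · rw [e1, leftMatrix_mulVec φ c p lam _ hk, hg1]; rfl
    · rw [e2, leftMatrix_mulVec φ c p lam _ hk, hg2]; rfl
    · ext i
      fin_cases i
      · simp [h5]; ring
      · simp [h6]; ring

/-- The right problem is the reflection of the model problem, with the components swapped. -/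
theorem isGL4Step_rightMatrix_iff {φ : ℝ → ℝ} {c p : ℝ} {lam : ℂ} (hk : kappa c p lam ≠ 0)
    {h x : ℝ} {a b : Fin 2 → ℂ} : IsGL4Step (rightMatrix φ c p lam) (-h) x a b ↔
      IsModelStep (rightPotential φ p) (kappa c p lam) h (-x) (a 1) (a 0) (b 1) (b 0) := by
  have n1 : -(x + (1 / 2 - √3 / 6) * -h) = -x + (1 / 2 - gaussOffset) * h := by
    simp only [gaussOffset]; ring
  have n2 : -(x + (1 / 2 + √3 / 6) * -h) = -x + (1 / 2 + gaussOffset) * h := by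
    simp only [gaussOffset]; ring
  constructor
  · rintro ⟨s₁, s₂, h1, h2, h3⟩
    obtain ⟨w₁, hw₁⟩ : ∃ w, w = a + ((1 / 4) * -h) • s₁ + ((1 / 4 - √3 / 6) * -h) • s₂ := ⟨_, rfl⟩
    obtain ⟨w₂, hw₂⟩ : ∃ w, w = a + ((1 / 4 + √3 / 6) * -h) • s₁ + ((1 / 4) * -h) • s₂ := ⟨_, rfl⟩
    rw [rightMatrix_mulVec φ c p lam _ hk, ← hw₁, n1] at h1
    rw [rightMatrix_mulVec φ c p lam _ hk, ← hw₂, n2] at h2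
    have h10 := congrFun h1 0
    have h11 := congrFun h1 1
    have h20 := congrFun h2 0
    have h21 := congrFun h2 1
    simp only [Matrix.cons_val_zero, Matrix.cons_val_one] at h10 h11 h20 h21
    rw [eq_comm, neg_eq_iff_eq_neg] at h10 h11 h20 h21
    refine ⟨w₁ 1, w₂ 1, w₁ 0, w₂ 0, _, _, rfl, rfl, ?_, ?_, ?_, ?_, ?_, ?_⟩ <;>
      first | rw [h10, h20] | rw [h11, h21]
    · rw [hw₁]; simp [gaussOffset]; ring
    · rw [hw₂]; simp [gaussOffset]; ring
    · rw [hw₁]; simp [gaussOffset]; ring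
    · rw [hw₂]; simp [gaussOffset]; ring
    · rw [h3]; simp; ring
    · rw [h3]; simp; ring
  · rintro ⟨U₁, U₂, V₁, V₂, g₁, g₂, hg1, hg2, h1, h2, h3, h4, h5, h6⟩
    have e1 : a + ((1 / 4) * -h) • ![-(-kappa c p lam * V₁ - g₁ * (U₁ + V₁)), -(g₁ * (U₁ + V₁))]
        + ((1 / 4 - √3 / 6) * -h)
          • ![-(-kappa c p lam * V₂ - g₂ * (U₂ + V₂)), -(g₂ * (U₂ + V₂))] = ![V₁, U₁] := by
      ext i
      fin_cases i
      · simp [gaussOffset, Matrix.vecHead, Matrix.vecTail] at h3 ⊢; linear_combination -h3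
      · simp [gaussOffset, Matrix.vecHead, Matrix.vecTail] at h1 ⊢; linear_combination -h1
    have e2 : a + ((1 / 4 + √3 / 6) * -h)
          • ![-(-kappa c p lam * V₁ - g₁ * (U₁ + V₁)), -(g₁ * (U₁ + V₁))]
        + ((1 / 4) * -h) • ![-(-kappa c p lam * V₂ - g₂ * (U₂ + V₂)), -(g₂ * (U₂ + V₂))]
        = ![V₂, U₂] := by
      ext i
      fin_cases i
      · simp [gaussOffset, Matrix.vecHead, Matrix.vecTail] at h4 ⊢; linear_combination -h4
      · simp [gaussOffset, Matrix.vecHead, Matrix.vecTail] at h2 ⊢; linear_combination -h2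
    refine ⟨![-(-kappa c p lam * V₁ - g₁ * (U₁ + V₁)), -(g₁ * (U₁ + V₁))],
      ![-(-kappa c p lam * V₂ - g₂ * (U₂ + V₂)), -(g₂ * (U₂ + V₂))], ?_, ?_, ?_⟩
    · rw [e1, rightMatrix_mulVec φ c p lam _ hk, n1, hg1]; rfl
    · rw [e2, rightMatrix_mulVec φ c p lam _ hk, n2, hg2]; rfl
    · ext i
      fin_cases i
      · simp [h6]; ring
      · simp [h5]; ring

/-- The linear system for the stages has only the trivial solution for zero data, which is the
case of vanishing errors and defects in the bound for the stage errors. -/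
theorem existsUnique_isModelStep {ψ : ℝ → ℂ} {κ : ℂ} {h B : ℝ} (hh : 0 < h) (hq : 60 ≤ h * ‖κ‖)
    (hB : ∀ x, ‖modelCoeff ψ κ x‖ ≤ B) (hhB : h * B ≤ 1 / 16) (x : ℝ) (a b : ℂ) :
    (∃ a' b', IsModelStep ψ κ h x a b a' b') ∧
      ∀ a₁ b₁ a₂ b₂, IsModelStep ψ κ h x a b a₁ b₁ → IsModelStep ψ κ h x a b a₂ b₂ →
        a₁ = a₂ ∧ b₁ = b₂ := by
  set g₁ := modelCoeff ψ κ (x + (1 / 2 - gaussOffset) * h) with hg1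
  set g₂ := modelCoeff ψ κ (x + (1 / 2 + gaussOffset) * h) with hg2
  have triv : ∀ U₁ U₂ V₁ V₂ : ℂ,
      U₁ = h * (1 / 4 * (g₁ * (U₁ + V₁)) + (1 / 4 - gaussOffset) * (g₂ * (U₂ + V₂))) →
      U₂ = h * ((1 / 4 + gaussOffset) * (g₁ * (U₁ + V₁)) + 1 / 4 * (g₂ * (U₂ + V₂))) →
      V₁ = h * (1 / 4 * (-κ * V₁ - g₁ * (U₁ + V₁))
        + (1 / 4 - gaussOffset) * (-κ * V₂ - g₂ * (U₂ + V₂))) →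
      V₂ = h * ((1 / 4 + gaussOffset) * (-κ * V₁ - g₁ * (U₁ + V₁))
        + 1 / 4 * (-κ * V₂ - g₂ * (U₂ + V₂))) →
      U₁ = 0 ∧ U₂ = 0 ∧ V₁ = 0 ∧ V₂ = 0 := by
    intro U₁ U₂ V₁ V₂ h1 h2 h3 h4
    have S : StepErrors κ h g₁ g₂ 0 0 0 0 0 0 0 0 U₁ U₂ V₁ V₂
        (h / 2 * (g₁ * (U₁ + V₁) + g₂ * (U₂ + V₂)))
        (h / 2 * ((-κ * V₁ - g₁ * (U₁ + V₁)) + (-κ * V₂ - g₂ * (U₂ + V₂)))) := by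
      constructor <;> simp only [zero_add, sub_zero]
      exacts [h1, h2, h3, h4]
    obtain ⟨s1, s2⟩ := S.norm_stage_le hh hq (hB _) (hB _) hhB (dU := 0) (dV := 0)
      (by simp) (by simp) (by simp) (by simp)
    simp only [norm_zero, add_zero, mul_zero] at s1 s2
    have s1 := norm_le_zero_iff.mp s1
    have s2 := norm_le_zero_iff.mp s2
    rw [s1, s2] at h1 h2
    simp only [mul_zero, add_zero] at h1 h2
    rw [h1, zero_add] at s1
    rw [h2, zero_add] at s2
    exact ⟨h1, h2, s1, s2⟩
  constructor
  · let T : (ℂ × ℂ × ℂ × ℂ) →ₗ[ℂ] (ℂ × ℂ × ℂ × ℂ) :=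
      { toFun := fun w =>
          (w.1 - h * (1 / 4 * (g₁ * (w.1 + w.2.2.1))
              + (1 / 4 - gaussOffset) * (g₂ * (w.2.1 + w.2.2.2))),
            w.2.1 - h * ((1 / 4 + gaussOffset) * (g₁ * (w.1 + w.2.2.1))
              + 1 / 4 * (g₂ * (w.2.1 + w.2.2.2))),
            w.2.2.1 - h * (1 / 4 * (-κ * w.2.2.1 - g₁ * (w.1 + w.2.2.1))
              + (1 / 4 - gaussOffset) * (-κ * w.2.2.2 - g₂ * (w.2.1 + w.2.2.2))),
            w.2.2.2 - h * ((1 / 4 + gaussOffset) * (-κ * w.2.2.1 - g₁ * (w.1 + w.2.2.1))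
              + 1 / 4 * (-κ * w.2.2.2 - g₂ * (w.2.1 + w.2.2.2))))
        map_add' := fun w w' => by
          ext <;> simp only [Prod.fst_add, Prod.snd_add, Prod.mk_add_mk] <;> ring
        map_smul' := fun r w => by
          ext <;> simp only [Prod.smul_fst, Prod.smul_snd, Prod.smul_mk, smul_eq_mul,
            RingHom.id_apply] <;> ring }
    have hinj : Function.Injective T := by
      rw [← LinearMap.ker_eq_bot, LinearMap.ker_eq_bot']
      rintro ⟨U₁, U₂, V₁, V₂⟩ hw
      have e1 := congrArg Prod.fst hw
      have e2 := congrArg (fun w => w.2.1) hw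
      have e3 := congrArg (fun w => w.2.2.1) hw
      have e4 := congrArg (fun w => w.2.2.2) hw
      obtain ⟨r1, r2, r3, r4⟩ := triv U₁ U₂ V₁ V₂ (sub_eq_zero.mp e1) (sub_eq_zero.mp e2)
        (sub_eq_zero.mp e3) (sub_eq_zero.mp e4)
      rw [r1, r2, r3, r4]; rfl
    obtain ⟨⟨U₁, U₂, V₁, V₂⟩, hw⟩ := LinearMap.injective_iff_surjective.mp hinj (a, a, b, b)
    have e1 := congrArg Prod.fst hw
    have e2 := congrArg (fun w => w.2.1) hw
    have e3 := congrArg (fun w => w.2.2.1) hw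
    have e4 := congrArg (fun w => w.2.2.2) hw
    exact ⟨_, _, U₁, U₂, V₁, V₂, g₁, g₂, hg1, hg2, sub_eq_iff_eq_add.mp e1,
      sub_eq_iff_eq_add.mp e2, sub_eq_iff_eq_add.mp e3, sub_eq_iff_eq_add.mp e4, rfl, rfl⟩
  · rintro a₁ b₁ a₂ b₂ ⟨U₁, U₂, V₁, V₂, _, _, rfl, rfl, h1, h2, h3, h4, h5, h6⟩
      ⟨U₁', U₂', V₁', V₂', _, _, rfl, rfl, k1, k2, k3, k4, k5, k6⟩
    obtain ⟨r1, r2, r3, r4⟩ := triv (U₁ - U₁') (U₂ - U₂') (V₁ - V₁') (V₂ - V₂')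
      (by linear_combination h1 - k1) (by linear_combination h2 - k2)
      (by linear_combination h3 - k3) (by linear_combination h4 - k4)
    rw [h5, h6, k5, k6, sub_eq_zero.mp r1, sub_eq_zero.mp r2, sub_eq_zero.mp r3, sub_eq_zero.mp r4]
    exact ⟨rfl, rfl⟩

/-! ### Asymptotics of the spatial eigenvalues -/

theorem kappa_re_nonneg (c p : ℝ) (lam : ℂ) : 0 ≤ (kappa c p lam).re := by
  rw [kappa]
  generalize (c : ℂ) ^ 2 + 4 * (lam - (p : ℂ)) = z
  rcases eq_or_ne z 0 with rfl | hz
  · rw [Complex.zero_cpow (by norm_num)]; simp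
  · rw [Complex.cpow_def_of_ne_zero hz, Complex.exp_re]
    refine mul_nonneg (Real.exp_pos _).le (Real.cos_nonneg_of_mem_Icc ?_)
    have e : (Complex.log z * (1 / 2 : ℂ)).im = z.arg / 2 := by
      rw [show (1 / 2 : ℂ) = ((1 / 2 : ℝ) : ℂ) by push_cast; rfl, Complex.im_mul_ofReal,
        Complex.log_im]
      ring
    rw [e]
    have := Complex.neg_pi_lt_arg z
    have := Complex.arg_le_pi z
    constructor <;> linarith

/-- Away from the negative real axis, the square root `κ` stays away from the imaginary axis. -/
theorem exists_kappa_bounds (c p : ℝ) {ε : ℝ} (hε : 0 < ε) : ∃ c₀ > 0, ∃ R : ℝ, ∀ lam : ℂ,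
    |lam.arg| < Real.pi - ε → R ≤ ‖lam‖ →
      √‖lam‖ ≤ ‖kappa c p lam‖ ∧ ‖kappa c p lam‖ ≤ 3 * √‖lam‖ ∧
        c₀ * ‖kappa c p lam‖ ≤ (kappa c p lam).re := by
  rcases le_or_gt Real.pi ε with hπ | hπ
  · exact ⟨1, one_pos, 0, fun lam ha _ => absurd (abs_nonneg lam.arg) (by linarith)⟩
  set δ := 1 - Real.cos ε with hδ
  have hδ0 : 0 < δ := by
    have := Real.cos_lt_cos_of_nonneg_of_le_pi le_rfl hπ.le hε
    rw [Real.cos_zero] at this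
    linarith
  have hδ2 : δ ≤ 2 := by linarith [Real.neg_one_le_cos ε]
  set d : ℝ := c ^ 2 - 4 * p with hd
  refine ⟨δ / 9, by positivity, |d| + |d| / δ, fun lam ha hR => ?_⟩
  have h1 : 0 ≤ |d| / δ := by positivity
  have hl1 : |d| ≤ ‖lam‖ := by linarith
  have hl2 : |d| ≤ δ * ‖lam‖ := by
    have : |d| / δ ≤ ‖lam‖ := by linarith [abs_nonneg d]
    rw [div_le_iff₀ hδ0] at this
    linarith
  set κ := kappa c p lam with hκ
  have hsq : κ ^ 2 = 4 * lam + (d : ℂ) := by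
    rw [hκ, kappa_sq, hd]; push_cast; ring
  have hn : ‖κ‖ ^ 2 = ‖4 * lam + (d : ℂ)‖ := by rw [← hsq, norm_pow]
  have e4 : ‖4 * lam‖ = 4 * ‖lam‖ := by rw [norm_mul]; norm_num
  have ed : ‖(d : ℂ)‖ = |d| := by rw [Complex.norm_real, Real.norm_eq_abs]
  have up : ‖κ‖ ^ 2 ≤ 9 * ‖lam‖ := by
    have := norm_add_le (4 * lam) (d : ℂ)
    linarith [norm_nonneg lam]
  have low : 4 * ‖lam‖ - |d| ≤ ‖κ‖ ^ 2 := by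
    have := norm_sub_norm_le (4 * lam) (-(d : ℂ))
    rw [norm_neg, sub_neg_eq_add] at this
    linarith
  have hs := Real.sq_sqrt (norm_nonneg lam)
  have hs0 := Real.sqrt_nonneg ‖lam‖
  have hcos : -(1 - δ) * ‖lam‖ ≤ lam.re := by
    have e : lam.re = ‖lam‖ * Real.cos |lam.arg| := by
      rw [Real.cos_abs, Complex.norm_mul_cos_arg]
    have : Real.cos (Real.pi - ε) ≤ Real.cos |lam.arg| :=
      Real.cos_le_cos_of_nonneg_of_le_pi (abs_nonneg _) (by linarith) ha.le
    rw [Real.cos_pi_sub] at this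
    rw [e, show -(1 - δ) = -Real.cos ε by rw [hδ]; ring]
    nlinarith [norm_nonneg lam]
  have hre : κ.re ^ 2 - κ.im ^ 2 = 4 * lam.re + d := by
    have := congrArg Complex.re hsq
    simp only [pow_two, Complex.mul_re, Complex.add_re, Complex.ofReal_re] at this
    norm_num at this
    linarith
  have hnorm : ‖κ‖ ^ 2 = κ.re ^ 2 + κ.im ^ 2 := by
    rw [← Complex.normSq_eq_norm_sq, Complex.normSq_apply]; ring
  refine ⟨le_of_sq_le_sq (by linarith [norm_nonneg lam]) (norm_nonneg _),
    le_of_sq_le_sq (by rw [mul_pow, hs]; linarith) (by positivity),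
    le_of_sq_le_sq ?_ (kappa_re_nonneg c p lam)⟩
  have k1 : (δ / 9 * ‖κ‖) ^ 2 ≤ δ / 9 * ‖κ‖ ^ 2 := by
    rw [mul_pow]
    have : (δ / 9) ^ 2 ≤ δ / 9 := by nlinarith
    gcongr
  have k2 : δ / 9 * ‖κ‖ ^ 2 ≤ δ * ‖lam‖ := by nlinarith
  have k3 := neg_abs_le d
  linarith

/-- The difference of the squares of the two roots does not depend on `lam`, so the roots differ by
`O(|lam|^(-1/2))`. -/
theorem norm_kappa_sub_le {c p p' c₀ : ℝ} {lam : ℂ} (hc : 0 < c₀) (hl : 0 < ‖lam‖)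
    (h1 : √‖lam‖ ≤ ‖kappa c p lam‖) (h2 : c₀ * ‖kappa c p lam‖ ≤ (kappa c p lam).re) :
    ‖kappa c p' lam - kappa c p lam‖ ≤ 4 * |p - p'| / c₀ * (1 / √‖lam‖) := by
  have hs : 0 < √‖lam‖ := Real.sqrt_pos.mpr hl
  have e : (kappa c p' lam - kappa c p lam) * (kappa c p' lam + kappa c p lam)
      = 4 * ((p - p' : ℝ) : ℂ) := by
    have a := kappa_sq c p lam
    have b := kappa_sq c p' lam
    push_cast
    linear_combination b - a
  have hn : ‖kappa c p' lam - kappa c p lam‖ * ‖kappa c p' lam + kappa c p lam‖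
      = 4 * |p - p'| := by
    rw [← norm_mul, e, norm_mul, Complex.norm_real, Real.norm_eq_abs]; norm_num
  have hlow : c₀ * √‖lam‖ ≤ ‖kappa c p' lam + kappa c p lam‖ := by
    have a := Complex.re_le_norm (kappa c p' lam + kappa c p lam)
    rw [Complex.add_re] at a
    have b := kappa_re_nonneg c p' lam
    nlinarith
  rw [div_mul_div_comm, le_div_iff₀ (by positivity), mul_one, ← hn]
  exact mul_le_mul_of_nonneg_left hlow (norm_nonneg _)

/-! ### The accumulated quadrature errors of the two half-lines -/

theorem gaussDefect_const (a : ℂ) (x h : ℝ) : gaussDefect (fun _ => a) x h = 0 := by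
  simpa using gaussDefect_cubic a 0 0 0 x h

theorem gaussDefect_comp_neg (f : ℝ → ℂ) (x h : ℝ) :
    gaussDefect (fun t => f (-t)) x h = gaussDefect f (-x - h) h := by
  simp only [gaussDefect]
  rw [intervalIntegral.integral_comp_neg, show -(x + h) = -x - h by ring,
    show -x - h + h = -x by ring,
    show -x - h + (1 / 2 - gaussOffset) * h = -(x + (1 / 2 + gaussOffset) * h) by ring,
    show -x - h + (1 / 2 + gaussOffset) * h = -(x + (1 / 2 - gaussOffset) * h) by ring]
  ring

theorem mul_gaussDefect_modelCoeff (ψ : ℝ → ℂ) {κ : ℂ} (hκ : κ ≠ 0) (x h : ℝ) :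
    κ * gaussDefect (modelCoeff ψ κ) x h = -gaussDefect ψ x h := by
  have e : modelCoeff ψ κ = fun t => -κ⁻¹ * ψ t := by
    funext t; rw [modelCoeff]; ring
  rw [e, gaussDefect_const_mul]
  field_simp

/-- The quadrature errors accumulated by the two integrations add up to that for `∫ φ`. -/
theorem quadratureDefect_eq_add {φ : ℝ → ℝ} (hφ : Continuous φ) (pm pp h : ℝ) (N : ℕ) :
    (quadratureDefect φ h N : ℂ)
      = ∑ j ∈ Finset.range N, gaussDefect (leftPotential φ pm) (gridPoint h N j) h
        + ∑ j ∈ Finset.range N, gaussDefect (rightPotential φ pp) (gridPoint h N j) h := by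
  have hc : Continuous fun x => (φ x : ℂ) := Complex.continuous_ofReal.comp hφ
  have e1 : ∀ x, gaussDefect (leftPotential φ pm) x h = gaussDefect (fun x => (φ x : ℂ)) x h := by
    intro x
    have : leftPotential φ pm = fun x => (φ x : ℂ) - (pm : ℂ) := by
      funext t; simp [leftPotential]
    rw [this, gaussDefect_sub hc continuous_const, gaussDefect_const, sub_zero]
  have e2 : ∀ x, gaussDefect (rightPotential φ pp) x h
      = gaussDefect (fun x => (φ x : ℂ)) (-x - h) h := by
    intro x
    have : rightPotential φ pp = fun x => (φ (-x) : ℂ) - (pp : ℂ) := by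
      funext t; simp [rightPotential]
    have hcn : Continuous fun x => (φ (-x) : ℂ) := hc.comp continuous_neg
    rw [this, gaussDefect_sub hcn continuous_const, gaussDefect_const,
      sub_zero]
    exact gaussDefect_comp_neg (fun x => (φ x : ℂ)) x h
  rw [quadratureDefect_eq_sum hφ, two_mul, Finset.sum_range_add]
  congr 1
  · exact Finset.sum_congr rfl fun j _ => (e1 _).symm
  · rw [← Finset.sum_range_reflect]
    refine Finset.sum_congr rfl fun j hj => ?_
    rw [e2]
    congr 1
    have hj := Finset.mem_range.mp hj
    simp only [gridPoint]
    rw [Nat.sub_sub]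
    push_cast [Nat.cast_sub (show 1 + j ≤ N by omega)]
    ring

/-! ### The error in the Evans function -/

/-- The Evans function in rescaled coordinates. Its leading part is `-κ` times the product of the
nonstiff components; the nonstiff-stiff products have the small factor `κ₊ - κ₋`. -/
theorem wedge_eigMatrix (c pm pp : ℝ) (lam : ℂ) (z zp : Fin 2 → ℂ) :
    wedge (eigMatrix c pm lam *ᵥ z) (eigMatrix c pp lam *ᵥ zp) =
      -((kappa c pp lam + kappa c pm lam) / 2) * (z 0 * zp 1)
        + (kappa c pp lam + kappa c pm lam) / 2 * (z 1 * zp 0)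
        + (kappa c pp lam - kappa c pm lam) / 2 * (z 0 * zp 0 - z 1 * zp 1) := by
  simp [wedge, eigMatrix, muOne, muTwo, Matrix.mulVec, dotProduct, Fin.sum_univ_two,
    Matrix.det_fin_two_of]
  ring

/-- The data of one half-line that enter the estimate of the error in the Evans function: the
exact values `u, v` at `0`, the numerical ones `a, b`, and the accumulated quadrature error `S` of
`-ψ / κ`. Powers of `X` count negative powers of `|lam|^(1/2)`. -/
structure EndpointData (C h X : ℝ) (κ u v a b S : ℂ) : Prop where
  norm_kappa : ‖κ‖ * X ≤ C
  u_sub : ‖u - 1‖ ≤ C * X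
  v_le : ‖v‖ ≤ C * X ^ 2
  a_sub : ‖a - u‖ ≤ C * (h ^ 4 * X)
  b_sub : ‖b - v‖ ≤ C * (h ^ 2 * X ^ 2)
  quad : ‖S‖ ≤ C * (h ^ 4 * X)
  fine : ‖a - u - u * S‖ ≤ C * (X * (h ^ 8 * X + h ^ 4 * X ^ 2 + h ^ 2 * X ^ 3))

theorem EndpointData.mono {C C' h X : ℝ} {κ u v a b S : ℂ} (H : EndpointData C h X κ u v a b S)
    (hC : C ≤ C') (hX : 0 ≤ X) : EndpointData C' h X κ u v a b S where
  norm_kappa := H.norm_kappa.trans hC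
  u_sub := H.u_sub.trans (by gcongr)
  v_le := H.v_le.trans (by gcongr)
  a_sub := H.a_sub.trans (by gcongr)
  b_sub := H.b_sub.trans (by gcongr)
  quad := H.quad.trans (by gcongr)
  fine := H.fine.trans (by gcongr)

set_option maxHeartbeats 1000000 in
/-- The leading part `S + S₊` of the relative error, multiplied by the leading part `-κ` of the
Evans function, is the quadrature error `q`; everything else is small. -/
theorem norm_evans_remainder_le {C h X : ℝ} (hC : 1 ≤ C) (hh : 0 < h) (h1 : h ≤ 1) (hX : 0 ≤ X)
    (hX1 : X ≤ 1) {κ κp u v a b S up vp ap bp Sp q : ℂ} (L : EndpointData C h X κ u v a b S)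
    (R : EndpointData C h X κp up vp ap bp Sp) (hd : ‖κp - κ‖ ≤ C * X)
    (hq : κ * S + κp * Sp = -q) (hqn : ‖q‖ ≤ C * h ^ 8) :
    ‖(-((κp + κ) / 2) * (a * ap) + (κp + κ) / 2 * (b * bp) + (κp - κ) / 2 * (a * bp - b * ap))
      - (-((κp + κ) / 2) * (u * up) + (κp + κ) / 2 * (v * vp) + (κp - κ) / 2 * (u * vp - v * up))
      - q‖ ≤ 100 * C ^ 5 * (h ^ 8 * X + h ^ 4 * X ^ 2 + h ^ 2 * X ^ 3) := by
  have hC0 : 0 ≤ C := by linarith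
  set k : ℂ := (κp + κ) / 2 with hk
  set d : ℂ := (κp - κ) / 2 with hd2
  set E : ℝ := h ^ 8 * X + h ^ 4 * X ^ 2 + h ^ 2 * X ^ 3 with hE
  have hkn : ‖k‖ * X ≤ C := by
    have : ‖k‖ ≤ (‖κp‖ + ‖κ‖) / 2 := by
      rw [hk, norm_div, show ‖(2 : ℂ)‖ = 2 by norm_num]
      have := norm_add_le κp κ
      linarith
    have := mul_le_mul_of_nonneg_right this hX
    linarith [L.norm_kappa, R.norm_kappa]
  have hdn : ‖d‖ ≤ C * X := by
    rw [hd2, norm_div, show ‖(2 : ℂ)‖ = 2 by norm_num]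
    linarith [norm_nonneg (κp - κ)]
  have size : ∀ {κ u v a b S : ℂ}, EndpointData C h X κ u v a b S →
      ‖u‖ ≤ 2 * C ∧ ‖a‖ ≤ 3 * C ∧ ‖b‖ ≤ 2 * C * X ^ 2 ∧ ‖a - u‖ ≤ C * h ^ 2 := by
    intro κ u v a b S D
    have i1 : ‖u‖ ≤ 2 * C := by
      have := norm_sub_norm_le u 1
      rw [norm_one] at this
      nlinarith [D.u_sub]
    have i2 : ‖a - u‖ ≤ C * h ^ 2 := by
      refine D.a_sub.trans ?_
      have e : h ^ 4 * X ≤ h ^ 2 * 1 :=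
        mul_le_mul (pow_le_pow_of_le_one hh.le h1 (by norm_num)) hX1 hX (by positivity)
      nlinarith
    refine ⟨i1, ?_, ?_, i2⟩
    · have e : h ^ 2 ≤ 1 := pow_le_one₀ hh.le h1
      have := norm_sub_norm_le a u
      nlinarith
    · have e : h ^ 2 * X ^ 2 ≤ 1 * X ^ 2 := by gcongr; exact pow_le_one₀ hh.le h1
      have := norm_sub_norm_le b v
      nlinarith [D.b_sub, D.v_le]
  obtain ⟨u1, a1, b1, s1⟩ := size L
  obtain ⟨u2, a2, b2, s2⟩ := size R
  have t1 : h ^ 8 * X ≤ E := by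
    have : 0 ≤ h ^ 4 * X ^ 2 + h ^ 2 * X ^ 3 := by positivity
    linarith
  have t2 : h ^ 4 * X ^ 2 ≤ E := by
    have : 0 ≤ h ^ 8 * X + h ^ 2 * X ^ 3 := by positivity
    linarith
  have t3 : h ^ 2 * X ^ 3 ≤ E := by
    have : 0 ≤ h ^ 8 * X + h ^ 4 * X ^ 2 := by positivity
    linarith
  have hE0 : 0 ≤ E := by positivity
  have pow45 : C ^ 4 ≤ C ^ 5 := pow_le_pow_right₀ hC (by norm_num)
  have pow35 : C ^ 3 ≤ C ^ 5 := pow_le_pow_right₀ hC (by norm_num)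
  have qe : ‖q‖ ≤ C * h ^ 8 := hqn
  have S1 := L.quad
  have S2 := R.quad
  have D1 := L.fine
  have D2 := R.fine
  rw [← hE] at D1 D2
  set D := a - u - u * S with hD
  set Dp := ap - up - up * Sp with hDp
  have ea : a = u + u * S + D := by rw [hD]; ring
  have eap : ap = up + up * Sp + Dp := by rw [hDp]; ring
  have v1 := L.v_le
  have v2 := R.v_le
  have w1 := L.b_sub
  have w2 := R.b_sub
  have key : (-k * (a * ap) + k * (b * bp) + d * (a * bp - b * ap))
      - (-k * (u * up) + k * (v * vp) + d * (u * vp - v * up)) - q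
      = -(k * D * ap) - k * (a - D) * Dp - k * (u * up) * (S * Sp)
        + (u * (up - 1) + (u - 1)) * q + u * up * d * (Sp - S)
        + k * ((b - v) * bp + v * (bp - vp))
        + d * (((a - u) * bp + u * (bp - vp)) - ((b - v) * ap + v * (ap - up))) := by
    have hκ : k - d = κ := by rw [hk, hd2]; ring
    have hκp : k + d = κp := by rw [hk, hd2]; ring
    rw [← hκ, ← hκp] at hq
    rw [hD, hDp]
    linear_combination (-u * up) * hq
  clear_value k d E D Dp
  have r1 : ‖k * D * ap‖ ≤ 3 * C ^ 5 * E := by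
    rw [norm_mul, norm_mul]
    calc ‖k‖ * ‖D‖ * ‖ap‖ ≤ ‖k‖ * (C * (X * E)) * (3 * C) := by gcongr
      _ = (‖k‖ * X) * (3 * C ^ 2 * E) := by ring
      _ ≤ C * (3 * C ^ 2 * E) := by gcongr
      _ = 3 * C ^ 3 * E := by ring
      _ ≤ _ := by gcongr
  have r2 : ‖k * (a - D) * Dp‖ ≤ 4 * C ^ 5 * E := by
    have : ‖a - D‖ ≤ 4 * C ^ 2 := by
      rw [show a - D = u * (1 + S) by rw [hD]; ring, norm_mul]
      have : ‖1 + S‖ ≤ 2 * C := by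
        refine (norm_add_le _ _).trans ?_
        rw [norm_one]
        have : h ^ 4 * X ≤ 1 * 1 := by
          gcongr
          exact pow_le_one₀ hh.le h1
        nlinarith
      calc ‖u‖ * ‖1 + S‖ ≤ (2 * C) * (2 * C) := by gcongr
        _ = _ := by ring
    rw [norm_mul, norm_mul]
    calc ‖k‖ * ‖a - D‖ * ‖Dp‖ ≤ ‖k‖ * (4 * C ^ 2) * (C * (X * E)) := by gcongr
      _ = (‖k‖ * X) * (4 * C ^ 3 * E) := by ring
      _ ≤ C * (4 * C ^ 3 * E) := by gcongr
      _ = 4 * C ^ 4 * E := by ring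
      _ ≤ _ := by gcongr
  have r3 : ‖k * (u * up) * (S * Sp)‖ ≤ 4 * C ^ 5 * E := by
    rw [norm_mul, norm_mul, norm_mul, norm_mul]
    calc ‖k‖ * (‖u‖ * ‖up‖) * (‖S‖ * ‖Sp‖)
        ≤ ‖k‖ * ((2 * C) * (2 * C)) * ((C * (h ^ 4 * X)) * (C * (h ^ 4 * X))) := by gcongr
      _ = (‖k‖ * X) * (4 * C ^ 4 * (h ^ 8 * X)) := by ring
      _ ≤ C * (4 * C ^ 4 * E) := by gcongr
      _ = _ := by ring
  have r4 : ‖(u * (up - 1) + (u - 1)) * q‖ ≤ 3 * C ^ 5 * E := by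
    have : ‖u * (up - 1) + (u - 1)‖ ≤ 3 * C ^ 2 * X := by
      refine (norm_add_le _ _).trans ?_
      rw [norm_mul]
      calc ‖u‖ * ‖up - 1‖ + ‖u - 1‖ ≤ (2 * C) * (C * X) + C * X := by
            gcongr
            · exact R.u_sub
            · exact L.u_sub
        _ ≤ (2 * C) * (C * X) + C * (C * X) := by gcongr; nlinarith [mul_nonneg hC0 hX]
        _ = _ := by ring
    rw [norm_mul]
    calc _ ≤ (3 * C ^ 2 * X) * (C * h ^ 8) := by gcongr
      _ = 3 * C ^ 3 * (h ^ 8 * X) := by ring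
      _ ≤ _ := by gcongr
  have r5 : ‖u * up * d * (Sp - S)‖ ≤ 8 * C ^ 5 * E := by
    rw [norm_mul, norm_mul, norm_mul]
    calc ‖u‖ * ‖up‖ * ‖d‖ * ‖Sp - S‖
        ≤ (2 * C) * (2 * C) * (C * X) * (C * (h ^ 4 * X) + C * (h ^ 4 * X)) := by
          gcongr
          exact (norm_sub_le _ _).trans (add_le_add S2 S1)
      _ = 8 * C ^ 4 * (h ^ 4 * X ^ 2) := by ring
      _ ≤ _ := by gcongr
  have r6 : ‖k * ((b - v) * bp + v * (bp - vp))‖ ≤ 3 * C ^ 5 * E := by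
    rw [norm_mul]
    calc ‖k‖ * ‖(b - v) * bp + v * (bp - vp)‖
        ≤ ‖k‖ * ((C * (h ^ 2 * X ^ 2)) * (2 * C * X ^ 2)
            + (C * X ^ 2) * (C * (h ^ 2 * X ^ 2))) := by
          gcongr
          refine (norm_add_le _ _).trans ?_
          rw [norm_mul, norm_mul]
          gcongr
      _ = (‖k‖ * X) * (3 * C ^ 2 * (h ^ 2 * X ^ 3)) := by ring
      _ ≤ C * (3 * C ^ 2 * E) := by gcongr
      _ = 3 * C ^ 3 * E := by ring
      _ ≤ _ := by gcongr
  have r7 : ‖d * (((a - u) * bp + u * (bp - vp)) - ((b - v) * ap + v * (ap - up)))‖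
      ≤ 8 * C ^ 5 * E := by
    rw [norm_mul]
    calc ‖d‖ * ‖((a - u) * bp + u * (bp - vp)) - ((b - v) * ap + v * (ap - up))‖
        ≤ (C * X) * (((C * h ^ 2) * (2 * C * X ^ 2) + (2 * C) * (C * (h ^ 2 * X ^ 2)))
          + ((C * (h ^ 2 * X ^ 2)) * (3 * C) + (C * X ^ 2) * (C * h ^ 2))) := by
          gcongr
          refine (norm_sub_le _ _).trans (add_le_add ((norm_add_le _ _).trans ?_)
            ((norm_add_le _ _).trans ?_)) <;> rw [norm_mul, norm_mul] <;> gcongr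
      _ = 8 * C ^ 3 * (h ^ 2 * X ^ 3) := by ring
      _ ≤ _ := by gcongr
  rw [key]
  have g1 := norm_add_le (-(k * D * ap) - k * (a - D) * Dp - k * (u * up) * (S * Sp)
        + (u * (up - 1) + (u - 1)) * q + u * up * d * (Sp - S)
        + k * ((b - v) * bp + v * (bp - vp)))
        (d * (((a - u) * bp + u * (bp - vp)) - ((b - v) * ap + v * (ap - up))))
  have g2 := norm_add_le (-(k * D * ap) - k * (a - D) * Dp - k * (u * up) * (S * Sp)
        + (u * (up - 1) + (u - 1)) * q + u * up * d * (Sp - S))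
        (k * ((b - v) * bp + v * (bp - vp)))
  have g3 := norm_add_le (-(k * D * ap) - k * (a - D) * Dp - k * (u * up) * (S * Sp)
        + (u * (up - 1) + (u - 1)) * q) (u * up * d * (Sp - S))
  have g4 := norm_add_le (-(k * D * ap) - k * (a - D) * Dp - k * (u * up) * (S * Sp))
        ((u * (up - 1) + (u - 1)) * q)
  have g5 := norm_sub_le (-(k * D * ap) - k * (a - D) * Dp) (k * (u * up) * (S * Sp))
  have g6 := norm_sub_le (-(k * D * ap)) (k * (a - D) * Dp)
  rw [norm_neg] at g6
  have : 0 ≤ C ^ 5 * E := by positivity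
  linarith

/-! ### Estimates for one half-line -/

theorem gridPoint_self (h : ℝ) (N : ℕ) : gridPoint h N N = 0 := by simp [gridPoint]

/-- The estimates of the errors on a half-line, with a constant `C`; `X` stands for
`|lam|^(-1/2)`. -/
structure HalfLineEstimates (C : ℝ) (ψ : ℝ → ℂ) (κ : ℂ) (h X : ℝ) (N : ℕ) : Prop where
  localError : ∀ u v, ModelSolution ψ κ u v → ∀ k < N, ∀ a' b',
    IsModelStep ψ κ h (gridPoint h N k) (u (gridPoint h N k)) (v (gridPoint h N k)) a' b' →
    ‖a' - u (gridPoint h N (k + 1))‖ ≤ C * (X * h ^ 5) ∧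
      ‖b' - v (gridPoint h N (k + 1))‖ ≤ C * (X ^ 2 * h ^ 3)
  globalError : ∀ u v, ModelSolution ψ κ u v → ∀ a b, IsModelRun ψ κ h N u v a b → ∀ k ≤ N,
    ‖a k - u (gridPoint h N k)‖ ≤ C * (X * h ^ 4) ∧
      ‖b k - v (gridPoint h N k)‖ ≤ C * (X ^ 2 * h ^ 2)
  endpoint : ∀ u v, ModelSolution ψ κ u v → ∀ a b, IsModelRun ψ κ h N u v a b →
    EndpointData C h X κ (u 0) (v 0) (a N) (b N)
      (∑ j ∈ Finset.range N, gaussDefect (modelCoeff ψ κ) (gridPoint h N j) h)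

/-- The estimates of the local, global and fine errors, with `1 / |κ|` replaced by `X`. -/
theorem exists_halfLineEstimates {ψ : ℝ → ℂ} {m : ℝ → ℝ} {W c₀ : ℝ} (hm : IsWeight ψ m W)
    (hc : 0 < c₀) : ∃ C ≥ 1, ∃ K : ℝ, ∀ (κ : ℂ) (h X : ℝ) (N : ℕ), c₀ * ‖κ‖ ≤ κ.re → K ≤ ‖κ‖ →
      60 ≤ h * ‖κ‖ → 0 < h → h ≤ 1 → 1 / ‖κ‖ ≤ X → ‖κ‖ * X ≤ 3 →
      HalfLineEstimates C ψ κ h X N := by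
  have hW := hm.bound_nonneg
  obtain ⟨A, hA, HA⟩ := exists_cellData W c₀ hW hc
  set T := Real.exp (500 * A ^ 3 * W) with hTd
  have hT : 0 ≤ T := (Real.exp_pos _).le
  set B := 408 * A ^ 4 * (1 + T) / c₀ with hBd
  have hB : 0 ≤ B := by positivity
  set F := Real.exp ((6 * A ^ 4 * W + 5000 * A ^ 5 * (1 + T) + 14 * A * B) * W) with hFd
  have hF : 0 ≤ F := (Real.exp_pos _).le
  set G := 2 * A * W with hG
  have hG0 : 0 ≤ G := by positivity
  set V := 4 / c₀ * W with hV
  have hV0 : 0 ≤ V := by positivity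
  set P := 500 * A ^ 4 with hP
  have hP0 : 0 ≤ P := by positivity
  clear_value T B F G V P
  set C := 3 + P + T + F + G + 2 * W + V with hC
  refine ⟨C, by linarith, max (kappaBound W c₀) (16 * A ^ 2), ?_⟩
  intro κ h X N hre hK hq hh h1 hX hX3
  have hK1 : kappaBound W c₀ ≤ ‖κ‖ := (le_max_left _ _).trans hK
  have hK2 : 16 * A ^ 2 ≤ ‖κ‖ := (le_max_right _ _).trans hK
  have hκ : 0 < ‖κ‖ := by nlinarith
  have hX0 : 0 ≤ X := le_trans (by positivity) hX
  have D : ∀ u v, ModelSolution ψ κ u v → ∀ k < N,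
      CellData A ψ κ u v (gridPoint h N k) h (m (gridPoint h N (k + 1))) := by
    intro u v hs k hk
    have hx := gridPoint_nonpos hh (show k + 1 ≤ N by omega)
    rw [← gridPoint_succ] at hx ⊢
    exact HA ψ m hm κ hK1 hre u v hs _ h hh h1 hx
  have x1 : ∀ {a c : ℝ}, 0 ≤ a → 0 ≤ c → c ≤ C → c * (a / ‖κ‖) ≤ C * (X * a) := by
    intro a c ha hc0 hcC
    calc c * (a / ‖κ‖) = c * (1 / ‖κ‖ * a) := by ring
      _ ≤ C * (X * a) := by gcongr
  have x2 : ∀ {a c : ℝ}, 0 ≤ a → 0 ≤ c → c ≤ C → c * (a / ‖κ‖ ^ 2) ≤ C * (X ^ 2 * a) := by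
    intro a c ha hc0 hcC
    calc c * (a / ‖κ‖ ^ 2) = c * ((1 / ‖κ‖) ^ 2 * a) := by ring
      _ ≤ C * (X ^ 2 * a) := by gcongr
  have glob : ∀ u v, ModelSolution ψ κ u v → ∀ a b, IsModelRun ψ κ h N u v a b → ∀ k ≤ N,
      ‖a k - u (gridPoint h N k)‖ ≤ h ^ 4 / ‖κ‖ * T ∧
      ‖b k - v (gridPoint h N k)‖ ≤ h ^ 2 / ‖κ‖ ^ 2 * T := by
    intro u v hs a b run k hk
    rw [hTd]
    exact run.norm_error_le hm hs hA (D u v hs) hc hh h1 hq hK2 hre hk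
  have glob' : ∀ u v, ModelSolution ψ κ u v → ∀ a b, IsModelRun ψ κ h N u v a b → ∀ k ≤ N,
      ‖a k - u (gridPoint h N k)‖ ≤ C * (X * h ^ 4) ∧
      ‖b k - v (gridPoint h N k)‖ ≤ C * (X ^ 2 * h ^ 2) := by
    intro u v hs a b run k hk
    obtain ⟨r1, r2⟩ := glob u v hs a b run k hk
    exact ⟨(r1.trans (by rw [mul_comm])).trans (x1 (c := T) (by positivity) hT (by linarith)),
      (r2.trans (by rw [mul_comm])).trans (x2 (c := T) (by positivity) hT (by linarith))⟩
  refine ⟨?_, glob', ?_⟩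
  · intro u v hs k hk a' b' step
    have r := step.norm_localError_le hs (D u v hs k hk) hh h1 hq hK2
    rw [gridPoint_succ, ← hP] at r
    exact ⟨r.1.trans (x1 (by positivity) hP0 (by linarith)),
      r.2.trans (x2 (by positivity) hP0 (by linarith))⟩
  · intro u v hs a b run
    have g := glob u v hs a b run
    have st : ∀ n ≤ N, ‖b n - v (gridPoint h N n)‖ ≤ B * (h ^ 4 / ‖κ‖) := by
      intro n hn
      rw [hBd]
      exact run.norm_stiff_error_le hs hA (D u v hs) hc hh h1 hq hK2 hre hT
        (fun n hn => (g n hn).1) (fun n hn => (g n hn).2) hn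
    have fine := run.norm_fine_error_le hm hs hA (D u v hs) hh h1 hq hK2 hT hB
      (fun n hn => (g n hn).1) (fun n hn => (g n hn).2) st le_rfl
    have e := glob' u v hs a b run N le_rfl
    rw [gridPoint_self] at e fine
    rw [← hFd, ← hG] at fine
    obtain ⟨-, n2, n3⟩ := hs.norm_le hm hc hK1 hre le_rfl
    refine ⟨hX3.trans (by linarith), ?_, ?_, ?_, ?_, ?_, ?_⟩
    · calc _ ≤ 2 * W / ‖κ‖ := n2
        _ = 2 * W * (1 / ‖κ‖) := by ring
        _ ≤ C * X := by gcongr; linarith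
    · have hm0 := hm.le 0 le_rfl
      calc _ ≤ 4 / c₀ * (m 0 / ‖κ‖ ^ 2) := n3
        _ ≤ 4 / c₀ * (W / ‖κ‖ ^ 2) := by gcongr
        _ = V * (1 / ‖κ‖) ^ 2 := by rw [hV]; ring
        _ ≤ C * X ^ 2 := by gcongr; linarith
    · refine e.1.trans (le_of_eq (by ring))
    · refine e.2.trans (le_of_eq (by ring))
    · exact (fine.1.trans (x1 (by positivity) hG0 (by linarith))).trans (le_of_eq (by ring))
    · calc _ ≤ F * (h ^ 4 / ‖κ‖ ^ 3 + h ^ 2 / ‖κ‖ ^ 4 + h ^ 8 / ‖κ‖ ^ 2) := fine.2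
        _ = F * (h ^ 8 * (1 / ‖κ‖) ^ 2 + h ^ 4 * (1 / ‖κ‖) ^ 3 + h ^ 2 * (1 / ‖κ‖) ^ 4) := by ring
        _ ≤ C * (h ^ 8 * X ^ 2 + h ^ 4 * X ^ 3 + h ^ 2 * X ^ 4) := by gcongr; linarith
        _ = _ := by ring

/-! ### The size of the error bound -/

theorem rpow_neg_half_eq (lam : ℂ) : ‖lam‖ ^ (-1 / 2 : ℝ) = 1 / √‖lam‖ := by
  rw [Real.sqrt_eq_rpow, one_div, ← Real.rpow_neg (norm_nonneg _)]
  norm_num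

theorem rpow_neg_one_eq (lam : ℂ) : ‖lam‖ ^ (-1 : ℝ) = (‖lam‖ ^ (-1 / 2 : ℝ)) ^ 2 := by
  rw [← Real.rpow_natCast, ← Real.rpow_mul (norm_nonneg _)]
  norm_num

theorem rpow_neg_three_half_eq (lam : ℂ) :
    ‖lam‖ ^ (-3 / 2 : ℝ) = (‖lam‖ ^ (-1 / 2 : ℝ)) ^ 3 := by
  rw [← Real.rpow_natCast, ← Real.rpow_mul (norm_nonneg _)]
  norm_num

theorem errorScale_eq (h : ℝ) (lam : ℂ) : errorScale h lam =
    h ^ 8 * ‖lam‖ ^ (-1 / 2 : ℝ) + h ^ 4 * (‖lam‖ ^ (-1 / 2 : ℝ)) ^ 2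
      + h ^ 2 * (‖lam‖ ^ (-1 / 2 : ℝ)) ^ 3 := by
  rw [errorScale, rpow_neg_one_eq, rpow_neg_three_half_eq]
  ring

theorem errorScale_strictAnti {h : ℝ} (hh : 0 < h) {lam lam' : ℂ} (h0 : 0 < ‖lam‖)
    (hlt : ‖lam‖ < ‖lam'‖) : errorScale h lam' < errorScale h lam := by
  have a : ∀ z : ℝ, z < 0 → ‖lam'‖ ^ z < ‖lam‖ ^ z := fun z hz =>
    Real.rpow_lt_rpow_of_neg h0 hlt hz
  have a1 := a (-1 / 2) (by norm_num)
  have a2 := a (-1) (by norm_num)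
  have a3 := a (-3 / 2) (by norm_num)
  unfold errorScale
  gcongr

theorem tendsto_errorScale (h : ℝ) :
    Tendsto (errorScale h) (Bornology.cobounded ℂ) (𝓝 0) := by
  have a : ∀ z : ℝ, 0 < z → ∀ b : ℝ,
      Tendsto (fun lam : ℂ => ‖lam‖ ^ (-z) * b) (Bornology.cobounded ℂ) (𝓝 0) := by
    intro z hz b
    have := ((tendsto_rpow_neg_atTop hz).comp
      (tendsto_norm_cobounded_atTop (E := ℂ))).mul_const b
    simpa using this
  have a1 := a (1 / 2) (by norm_num) (h ^ 8)
  have a2 := a 1 (by norm_num) (h ^ 4)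
  have a3 := a (3 / 2) (by norm_num) (h ^ 2)
  have := (a1.add a2).add a3
  simp only [add_zero] at this
  refine this.congr fun lam => ?_
  rw [errorScale]
  norm_num [neg_div]

/-- What membership in the regime says about `X = |lam|^(-1/2)`. -/
theorem InRegime.bounds {ε K h₀ h : ℝ} {lam : ℂ} (H : InRegime ε K h₀ h lam) (hK : 0 < K)
    (h1 : h₀ ≤ 1) : 0 < ‖lam‖ ∧ K ≤ ‖lam‖ ∧ √K ≤ h * √‖lam‖ ∧
      ‖lam‖ ^ (-1 / 2 : ℝ) * √K ≤ h ∧ 0 < ‖lam‖ ^ (-1 / 2 : ℝ) := by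
  obtain ⟨hh, hh0, -, hl⟩ := H
  have hle : h ≤ 1 := by linarith
  have hp : 0 < ‖lam‖ := by
    by_contra hc
    have : ‖lam‖ * h ^ 2 ≤ 0 := mul_nonpos_of_nonpos_of_nonneg (not_lt.mp hc) (by positivity)
    linarith
  have h2 : h ^ 2 ≤ 1 := pow_le_one₀ hh.le hle
  have hs : √K ≤ h * √‖lam‖ := by
    have := Real.sqrt_le_sqrt hl
    rwa [Real.sqrt_mul hp.le, Real.sqrt_sq hh.le, mul_comm] at this
  have hsp : 0 < √‖lam‖ := Real.sqrt_pos.mpr hp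
  refine ⟨hp, by nlinarith, hs, ?_, Real.rpow_pos_of_pos hp _⟩
  rw [rpow_neg_half_eq, div_mul_eq_mul_div, one_mul, div_le_iff₀ hsp]
  exact hs

theorem InRegime.mono {ε K K' h₀ h₀' h : ℝ} {lam : ℂ} (H : InRegime ε K' h₀' h lam) (hK : K ≤ K')
    (hh : h₀' ≤ h₀) : InRegime ε K h₀ h lam :=
  ⟨H.1, H.2.1.trans_le hh, H.2.2.1, hK.trans H.2.2.2⟩

theorem exists_bound_of_isBigO {q : ℝ → ℝ} {M : ℕ}
    (hq : q =O[𝓝[>] 0] (fun h : ℝ => h ^ M)) :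
    ∃ C > 0, ∃ h₁ > 0, ∀ h, 0 < h → h < h₁ → |q h| ≤ C * h ^ M := by
  obtain ⟨C, hC, H⟩ := hq.exists_pos
  obtain ⟨h₁, hh1, hs⟩ := mem_nhdsGT_iff_exists_Ioo_subset.mp H.bound
  refine ⟨C, hC, h₁, hh1, fun h hh hlt => ?_⟩
  have := hs ⟨hh, hlt⟩
  simp only [Set.mem_ofPred_eq, Real.norm_eq_abs] at this
  rwa [abs_of_nonneg (pow_nonneg hh.le M)] at this

/-- For `|lam| ≤ h^(-M)`, powers of `|lam|^(-1/2)` dominate high powers of `h`. -/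
theorem pow_le_rpow_neg_half {h : ℝ} {lam : ℂ} {M : ℕ} (hp : 1 ≤ ‖lam‖)
    (hM : ‖lam‖ * h ^ M ≤ 1) : h ^ M ≤ ‖lam‖ ^ (-1 / 2 : ℝ) := by
  have h0 : 0 < ‖lam‖ := by linarith
  calc h ^ M ≤ ‖lam‖ ^ (-1 : ℝ) := by
        rw [Real.rpow_neg_one, ← one_div, le_div_iff₀ h0, mul_comm]; exact hM
    _ ≤ ‖lam‖ ^ (-1 / 2 : ℝ) := Real.rpow_le_rpow_of_exponent_le hp (by norm_num)

/-! ### Estimates in the regime -/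

/-- Reflection carries the right half-line to the left one. -/
theorem exists_isWeight_right {φ : ℝ → ℝ} (hφ : ContDiff ℝ ∞ φ) {p : ℝ}
    (h0 : IntegrableOn (fun x => φ x - p) (Set.Ici 0))
    (hd : ∀ j : ℕ, 1 ≤ j → Integrable (iteratedDeriv j φ)) :
    ∃ m W, IsWeight (rightPotential φ p) m W := by
  refine exists_isWeight (φ := fun x => φ (-x)) (hφ.comp contDiff_neg) ?_ ?_
  · have := ((Measure.measurePreserving_neg (volume : Measure ℝ)).integrableOn_comp_preimage
      (Homeomorph.neg ℝ).measurableEmbedding).mpr h0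
    simpa [Function.comp_def] using this
  · intro j hj
    have e : iteratedDeriv j (fun x => φ (-x))
        = fun x => (-1 : ℝ) ^ j • iteratedDeriv j φ (-x) := by
      funext x
      exact iteratedDeriv_comp_neg j φ x
    rw [e]
    exact (hd j hj).comp_neg.smul ((-1 : ℝ) ^ j)

theorem existsUnique_step {φ : ℝ → ℝ} {c p : ℝ} {lam : ℂ} {h B : ℝ} (hh : 0 < h)
    (h1 : h ≤ 1) (hq : 60 ≤ h * ‖kappa c p lam‖) (hB : ∀ x, |φ x| ≤ B)
    (hK : 16 * (B + |p|) ≤ ‖kappa c p lam‖) (x : ℝ) (a : Fin 2 → ℂ) :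
    (∃! b, IsGL4Step (leftMatrix φ c p lam) h x a b) ∧
      (∃! b, IsGL4Step (rightMatrix φ c p lam) (-h) x a b) := by
  have hκ : 0 < ‖kappa c p lam‖ := by
    by_contra hc
    have : h * ‖kappa c p lam‖ ≤ 0 := mul_nonpos_of_nonneg_of_nonpos hh.le (not_lt.mp hc)
    linarith
  have hκ0 := norm_pos_iff.mp hκ
  have hc : ∀ {ψ : ℝ → ℂ}, (∀ x, ‖ψ x‖ ≤ B + |p|) →
      ∀ x, ‖modelCoeff ψ (kappa c p lam) x‖ ≤ (B + |p|) / ‖kappa c p lam‖ := by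
    intro ψ hψ x
    rw [modelCoeff, norm_neg, norm_div]
    gcongr
    exact hψ x
  have hl : ∀ x, ‖leftPotential φ p x‖ ≤ B + |p| := fun x => by
    rw [leftPotential, Complex.norm_real]
    exact (norm_sub_le _ _).trans (add_le_add (hB x) le_rfl)
  have hr : ∀ x, ‖rightPotential φ p x‖ ≤ B + |p| := fun x => by
    rw [rightPotential, Complex.norm_real]
    exact (norm_sub_le _ _).trans (add_le_add (hB _) le_rfl)
  have hBp : 0 ≤ B + |p| := (norm_nonneg _).trans (hl 0)
  have hs : h * ((B + |p|) / ‖kappa c p lam‖) ≤ 1 / 16 := by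
    have : (B + |p|) / ‖kappa c p lam‖ ≤ 1 / 16 := by
      rw [div_le_iff₀ hκ]; linarith
    have : 0 ≤ (B + |p|) / ‖kappa c p lam‖ := by positivity
    nlinarith
  constructor
  · obtain ⟨⟨a', b', H⟩, U⟩ := existsUnique_isModelStep hh hq (hc hl) hs x (a 0) (a 1)
    refine ⟨![a', b'], (isGL4Step_leftMatrix_iff hκ0).mpr H, fun b hb => ?_⟩
    obtain ⟨e1, e2⟩ := U _ _ _ _ ((isGL4Step_leftMatrix_iff hκ0).mp hb) H
    ext i
    fin_cases i
    · exact e1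
    · exact e2
  · obtain ⟨⟨a', b', H⟩, U⟩ := existsUnique_isModelStep hh hq (hc hr) hs (-x) (a 1) (a 0)
    refine ⟨![b', a'], (isGL4Step_rightMatrix_iff hκ0).mpr H, fun b hb => ?_⟩
    obtain ⟨e1, e2⟩ := U _ _ _ _ ((isGL4Step_rightMatrix_iff hκ0).mp hb) H
    ext i
    fin_cases i
    · exact e2
    · exact e1

theorem IsGL4Run.left_isModelRun {φ : ℝ → ℝ} {c p : ℝ} {lam : ℂ} (hk : kappa c p lam ≠ 0)
    {h : ℝ} {N : ℕ} {y : ℝ → Fin 2 → ℂ} {z : ℕ → Fin 2 → ℂ}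
    (H : IsGL4Run (leftMatrix φ c p lam) h (-(N * h)) N (leftCoords c p lam y (-(N * h))) z) :
    IsModelRun (leftPotential φ p) (kappa c p lam) h N (fun x => leftCoords c p lam y x 0)
      (fun x => leftCoords c p lam y x 1) (fun k => z k 0) (fun k => z k 1) :=
  ⟨congrFun H.1 0, congrFun H.1 1, fun k hk' => (isGL4Step_leftMatrix_iff hk).mp (H.2 k hk')⟩

theorem IsGL4Run.right_isModelRun {φ : ℝ → ℝ} {c p : ℝ} {lam : ℂ} (hk : kappa c p lam ≠ 0)
    {h : ℝ} {N : ℕ} {y : ℝ → Fin 2 → ℂ} {z : ℕ → Fin 2 → ℂ}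
    (H : IsGL4Run (rightMatrix φ c p lam) (-h) (N * h) N (rightCoords c p lam y (N * h)) z) :
    IsModelRun (rightPotential φ p) (kappa c p lam) h N (fun x => rightCoords c p lam y (-x) 1)
      (fun x => rightCoords c p lam y (-x) 0) (fun k => z k 1) (fun k => z k 0) := by
  refine ⟨?_, ?_, fun k hk' => ?_⟩
  · simp only [neg_neg]; exact congrFun H.1 1
  · simp only [neg_neg]; exact congrFun H.1 0
  · have := (isGL4Step_rightMatrix_iff hk).mp (H.2 k hk')
    rwa [show -((N : ℝ) * h + k * -h) = -(N * h) + k * h by ring] at this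

/-- The sup norm of an error vector, from its components. -/
theorem norm_le_of_components {e : Fin 2 → ℂ} {B : ℝ} (h0 : ‖e 0‖ ≤ B) (h1 : ‖e 1‖ ≤ B) :
    ‖e‖ ≤ B := by
  rw [pi_norm_le_iff_of_nonneg ((norm_nonneg _).trans h0)]
  intro i
  fin_cases i
  · exact h0
  · exact h1

/-- The half-line estimates on both sides, in the coordinates of the Evans system, and their
combination in the Evans function. -/
theorem exists_regime_estimates {φ : ℝ → ℝ} (hφ : ContDiff ℝ ∞ φ) {c pm pp : ℝ}
    (hleft : IntegrableOn (fun x => φ x - pm) (Set.Iic 0))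
    (hright : IntegrableOn (fun x => φ x - pp) (Set.Ici 0))
    (hderiv : ∀ p : ℕ, 1 ≤ p → Integrable (iteratedDeriv p φ)) {N : ℝ → ℕ}
    (hq : (fun h : ℝ => quadratureDefect φ h (N h)) =O[𝓝[>] 0] (fun h : ℝ => h ^ 8))
    {ε : ℝ} (hε : 0 < ε) :
    ∃ K > 0, ∃ h₀ > 0, ∃ C > 0, ∀ (h : ℝ) (lam : ℂ), InRegime ε K h₀ h lam →
      (∀ (x : ℝ) (a : Fin 2 → ℂ),
        (∃! b, IsGL4Step (leftMatrix φ c pm lam) h x a b) ∧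
        (∃! b, IsGL4Step (rightMatrix φ c pp lam) (-h) x a b)) ∧
      ∀ (y yp : ℝ → Fin 2 → ℂ) (z zp : ℕ → Fin 2 → ℂ),
        IsComputation φ c pm pp lam h (N h) y yp z zp →
        (∀ k < N h, ∀ b e : Fin 2 → ℂ,
          IsGL4Step (leftMatrix φ c pm lam) h (-(N h * h) + k * h)
            (leftCoords c pm lam y (-(N h * h) + k * h)) b →
          e = b - leftCoords c pm lam y (-(N h * h) + (k + 1) * h) →
            ‖e 0‖ ≤ C * (‖lam‖ ^ (-1 / 2 : ℝ) * h ^ 5) ∧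
            ‖e 1‖ ≤ C * (‖lam‖ ^ (-1 : ℝ) * h ^ 3) ∧
            ‖e‖ ≤ C * h ^ 5) ∧
        (∀ k < N h, ∀ b e : Fin 2 → ℂ,
          IsGL4Step (rightMatrix φ c pp lam) (-h) (N h * h - k * h)
            (rightCoords c pp lam yp (N h * h - k * h)) b →
          e = b - rightCoords c pp lam yp (N h * h - (k + 1) * h) →
            ‖e 1‖ ≤ C * (‖lam‖ ^ (-1 / 2 : ℝ) * h ^ 5) ∧
            ‖e 0‖ ≤ C * (‖lam‖ ^ (-1 : ℝ) * h ^ 3) ∧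
            ‖e‖ ≤ C * h ^ 5) ∧
        (∀ k ≤ N h, ∀ e : Fin 2 → ℂ,
          e = z k - leftCoords c pm lam y (-(N h * h) + k * h) →
            ‖e 0‖ ≤ C * (‖lam‖ ^ (-1 / 2 : ℝ) * h ^ 4) ∧
            ‖e 1‖ ≤ C * (‖lam‖ ^ (-1 : ℝ) * h ^ 2) ∧
            ‖e‖ ≤ C * h ^ 4) ∧
        (∀ k ≤ N h, ∀ e : Fin 2 → ℂ,
          e = zp k - rightCoords c pp lam yp (N h * h - k * h) →
            ‖e 1‖ ≤ C * (‖lam‖ ^ (-1 / 2 : ℝ) * h ^ 4) ∧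
            ‖e 0‖ ≤ C * (‖lam‖ ^ (-1 : ℝ) * h ^ 2) ∧
            ‖e‖ ≤ C * h ^ 4) ∧
        ‖evansError c pm pp lam (N h) y yp z zp - (quadratureDefect φ h (N h) : ℂ)‖
          ≤ C * errorScale h lam := by
  obtain ⟨B, hB⟩ := exists_bound_of_integrable_deriv hφ
    (by simpa using hderiv 1 le_rfl)
  obtain ⟨m₁, W₁, hm₁⟩ : ∃ m W, IsWeight (leftPotential φ pm) m W :=
    exists_isWeight hφ hleft hderiv
  obtain ⟨m₂, W₂, hm₂⟩ := exists_isWeight_right hφ hright hderiv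
  obtain ⟨c₁, hc₁, R₁, hR₁⟩ := exists_kappa_bounds c pm hε
  obtain ⟨c₂, hc₂, R₂, hR₂⟩ := exists_kappa_bounds c pp hε
  obtain ⟨C₁, hC₁, K₁, H₁⟩ := exists_halfLineEstimates hm₁ hc₁
  obtain ⟨C₂, hC₂, K₂, H₂⟩ := exists_halfLineEstimates hm₂ hc₂
  obtain ⟨C₃, hC₃, h₁, hh₁, H₃⟩ := exists_bound_of_isBigO hq
  set C₄ := 4 * |pm - pp| / c₁ with hC₄
  have hC₄0 : 0 ≤ C₄ := by positivity
  set C := C₁ + C₂ + C₃ + C₄ with hC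
  have hC1 : 1 ≤ C := by linarith
  -- the lower bound for `|κ|` that all estimates need
  set K₀ := 60 + |K₁| + |K₂| + 16 * (|B| + |pm|) + 16 * (|B| + |pp|) with hK₀
  have hK₀60 : 60 ≤ K₀ := by
    have : 0 ≤ |K₁| + |K₂| + 16 * (|B| + |pm|) + 16 * (|B| + |pp|) := by positivity
    linarith
  have bK1 : K₁ ≤ K₀ := by
    have : 0 ≤ |K₂| + 16 * (|B| + |pm|) + 16 * (|B| + |pp|) := by positivity
    linarith [le_abs_self K₁]
  have bK2 : K₂ ≤ K₀ := by
    have : 0 ≤ |K₁| + 16 * (|B| + |pm|) + 16 * (|B| + |pp|) := by positivity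
    linarith [le_abs_self K₂]
  have bKm : 16 * (B + |pm|) ≤ K₀ := by
    have : 0 ≤ |K₁| + |K₂| + 16 * (|B| + |pp|) := by positivity
    linarith [le_abs_self B]
  have bKp : 16 * (B + |pp|) ≤ K₀ := by
    have : 0 ≤ |K₁| + |K₂| + 16 * (|B| + |pm|) := by positivity
    linarith [le_abs_self B]
  clear_value C C₄ K₀
  refine ⟨K₀ ^ 2 + |R₁| + |R₂|, by positivity, min 1 h₁, lt_min one_pos hh₁, 100 * C ^ 5,
    by positivity, ?_⟩
  intro h lam hreg
  have hKpos : 0 < K₀ ^ 2 + |R₁| + |R₂| := by positivity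
  obtain ⟨hlam, hKl, hsq, hXs, hX0⟩ := hreg.bounds hKpos (min_le_left _ _)
  obtain ⟨hh, hh0, harg, -⟩ := hreg
  have hle : h ≤ 1 := (hh0.trans_le (min_le_left _ _)).le
  have hlt : h < h₁ := hh0.trans_le (min_le_right _ _)
  have hsK : K₀ ≤ √(K₀ ^ 2 + |R₁| + |R₂|) := by
    refine Real.le_sqrt_of_sq_le ?_
    linarith [abs_nonneg R₁, abs_nonneg R₂]
  have hqs : K₀ ≤ h * √‖lam‖ := hsK.trans hsq
  have hs0 : 0 < √‖lam‖ := Real.sqrt_pos.mpr hlam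
  have hs : K₀ ≤ √‖lam‖ := hqs.trans (mul_le_of_le_one_left hs0.le hle)
  obtain ⟨l1, u1, r1⟩ := hR₁ lam harg
    (by linarith [le_abs_self R₁, abs_nonneg R₂, sq_nonneg K₀])
  obtain ⟨l2, u2, r2⟩ := hR₂ lam harg
    (by linarith [le_abs_self R₂, abs_nonneg R₁, sq_nonneg K₀])
  have hd := norm_kappa_sub_le (p' := pp) hc₁ hlam l1 r1
  rw [← rpow_neg_half_eq, ← hC₄] at hd
  have hXe := rpow_neg_half_eq lam
  rw [errorScale_eq, rpow_neg_one_eq]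
  set X := ‖lam‖ ^ (-1 / 2 : ℝ) with hX
  clear_value X
  have hXh : X ≤ h := by nlinarith
  have hX1 : X ≤ 1 := hXh.trans hle
  have inv : ∀ {κ : ℂ}, √‖lam‖ ≤ ‖κ‖ → ‖κ‖ ≤ 3 * √‖lam‖ → 1 / ‖κ‖ ≤ X ∧ ‖κ‖ * X ≤ 3 := by
    intro κ a b
    rw [hXe]
    refine ⟨one_div_le_one_div_of_le hs0 a, ?_⟩
    rw [mul_one_div, div_le_iff₀ hs0]
    exact b
  have big : ∀ {κ : ℂ}, √‖lam‖ ≤ ‖κ‖ → K₀ ≤ ‖κ‖ ∧ 60 ≤ h * ‖κ‖ := by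
    intro κ a
    refine ⟨hs.trans a, ?_⟩
    have : h * √‖lam‖ ≤ h * ‖κ‖ := by gcongr
    linarith
  obtain ⟨g1, q1⟩ := big l1
  obtain ⟨g2, q2⟩ := big l2
  have E₁ := H₁ (kappa c pm lam) h X (N h) r1 (bK1.trans g1) q1 hh hle (inv l1 u1).1 (inv l1 u1).2
  have E₂ := H₂ (kappa c pp lam) h X (N h) r2 (bK2.trans g2) q2 hh hle (inv l2 u2).1 (inv l2 u2).2
  have k1 : kappa c pm lam ≠ 0 := norm_pos_iff.mp (by linarith)
  have k2 : kappa c pp lam ≠ 0 := norm_pos_iff.mp (by linarith)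
  have hCC : C ≤ 100 * C ^ 5 := by
    have := le_self_pow₀ hC1 (by norm_num : (5 : ℕ) ≠ 0)
    nlinarith
  have hCC1 : C₁ ≤ 100 * C ^ 5 := by linarith
  have hCC2 : C₂ ≤ 100 * C ^ 5 := by linarith
  have hC'0 : 0 ≤ 100 * C ^ 5 := by linarith
  -- the sup norm of an error is `O(h ^ (r + 2))` because `X ≤ h` and `X ≤ 1`
  have wrap : ∀ {C' s t : ℝ} {r : ℕ}, 1 ≤ C' → C' ≤ 100 * C ^ 5 →
      s ≤ C' * (X * h ^ (r + 2)) → t ≤ C' * (X ^ 2 * h ^ r) →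
      s ≤ 100 * C ^ 5 * (X * h ^ (r + 2)) ∧ t ≤ 100 * C ^ 5 * (X ^ 2 * h ^ r) ∧
      s ≤ 100 * C ^ 5 * h ^ (r + 2) ∧ t ≤ 100 * C ^ 5 * h ^ (r + 2) := by
    intro C' s t r h1' hC' b1 b2
    have a1 : s ≤ 100 * C ^ 5 * (X * h ^ (r + 2)) := b1.trans (by gcongr)
    have a2 : t ≤ 100 * C ^ 5 * (X ^ 2 * h ^ r) := b2.trans (by gcongr)
    refine ⟨a1, a2, a1.trans ?_, a2.trans ?_⟩
    · gcongr
      exact mul_le_of_le_one_left (by positivity) hX1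
    · have : X ^ 2 * h ^ r ≤ h ^ 2 * h ^ r := by gcongr
      rw [← pow_add, add_comm 2 r] at this
      gcongr
  refine ⟨fun x a => ⟨(existsUnique_step hh hle q1 hB (bKm.trans g1) x a).1,
    (existsUnique_step hh hle q2 hB (bKp.trans g2) x a).2⟩, ?_⟩
  intro y yp z zp hcomp
  have M₁ := hcomp.left.modelSolution k1
  have M₂ := hcomp.right.modelSolution k2
  have G₁ := hcomp.run_left.left_isModelRun k1
  have G₂ := hcomp.run_right.right_isModelRun k2
  have n1 : ∀ k : ℕ, -gridPoint h (N h) k = N h * h - k * h := fun k => by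
    simp only [gridPoint]; ring
  have n2 : ∀ k : ℕ, gridPoint h (N h) (k + 1) = -(N h * h) + (k + 1) * h := fun k => by
    simp only [gridPoint]; push_cast; ring
  have n3 : ∀ k : ℕ, -gridPoint h (N h) (k + 1) = N h * h - (k + 1) * h := fun k => by
    simp only [gridPoint]; push_cast; ring
  refine ⟨?_, ?_, ?_, ?_, ?_⟩
  · rintro k hk b e hb rfl
    have r := E₁.localError _ _ M₁ k hk _ _ ((isGL4Step_leftMatrix_iff k1).mp hb)
    rw [n2] at r
    obtain ⟨w1, w2, w3, w4⟩ := wrap hC₁ hCC1 r.1 r.2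
    exact ⟨w1, w2, norm_le_of_components w3 w4⟩
  · rintro k hk b e hb rfl
    have hb' := (isGL4Step_rightMatrix_iff k2).mp hb
    rw [← n1, neg_neg] at hb'
    have r := E₂.localError _ _ M₂ k hk _ _ hb'
    rw [n3] at r
    obtain ⟨w1, w2, w3, w4⟩ := wrap hC₂ hCC2 r.1 r.2
    exact ⟨w1, w2, norm_le_of_components w4 w3⟩
  · rintro k hk e rfl
    have r := E₁.globalError _ _ M₁ _ _ G₁ k hk
    obtain ⟨w1, w2, w3, w4⟩ := wrap hC₁ hCC1 r.1 r.2
    exact ⟨w1, w2, norm_le_of_components w3 w4⟩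
  · rintro k hk e rfl
    have r := E₂.globalError _ _ M₂ _ _ G₂ k hk
    rw [n1] at r
    obtain ⟨w1, w2, w3, w4⟩ := wrap hC₂ hCC2 r.1 r.2
    exact ⟨w1, w2, norm_le_of_components w4 w3⟩
  · have D₁ := (E₁.endpoint _ _ M₁ _ _ G₁).mono (C' := C) (by linarith) hX0.le
    have D₂ := (E₂.endpoint _ _ M₂ _ _ G₂).mono (C' := C) (by linarith) hX0.le
    rw [neg_zero] at D₂
    have e0 : wedge (y 0) (yp 0) = wedge (eigMatrix c pm lam *ᵥ leftCoords c pm lam y 0)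
        (eigMatrix c pp lam *ᵥ rightCoords c pp lam yp 0) := by
      rw [leftCoords, rightCoords, eigMatrix_mulVec_rescale_zero k1,
        eigMatrix_mulVec_rescale_zero k2]
    rw [evansError, e0, wedge_eigMatrix, wedge_eigMatrix]
    refine norm_evans_remainder_le hC1 hh hle hX0.le hX1 D₁ D₂ (hd.trans ?_) ?_ ?_
    · gcongr
      linarith
    · rw [Finset.mul_sum, Finset.mul_sum]
      simp only [mul_gaussDefect_modelCoeff _ k1, mul_gaussDefect_modelCoeff _ k2]
      rw [quadratureDefect_eq_add hφ.continuous pm pp, Finset.sum_neg_distrib,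
        Finset.sum_neg_distrib]
      ring
    · rw [Complex.norm_real, Real.norm_eq_abs]
      refine (H₃ h hh hlt).trans ?_
      gcongr
      linarith

theorem norm_le_add_of_norm_sub_ofReal_le {e : ℂ} {q B D : ℝ} (h : ‖e - (q : ℂ)‖ ≤ B)
    (hq : |q| ≤ D) : ‖e‖ ≤ B + D := by
  have h1 := norm_sub_norm_le e (q : ℂ)
  rw [Complex.norm_real, Real.norm_eq_abs] at h1
  linarith

end

end EvansGL

theorem mainTheorem6 (f w : ℝ → ℝ) (c wm wp : ℝ) (hw : IsTravellingWave f w c wm wp)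
    -- the potential `φ = f' ∘ w` and its limits at `∓∞`
    (φ : ℝ → ℝ) (hφ : ∀ x, φ x = deriv f (w x))
    (pm pp : ℝ) (hpm : pm = deriv f wm) (hpp : pp = deriv f wp)
    -- convergence of `Φ₋(0) = ∫_{-∞}^0 (φ - pm)` and `Φ₊(0) = ∫_0^∞ (φ - pp)`, and
    -- integrability of the derivatives of `φ`
    (hleft : IntegrableOn (fun x => φ x - pm) (Set.Iic 0))
    (hright : IntegrableOn (fun x => φ x - pp) (Set.Ici 0))
    (hderiv : ∀ p : ℕ, 1 ≤ p → Integrable (iteratedDeriv p φ))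
    -- the interval `[-L, L]`, `L = N h`, is so large that the derivatives of `φ` at `± L` are
    -- negligible
    (N : ℝ → ℕ)
    (hN : ∀ p : ℕ, 1 ≤ p → ∀ M : ℕ,
      (fun h : ℝ => iteratedDeriv p φ (-(N h * h))) =O[𝓝[>] 0] (fun h : ℝ => h ^ M) ∧
      (fun h : ℝ => iteratedDeriv p φ (N h * h)) =O[𝓝[>] 0] (fun h : ℝ => h ^ M))
    (ε : ℝ) (hε : 0 < ε) :
    -- (1) estimates in the whole regime
    (∃ K > 0, ∃ h₀ > 0, ∃ C > 0, ∀ (h : ℝ) (lam : ℂ), InRegime ε K h₀ h lam →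
      -- the steps of the method are uniquely solvable
      (∀ (x : ℝ) (a : Fin 2 → ℂ),
        (∃! b, IsGL4Step (leftMatrix φ c pm lam) h x a b) ∧
        (∃! b, IsGL4Step (rightMatrix φ c pp lam) (-h) x a b)) ∧
      ∀ (y yp : ℝ → Fin 2 → ℂ) (z zp : ℕ → Fin 2 → ℂ),
        IsComputation φ c pm pp lam h (N h) y yp z zp →
        -- local error on the left: no term of order `|lam|^(-1/2) h²`, no order reduction
        (∀ k < N h, ∀ b e : Fin 2 → ℂ,
          IsGL4Step (leftMatrix φ c pm lam) h (-(N h * h) + k * h)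
            (leftCoords c pm lam y (-(N h * h) + k * h)) b →
          e = b - leftCoords c pm lam y (-(N h * h) + (k + 1) * h) →
            ‖e 0‖ ≤ C * (‖lam‖ ^ (-1 / 2 : ℝ) * h ^ 5) ∧
            ‖e 1‖ ≤ C * (‖lam‖ ^ (-1 : ℝ) * h ^ 3) ∧
            ‖e‖ ≤ C * h ^ 5) ∧
        -- local error on the right
        (∀ k < N h, ∀ b e : Fin 2 → ℂ,
          IsGL4Step (rightMatrix φ c pp lam) (-h) (N h * h - k * h)
            (rightCoords c pp lam yp (N h * h - k * h)) b →
          e = b - rightCoords c pp lam yp (N h * h - (k + 1) * h) →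
            ‖e 1‖ ≤ C * (‖lam‖ ^ (-1 / 2 : ℝ) * h ^ 5) ∧
            ‖e 0‖ ≤ C * (‖lam‖ ^ (-1 : ℝ) * h ^ 3) ∧
            ‖e‖ ≤ C * h ^ 5) ∧
        -- global error on the left: no order reduction
        (∀ k ≤ N h, ∀ e : Fin 2 → ℂ,
          e = z k - leftCoords c pm lam y (-(N h * h) + k * h) →
            ‖e 0‖ ≤ C * (‖lam‖ ^ (-1 / 2 : ℝ) * h ^ 4) ∧
            ‖e 1‖ ≤ C * (‖lam‖ ^ (-1 : ℝ) * h ^ 2) ∧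
            ‖e‖ ≤ C * h ^ 4) ∧
        -- global error on the right
        (∀ k ≤ N h, ∀ e : Fin 2 → ℂ,
          e = zp k - rightCoords c pp lam yp (N h * h - k * h) →
            ‖e 1‖ ≤ C * (‖lam‖ ^ (-1 / 2 : ℝ) * h ^ 4) ∧
            ‖e 0‖ ≤ C * (‖lam‖ ^ (-1 : ℝ) * h ^ 2) ∧
            ‖e‖ ≤ C * h ^ 4) ∧
        -- the error in the Evans function, up to a quantity that does not depend on `lam` ...
        ‖evansError c pm pp lam (N h) y yp z zp - (quadratureDefect φ h (N h) : ℂ)‖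
          ≤ C * errorScale h lam) ∧
    -- (2) ... and that vanishes at all orders in `h`
    (∀ M : ℕ, (fun h : ℝ => quadratureDefect φ h (N h)) =O[𝓝[>] 0] (fun h : ℝ => h ^ M)) ∧
    -- (3) the error in the Evans function is `O(|lam|^(-1/2) h⁸, |lam|^(-1) h⁴, |lam|^(-3/2) h²)`
    -- as long as `|lam|` is at most some power of `h⁻¹`
    (∀ M : ℕ, ∃ K > 0, ∃ h₀ > 0, ∃ C > 0, ∀ (h : ℝ) (lam : ℂ), InRegime ε K h₀ h lam →
      ‖lam‖ * h ^ M ≤ 1 →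
      ∀ (y yp : ℝ → Fin 2 → ℂ) (z zp : ℕ → Fin 2 → ℂ),
        IsComputation φ c pm pp lam h (N h) y yp z zp →
        ‖evansError c pm pp lam (N h) y yp z zp‖ ≤ C * errorScale h lam) ∧
    -- (4) this bound decreases as `|lam|` grows
    (∀ h > 0, (∀ lam lam' : ℂ, 0 < ‖lam‖ → ‖lam‖ < ‖lam'‖ → errorScale h lam' < errorScale h lam) ∧
      Tendsto (errorScale h) (Bornology.cobounded ℂ) (𝓝 0)) ∧
    -- (5) the error is of smaller order than the `O(h⁴)` of the fourth-order Magnus method ...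
    (∀ η > 0, ∃ K > 0, ∃ h₀ > 0, ∀ (h : ℝ) (lam : ℂ), InRegime ε K h₀ h lam →
      ∀ (y yp : ℝ → Fin 2 → ℂ) (z zp : ℕ → Fin 2 → ℂ),
        IsComputation φ c pm pp lam h (N h) y yp z zp →
        ‖evansError c pm pp lam (N h) y yp z zp‖ ≤ η * h ^ 4) ∧
    -- (6) ... and than the `O(|lam|^(-1/2) h²)` of the exponential midpoint rule
    (∀ η > 0, ∀ M : ℕ, ∃ K > 0, ∃ h₀ > 0, ∀ (h : ℝ) (lam : ℂ), InRegime ε K h₀ h lam →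
      ‖lam‖ * h ^ M ≤ 1 →
      ∀ (y yp : ℝ → Fin 2 → ℂ) (z zp : ℕ → Fin 2 → ℂ),
        IsComputation φ c pm pp lam h (N h) y yp z zp →
        ‖evansError c pm pp lam (N h) y yp z zp‖ ≤ η * (‖lam‖ ^ (-1 / 2 : ℝ) * h ^ 2)) := by
  have hφs : ContDiff ℝ ∞ φ := by
    have e : φ = fun x => deriv f (w x) := funext hφ
    rw [e]
    have hf : ContDiff ℝ ∞ (deriv f) :=
      ((contDiff_infty_iff_deriv (𝕜 := ℝ)).mp hw.smooth_reaction).2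
    exact hf.comp hw.smooth_profile
  have hq := quadratureDefect_isBigO hφs hderiv hN
  have main := exists_regime_estimates hφs (c := c) hleft hright hderiv (hq 8) hε
  refine ⟨main, hq, ?_, fun h hh => ⟨fun lam lam' h0 hlt => errorScale_strictAnti hh h0 hlt,
    tendsto_errorScale h⟩, ?_, ?_⟩
  all_goals obtain ⟨K, hK, h₀, hh₀, C, hC, H⟩ := main
  · -- `q` is below the first term of the error scale, as `h ^ M ≤ |lam|^(-1/2)`
    intro M
    obtain ⟨Cq, hCq, h₁, hh₁, Hq⟩ := exists_bound_of_isBigO (hq (M + 8))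
    refine ⟨max K 1, lt_max_of_lt_left hK, min (min h₀ h₁) 1, by positivity, C + Cq,
      by positivity, fun h lam hreg hM y yp z zp hcomp => ?_⟩
    obtain ⟨hlam, hl1, -, -, hX0⟩ := hreg.bounds (lt_max_of_lt_left hK) (min_le_right _ _)
    have h1 := (H h lam (hreg.mono (le_max_left _ _)
      ((min_le_left _ _).trans (min_le_left _ _)))).2 y yp z zp hcomp
    have hE := h1.2.2.2.2
    obtain ⟨hh, hlt, -⟩ := hreg
    have hqb := Hq h hh (hlt.trans_le ((min_le_left _ _).trans (min_le_right _ _)))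
    have hXM := pow_le_rpow_neg_half ((le_max_right _ _).trans hl1) hM
    have hscale : h ^ (M + 8) ≤ errorScale h lam := by
      rw [errorScale_eq, pow_add, mul_comm]
      have : h ^ 8 * h ^ M ≤ h ^ 8 * ‖lam‖ ^ (-1 / 2 : ℝ) := by gcongr
      have : 0 ≤ h ^ 4 * (‖lam‖ ^ (-1 / 2 : ℝ)) ^ 2 + h ^ 2 * (‖lam‖ ^ (-1 / 2 : ℝ)) ^ 3 := by
        positivity
      linarith
    calc _ ≤ C * errorScale h lam + Cq * h ^ (M + 8) := norm_le_add_of_norm_sub_ofReal_le hE hqb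
      _ ≤ C * errorScale h lam + Cq * errorScale h lam := by gcongr
      _ = _ := by ring
  · -- both the error scale and `q` are `O(h ^ 5)`
    intro η hη
    obtain ⟨Cq, hCq, h₁, hh₁, Hq⟩ := exists_bound_of_isBigO (hq 5)
    refine ⟨max K 1, lt_max_of_lt_left hK, min (min h₀ h₁) (min 1 (η / (3 * C + Cq))),
      by positivity, fun h lam hreg y yp z zp hcomp => ?_⟩
    obtain ⟨-, -, -, hXh, hX0⟩ := hreg.bounds (lt_max_of_lt_left hK)
      ((min_le_right _ _).trans (min_le_left _ _))
    have h1 := (H h lam (hreg.mono (le_max_left _ _)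
      ((min_le_left _ _).trans (min_le_left _ _)))).2 y yp z zp hcomp
    have hE := h1.2.2.2.2
    obtain ⟨hh, hlt, -⟩ := hreg
    have hqb := Hq h hh (hlt.trans_le ((min_le_left _ _).trans (min_le_right _ _)))
    have hle : h ≤ 1 := (hlt.trans_le ((min_le_right _ _).trans (min_le_left _ _))).le
    have hsmall : (3 * C + Cq) * h ≤ η := by
      have := (hlt.trans_le ((min_le_right _ _).trans (min_le_right _ _))).le
      rw [le_div_iff₀ (by positivity)] at this
      linarith
    -- the threshold `K ≥ 1` of the regime gives `|lam| h² ≥ 1`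
    have hX : ‖lam‖ ^ (-1 / 2 : ℝ) ≤ h := by
      have : 1 ≤ √(max K 1) := Real.one_le_sqrt.mpr (le_max_right _ _)
      nlinarith
    have hscale : errorScale h lam ≤ 3 * h ^ 5 := by
      rw [errorScale_eq]
      set X := ‖lam‖ ^ (-1 / 2 : ℝ)
      calc h ^ 8 * X + h ^ 4 * X ^ 2 + h ^ 2 * X ^ 3
          ≤ h ^ 8 * h + h ^ 4 * h ^ 2 + h ^ 2 * h ^ 3 := by gcongr
        _ = h ^ 9 + h ^ 6 + h ^ 5 := by ring
        _ ≤ h ^ 5 + h ^ 5 + h ^ 5 := by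
            gcongr ?_ + ?_ + _ <;> exact pow_le_pow_of_le_one hh.le hle (by norm_num)
        _ = _ := by ring
    calc _ ≤ C * errorScale h lam + Cq * h ^ 5 := norm_le_add_of_norm_sub_ofReal_le hE hqb
      _ ≤ C * (3 * h ^ 5) + Cq * h ^ 5 := by gcongr
      _ = ((3 * C + Cq) * h) * h ^ 4 := by ring
      _ ≤ _ := by gcongr
  · -- the error scale and `q` have a factor `h` to spare against `|lam|^(-1/2) h²`
    intro η hη M
    obtain ⟨Cq, hCq, h₁, hh₁, Hq⟩ := exists_bound_of_isBigO (hq (M + 3))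
    refine ⟨max K 1, lt_max_of_lt_left hK, min (min h₀ h₁) (min 1 (η / (3 * C + Cq))),
      by positivity, fun h lam hreg hM y yp z zp hcomp => ?_⟩
    obtain ⟨-, hl1, -, hXh, hX0⟩ := hreg.bounds (lt_max_of_lt_left hK)
      ((min_le_right _ _).trans (min_le_left _ _))
    have h1 := (H h lam (hreg.mono (le_max_left _ _)
      ((min_le_left _ _).trans (min_le_left _ _)))).2 y yp z zp hcomp
    have hE := h1.2.2.2.2
    obtain ⟨hh, hlt, -⟩ := hreg
    have hqb := Hq h hh (hlt.trans_le ((min_le_left _ _).trans (min_le_right _ _)))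
    have hle : h ≤ 1 := (hlt.trans_le ((min_le_right _ _).trans (min_le_left _ _))).le
    have hsmall : (3 * C + Cq) * h ≤ η := by
      have := (hlt.trans_le ((min_le_right _ _).trans (min_le_right _ _))).le
      rw [le_div_iff₀ (by positivity)] at this
      linarith
    -- the threshold `K ≥ 1` of the regime gives `|lam| h² ≥ 1`
    have hX : ‖lam‖ ^ (-1 / 2 : ℝ) ≤ h := by
      have : 1 ≤ √(max K 1) := Real.one_le_sqrt.mpr (le_max_right _ _)
      nlinarith
    have hXM := pow_le_rpow_neg_half ((le_max_right _ _).trans hl1) hM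
    rw [errorScale_eq] at hE
    set X := ‖lam‖ ^ (-1 / 2 : ℝ)
    have hscale : h ^ 8 * X + h ^ 4 * X ^ 2 + h ^ 2 * X ^ 3 ≤ 3 * h * (X * h ^ 2) := by
      calc h ^ 8 * X + h ^ 4 * X ^ 2 + h ^ 2 * X ^ 3
          = (h ^ 6 + h ^ 2 * X + X * X) * (X * h ^ 2) := by ring
        _ ≤ (h ^ 6 + h ^ 2 * h + h * h) * (X * h ^ 2) := by gcongr
        _ = (h ^ 6 + h ^ 3 + h ^ 2) * (X * h ^ 2) := by ring
        _ ≤ (h + h + h) * (X * h ^ 2) := by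
            gcongr ?_ * _
            gcongr ?_ + ?_ + ?_ <;> exact pow_le_of_le_one hh.le hle (by norm_num)
        _ = _ := by ring
    calc _ ≤ C * (h ^ 8 * X + h ^ 4 * X ^ 2 + h ^ 2 * X ^ 3) + Cq * h ^ (M + 3) :=
          norm_le_add_of_norm_sub_ofReal_le hE hqb
      _ = C * (h ^ 8 * X + h ^ 4 * X ^ 2 + h ^ 2 * X ^ 3) + Cq * (h ^ M * h ^ 3) := by
          rw [pow_add]
      _ ≤ C * (3 * h * (X * h ^ 2)) + Cq * (X * h ^ 3) := by gcongr
      _ = ((3 * C + Cq) * h) * (X * h ^ 2) := by ring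
      _ ≤ _ := by gcongr
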